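/- **Proposition.** Let $\Gamma$ be a word hyperbolic group (with a fixed finite generating set and word length $|\cdot|_\Gamma$) whose Gromov boundary $\partial\Gamma$ is homeomorphic to a circle, for example the fundamental group of a closed surface of genus at least $2$; orient $\partial\Gamma$ by such a homeomorphism. Let $p<q$, $d=p+q$, and let $\rho:\Gamma\to \mathrm{SO}(p,q)\subset \mathrm{SL}(d,\mathbb R)$ be a $\Theta$-positive representation that is $\{1,\dots,p-1\}$-Anosov. Then $\rho$ has property $C_k$ for every $1\le k\le p-3$. *Anosov.* Let $\sigma_1\ge\dots\ge\sigma_d$ denote singular values. For $1\le j\le d-1$, $\rho$ is $j$-Anosov if there are $c,\mu>0$ with $\frac{\sigma_j}{\sigma_{j+1}}(\rho(\gamma))\ge c\,e^{\mu|\gamma|_\Gamma}$ for all $\gamma\in\Gamma$; for $j=d$ the condition is empty. If $g=K\,\mathrm{diag}(\sigma_1,\dots,\sigma_d)\,L$ with $K,L\in \mathrm{SO}(d)$, put $U_j(g)=K\langle e_1,\dots,e_j\rangle$. The $j$-th boundary map of a $j$-Anosov representation is $\xi_j:\partial\Gamma\to\mathrm{Gr}_j(\mathbb R^d)$, $\xi_j(x)=\lim_n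 U_j(\rho(\gamma_n))$ for every geodesic ray $(\gamma_n)$ with endpoint $x$; $\xi_d$ is constant equal to $\mathbb R^d$. *Property $C_k$.* $\rho$ is $\{k,k+1,d-k-2,d-k+1\}$-Anosov (so that the boundary maps in question exist), and for all pairwise distinct $x,y,z\in\partial\Gamma$ the sum $$\xi_{d-k-2}(x)+\bigl(\xi_k(y)\cap\xi_{d-k+1}(x)\bigr)+\xi_{k+1}(z)$$ is direct. *$\Theta$-positivity.* $\mathrm{SO}(p,q)$ is the group of matrices of determinant $1$ preserving the form $$Q=\begin{pmatrix}0&0&K\\0&J&0\\(-1)^pK&0&0\end{pmatrix},\quad J=\begin{pmatrix}0&0&(-1)^{p-1}\\0&-\mathrm{Id}_{q-p}&0\\(-1)^{p-1}&0&0\end{pmatrix},$$ where $K$ is the antidiagonal matrix of size $p-1$ with entries $1,-1,\dots,(-1)^p$ from top right to bottom left; $\mathrm{SO}_0(p,q)$ is its identity component. Let $\mathcal F$ be the space of flags of subspaces of dimensions $1,\dots,p-1,q+1,\dots,q+p-1$ whose first $p-1$ members are $Q$-isotropic and whose other members are their $Q$-orthogonals; let $Z,X\in\mathcal F$ be given by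 $Z^l=\langle e_1,\dots,e_l\rangle$, $X^l=\langle e_d,\dots,e_{d-l+1}\rangle$. For $1\le j\le p-2$ and $t>0$ let $E_j(t)$ be the matrix that differs from the identity only in the positions $(j,j+1)$ and $(d-j,d-j+1)$, where it equals $t$. For $v\in\mathbb R^{q-p+2}$ let $E_{p-1}(v)$ be the matrix that equals the identity except for the block $$\begin{pmatrix}1&v^t&\varepsilon\, q_J(v)\\0&\mathrm{Id}_{q-p+2}&\varepsilon Jv\\0&0&1\end{pmatrix},\qquad \varepsilon=(-1)^{p-1},\quad q_J(v)=\tfrac12v^tJv,$$ in rows and columns $p-1,\dots,q+2$. Let $V_\Theta$ be the set of $\overline v=(v_1,\dots,v_{p-1})$ with $v_1,\dots,v_{p-2}>0$ and $v_{p-1}\in\mathbb R^{q-p+2}$ with $q_J(v_{p-1})>0$ and positive first entry, and put $$ab(\overline v)=\prod_{j\le p-1,\ j\text{ even}}E_j(v_j)\cdot\prod_{j\le p-1,\ j\text{ odd}}E_j(v_j).$$ The positive elements are the products $P=ab(\overline v_1)\cdots ab(\overline v_{p-1})$ with $\overline v_i\in V_\Theta$. A triple $(A,B,C)\in\mathcal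 F^3$ is positive if $(gA,gB,gC)=(X,PX,Z)$ for some $g\in\mathrm{SO}_0(p,q)$ and some positive element $P$. The representation $\rho$ is $\Theta$-positive if there is a continuous $\rho$-equivariant map $\xi:\partial\Gamma\to\mathcal F$ such that $(\xi(z),\xi(y),\xi(x))$ is positive for every positively oriented triple $(z,y,x)$ in $\partial\Gamma$. -/

import Mathlib

noncomputable section

namespace ThetaPos

open Filter Topology

/-! ### Word metrics, hyperbolic groups and their Gromov boundary -/

section Boundary

variable {Γ : Type*} [Group Γ]

/-- Word length of `g` with respect to `S`: the least length of a word in `S ∪ S⁻¹` with value `g`. -/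
def wordLength (S : Finset Γ) (g : Γ) : ℕ :=
  sInf {n | ∃ l : List Γ, (∀ s ∈ l, s ∈ S ∨ s⁻¹ ∈ S) ∧ l.prod = g ∧ l.length = n}

/-- The (left invariant) word metric. -/
def wordDist (S : Finset Γ) (g h : Γ) : ℕ := wordLength S (g⁻¹ * h)

theorem wordDist_mul_left (S : Finset Γ) (a g h : Γ) :
    wordDist S (a * g) (a * h) = wordDist S g h := by
  simp [wordDist, mul_assoc]

/-- Gromov hyperbolicity of the word metric, by the four point condition. -/
def IsHyperbolic (S : Finset Γ) : Prop :=
  ∃ δ : ℕ, ∀ a b c e : Γ,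
    wordDist S a b + wordDist S c e ≤
      max (wordDist S a c + wordDist S b e) (wordDist S a e + wordDist S b c) + δ

/-- Geodesic rays in the Cayley graph, recorded by the sequence of their vertices; the starting
point is arbitrary. -/
structure GeodesicRay (S : Finset Γ) where
  vertex : ℕ → Γ
  isGeodesic : ∀ m n : ℕ, wordDist S (vertex m) (vertex (m + n)) = n

/-- Pointwise convergence of rays (`Γ` is discrete). -/
instance (S : Finset Γ) : TopologicalSpace (GeodesicRay S) :=
  TopologicalSpace.induced GeodesicRay.vertex
    (@Pi.topologicalSpace ℕ (fun _ => Γ) (fun _ => ⊥))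

/-- Two rays are asymptotic if they stay at bounded distance. -/
def Asymptotic (S : Finset Γ) (r s : GeodesicRay S) : Prop :=
  ∃ C : ℕ, ∀ n, wordDist S (r.vertex n) (s.vertex n) ≤ C

/-- The Gromov boundary: geodesic rays modulo the equivalence relation generated by being
asymptotic (which already is an equivalence relation when `S` generates `Γ`), with the quotient
topology. -/
def Boundary (S : Finset Γ) : Type _ := Quot (Asymptotic S)

instance (S : Finset Γ) : TopologicalSpace (Boundary S) :=
  inferInstanceAs (TopologicalSpace (Quot (Asymptotic S)))

/-- The endpoint at infinity of a geodesic ray. -/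
def GeodesicRay.endpoint {S : Finset Γ} (r : GeodesicRay S) : Boundary S := Quot.mk _ r

/-- Translate of a geodesic ray. -/
def GeodesicRay.translate {S : Finset Γ} (g : Γ) (r : GeodesicRay S) : GeodesicRay S where
  vertex n := g * r.vertex n
  isGeodesic m n := by rw [wordDist_mul_left]; exact r.isGeodesic m n

/-- The action of `Γ` on its boundary. -/
def Boundary.act {S : Finset Γ} (g : Γ) : Boundary S → Boundary S :=
  Quot.map (GeodesicRay.translate g) (by
    rintro r s ⟨C, hC⟩
    exact ⟨C, fun n => by
      simpa only [GeodesicRay.translate, wordDist_mul_left] using hC n⟩)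

end Boundary

/-! ### Anosov representations and their boundary maps -/

section Anosov

/-- The Euclidean space `ℝ^d`. -/
abbrev E (d : ℕ) : Type := EuclideanSpace ℝ (Fin d)

/-- The image of a subspace of `ℝ^d` under a matrix. -/
def mapSub {d : ℕ} (g : Matrix (Fin d) (Fin d) ℝ) (W : Submodule ℝ (E d)) : Submodule ℝ (E d) :=
  W.map (Matrix.toEuclideanLin g)

/-- The span of the first `l` vectors of the standard basis. -/
def firstSpan (d l : ℕ) : Submodule ℝ (E d) :=
  Submodule.span ℝ {v | ∃ i : Fin d, (i : ℕ) < l ∧ v = EuclideanSpace.single i 1}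

/-- The span of the last `l` vectors of the standard basis. -/
def lastSpan (d l : ℕ) : Submodule ℝ (E d) :=
  Submodule.span ℝ {v | ∃ i : Fin d, d ≤ (i : ℕ) + l ∧ v = EuclideanSpace.single i 1}

/-- The `j`-th singular value `σ_j` in decreasing order, for `1 ≤ j ≤ d` (so counted from `1`). -/
def sigma {d : ℕ} (g : Matrix (Fin d) (Fin d) ℝ) (j : ℕ) : ℝ :=
  (Matrix.toEuclideanLin g).singularValues (j - 1)

/-- `U` is a `j`-th Cartan attractor of `g`: for some Cartan decomposition `g = K a L`, with
`K, L ∈ SO(d)` and `a = diag(σ_1, …, σ_d)`, it is `K ⟨e_1, …, e_j⟩`. It is unique if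
`σ_j > σ_{j+1}`. -/
def IsCartanAttractor {d : ℕ} (j : ℕ) (g : Matrix (Fin d) (Fin d) ℝ) (U : Submodule ℝ (E d)) :
    Prop :=
  ∃ K ∈ Matrix.specialOrthogonalGroup (Fin d) ℝ, ∃ L ∈ Matrix.specialOrthogonalGroup (Fin d) ℝ,
    g = K * Matrix.diagonal (fun i : Fin d => sigma g ((i : ℕ) + 1)) * L ∧
      U = mapSub K (firstSpan d j)

variable {Γ : Type*} [Group Γ] {d : ℕ}

/-- `ρ` is `j`-Anosov, for `1 ≤ j ≤ d - 1`. -/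
def IsAnosov (S : Finset Γ) (ρ : Γ →* Matrix.SpecialLinearGroup (Fin d) ℝ) (j : ℕ) : Prop :=
  ∃ c > (0 : ℝ), ∃ μ > (0 : ℝ), ∀ γ : Γ,
    c * Real.exp (μ * (wordLength S γ : ℝ)) ≤
      sigma (ρ γ : Matrix (Fin d) (Fin d) ℝ) j / sigma (ρ γ : Matrix (Fin d) (Fin d) ℝ) (j + 1)

/-- `ξ` is the `j`-th boundary map of `ρ`: along every geodesic ray `(γ_n)`, the `j`-th Cartan
attractors of `ρ(γ_n)` converge to the value of `ξ` at the endpoint of the ray. Convergence in the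
Grassmannian is convergence of orthogonal projections; in particular `dim ξ(x) = j` for `j ≤ d`. -/
def IsBoundaryMap (S : Finset Γ) (ρ : Γ →* Matrix.SpecialLinearGroup (Fin d) ℝ) (j : ℕ)
    (ξ : Boundary S → Submodule ℝ (E d)) : Prop :=
  ∀ (r : GeodesicRay S) (U : ℕ → Submodule ℝ (E d)),
    (∀ n, IsCartanAttractor j (ρ (r.vertex n) : Matrix (Fin d) (Fin d) ℝ) (U n)) →
      Tendsto (fun n => (U n).starProjection) atTop (𝓝 (ξ r.endpoint).starProjection)

/-- Property `C_k` (for `1 ≤ k ≤ d - 2`): `ρ` is `j`-Anosov for `j = k, k + 1, d - k - 2, d - k + 1`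
(an empty condition for `j = 0` and `j = d`), hence has boundary maps `ξ_j`, and the sum
`ξ_{d-k-2}(x) + (ξ_k(y) ∩ ξ_{d-k+1}(x)) + ξ_{k+1}(z)` is direct for pairwise distinct `x, y, z`. -/
def PropertyC (S : Finset Γ) (ρ : Γ →* Matrix.SpecialLinearGroup (Fin d) ℝ) (k : ℕ) : Prop :=
  (∀ j ∈ ({k, k + 1, d - k - 2, d - k + 1} : Set ℕ), 0 < j → j < d → IsAnosov S ρ j) ∧
  ∃ ξ : ℕ → Boundary S → Submodule ℝ (E d),
    (∀ j ∈ ({k, k + 1, d - k - 2, d - k + 1} : Set ℕ), IsBoundaryMap S ρ j (ξ j)) ∧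
    ∀ x y z : Boundary S, x ≠ y → y ≠ z → x ≠ z →
      iSupIndep ![ξ (d - k - 2) x, ξ k y ⊓ ξ (d - k + 1) x, ξ (k + 1) z]

end Anosov

/-! ### The group `SO(p,q)`, for `p < q` -/

section Orthogonal

/-- The form `J` of signature `(1, q - p + 1)` on `ℝ^(q-p+2)`: antidiagonal corners `(-1)^(p-1)`,
and `-Id` in the middle. -/
def formJ (p q : ℕ) : Matrix (Fin (q + 2 - p)) (Fin (q + 2 - p)) ℝ :=
  Matrix.of fun s t =>
    if (s : ℕ) + t + 1 = q + 2 - p ∧ ((s : ℕ) = 0 ∨ (t : ℕ) = 0) then (-1) ^ (p - 1)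
    else if s = t ∧ 0 < (s : ℕ) ∧ (s : ℕ) + 1 < q + 2 - p then -1
    else 0

/-- The form `Q` of signature `(p, q)`, the block matrix with antidiagonal blocks `K`, `J`,
`(-1)^p K`, where `K` is the antidiagonal matrix of size `p - 1` with entries
`1, -1, …, (-1)^p` from top right to bottom left. Written out (indices from `0`): `-1` on
the diagonal in positions `p, …, q - 1`, and `(-1)^(min i j)` elsewhere on the antidiagonal. -/
def formQ (p q : ℕ) : Matrix (Fin (p + q)) (Fin (p + q)) ℝ :=
  Matrix.of fun i j =>
    if p ≤ (i : ℕ) ∧ (i : ℕ) < q then (if i = j then -1 else 0)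
    else if (i : ℕ) + j + 1 = p + q then (-1) ^ (min (i : ℕ) j)
    else 0

/-- The bilinear form of `Q`. -/
def bilinQ {p q : ℕ} (v w : E (p + q)) : ℝ := ∑ i, ∑ j, v i * formQ p q i j * w j

/-- The group `SO(p,q) = SO(Q)`. -/
def SO (p q : ℕ) : Subgroup (Matrix.SpecialLinearGroup (Fin (p + q)) ℝ) where
  carrier := {g | (g : Matrix (Fin (p + q)) (Fin (p + q)) ℝ).transpose * formQ p q *
    (g : Matrix (Fin (p + q)) (Fin (p + q)) ℝ) = formQ p q}
  one_mem' := by simp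
  mul_mem' := by
    intro a b ha hb
    simp only [Set.mem_ofPred_eq, Matrix.SpecialLinearGroup.coe_mul, Matrix.transpose_mul] at *
    calc _ = (b : Matrix (Fin (p + q)) (Fin (p + q)) ℝ).transpose *
          ((a : Matrix (Fin (p + q)) (Fin (p + q)) ℝ).transpose * formQ p q *
            (a : Matrix (Fin (p + q)) (Fin (p + q)) ℝ)) *
          (b : Matrix (Fin (p + q)) (Fin (p + q)) ℝ) := by simp only [mul_assoc]
      _ = formQ p q := by rw [ha, hb]
  inv_mem' := by
    intro a ha
    simp only [Set.mem_ofPred_eq] at *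
    have h : (a : Matrix (Fin (p + q)) (Fin (p + q)) ℝ) *
        ((a⁻¹ : Matrix.SpecialLinearGroup (Fin (p + q)) ℝ) : Matrix _ _ ℝ) = 1 := by
      rw [← Matrix.SpecialLinearGroup.coe_mul]; simp
    have h' := congrArg Matrix.transpose h
    rw [Matrix.transpose_mul, Matrix.transpose_one] at h'
    rw [← ha]
    calc _ = (((a⁻¹ : Matrix.SpecialLinearGroup (Fin (p + q)) ℝ) : Matrix _ _ ℝ).transpose *
          (a : Matrix (Fin (p + q)) (Fin (p + q)) ℝ).transpose) * formQ p q *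
          ((a : Matrix (Fin (p + q)) (Fin (p + q)) ℝ) *
            ((a⁻¹ : Matrix.SpecialLinearGroup (Fin (p + q)) ℝ) : Matrix _ _ ℝ)) := by
            simp only [mul_assoc]
      _ = _ := by rw [h, h', one_mul, mul_one, ha]

/-- `g` lies in `SO₀(p,q)`, the connected component of the identity in `SO(p,q)`. -/
def IsInSO₀ {p q : ℕ} (g : Matrix (Fin (p + q)) (Fin (p + q)) ℝ) : Prop :=
  g ∈ connectedComponentIn
    {h : Matrix (Fin (p + q)) (Fin (p + q)) ℝ |
      h.transpose * formQ p q * h = formQ p q ∧ h.det = 1} 1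

/-- The dimensions `1, …, p - 1, q + 1, …, q + p - 1` of the subspaces in the partial flags. -/
abbrev FlagIndex (p q : ℕ) : Type :=
  {l : ℕ // (1 ≤ l ∧ l ≤ p - 1) ∨ (q + 1 ≤ l ∧ l ≤ q + p - 1)}

/-- The partial flag manifold `F`: flags of subspaces with dimensions in `FlagIndex p q`, of which
the first `p - 1` are isotropic and the others are their `Q`-orthogonals. -/
structure IsotropicFlag (p q : ℕ) where
  sub : FlagIndex p q → Submodule ℝ (E (p + q))
  finrank_sub : ∀ l, Module.finrank ℝ (sub l) = l.1
  mono : ∀ l m : FlagIndex p q, l.1 ≤ m.1 → sub l ≤ sub m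
  isotropic : ∀ l : FlagIndex p q, l.1 ≤ p - 1 → ∀ v ∈ sub l, ∀ w ∈ sub l, bilinQ v w = 0
  orthogonal : ∀ l m : FlagIndex p q, l.1 ≤ p - 1 → l.1 + m.1 = p + q →
    ∀ v, v ∈ sub m ↔ ∀ w ∈ sub l, bilinQ v w = 0

end Orthogonal

/-! ### The positive semigroup and `Θ`-positive representations -/

section Positive

/-- For `1 ≤ k ≤ p - 2`, the matrix `E_k(t)` that differs from the identity only in the positions
`(k, k + 1)` and `(d - k, d - k + 1)` (counted from `1`, with `d = p + q`), where it is `t`. -/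
def elemShort (p q k : ℕ) (t : ℝ) : Matrix (Fin (p + q)) (Fin (p + q)) ℝ :=
  Matrix.of fun i j =>
    if i = j then 1
    else if ((i : ℕ) + 1 = k ∧ (j : ℕ) = k) ∨ ((i : ℕ) + k + 1 = p + q ∧ (j : ℕ) + k = p + q) then t
    else 0

/-- The matrix `E_{p-1}(v)`, `v ∈ ℝ^(q-p+2)`: the unipotent element of `SO(p,q)` which is the
identity except for the block
`(1, vᵀ, ε q_J(v); 0, Id, ε J v; 0, 0, 1)` in the rows and columns `p - 1, …, q + 2`
(counted from `1`), where `q_J(v) = (1/2) vᵀ J v` and `ε = (-1)^(p-1)`. -/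
def elemLast (p q : ℕ) (v : Fin (q + 2 - p) → ℝ) : Matrix (Fin (p + q)) (Fin (p + q)) ℝ :=
  Matrix.of fun i j =>
    if i = j then 1
    else if (i : ℕ) + 2 = p ∧ (j : ℕ) = q + 1 then
      (-1) ^ (p - 1) * ((1 / 2) * (v ⬝ᵥ (formJ p q).mulVec v))
    else if h : (i : ℕ) + 2 = p ∧ p ≤ (j : ℕ) + 1 ∧ (j : ℕ) ≤ q then
      v ⟨(j : ℕ) + 1 - p, by omega⟩
    else if h : (j : ℕ) = q + 1 ∧ p ≤ (i : ℕ) + 1 ∧ (i : ℕ) ≤ q then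
      (-1) ^ (p - 1) * (formJ p q).mulVec v ⟨(i : ℕ) + 1 - p, by omega⟩
    else 0

/-- The parameter set `V_Θ`: positive numbers `v_1, …, v_{p-2}` and a vector `v_{p-1}` in the cone
of vectors that are positive for `J` and have positive first entry. -/
structure VTheta (p q : ℕ) where
  coef : Fin (p - 2) → ℝ
  last : Fin (q + 2 - p) → ℝ
  coef_pos : ∀ j, 0 < coef j
  last_pos : 0 < last ⬝ᵥ (formJ p q).mulVec last
  last_first : ∀ i : Fin (q + 2 - p), (i : ℕ) = 0 → 0 < last i

/-- `E_j(v_j)` for `1 ≤ j ≤ p - 1`. -/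
def VTheta.elem {p q : ℕ} (v : VTheta p q) (j : ℕ) : Matrix (Fin (p + q)) (Fin (p + q)) ℝ :=
  if h : 1 ≤ j ∧ j ≤ p - 2 then elemShort p q j (v.coef ⟨j - 1, by omega⟩)
  else elemLast p q v.last

/-- `ab(v)`: the product of the `E_j(v_j)` with `j ≤ p - 1` even, times the product of those with
`j` odd. -/
def VTheta.ab {p q : ℕ} (v : VTheta p q) : Matrix (Fin (p + q)) (Fin (p + q)) ℝ :=
  (((List.range' 1 (p - 1)).filter (fun j => j % 2 = 0)).map v.elem).prod *
    (((List.range' 1 (p - 1)).filter (fun j => j % 2 = 1)).map v.elem).prod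

/-- The positive element `P(v_1, …, v_{h/2}) = ab(v_1) ⋯ ab(v_{h/2})`, where `h = 2 (p - 1)` is the
Coxeter number of `B_{p-1}`. -/
def posElem {p q : ℕ} (v : Fin (p - 1) → VTheta p q) : Matrix (Fin (p + q)) (Fin (p + q)) ℝ :=
  (List.ofFn fun i => (v i).ab).prod

/-- `(A, B, C)` is `Θ`-positive: `(gA, gB, gC) = (X, P X, Z)` for some `g ∈ SO₀(p,q)` and some
positive element `P`, where `X^l = ⟨e_d, …, e_{d-l+1}⟩` and `Z^l = ⟨e_1, …, e_l⟩`. -/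
def IsPositiveTriple {p q : ℕ} (A B C : IsotropicFlag p q) : Prop :=
  ∃ g : Matrix (Fin (p + q)) (Fin (p + q)) ℝ, IsInSO₀ g ∧ ∃ v : Fin (p - 1) → VTheta p q,
    ∀ l : FlagIndex p q,
      mapSub g (A.sub l) = lastSpan (p + q) l.1 ∧
      mapSub g (B.sub l) = mapSub (posElem v) (lastSpan (p + q) l.1) ∧
      mapSub g (C.sub l) = firstSpan (p + q) l.1

variable {Γ : Type*} [Group Γ] {p q : ℕ}

/-- `ρ : Γ → SO(p,q)` is `Θ`-positive, where the boundary circle is oriented through `φ`: there is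
a continuous `ρ`-equivariant map `ξ` from the boundary to `F` that sends positively oriented triples
to positive triples. -/
def IsThetaPositive (S : Finset Γ) (φ : Boundary S ≃ₜ UnitAddCircle) (ρ : Γ →* SO p q) : Prop :=
  ∃ ξ : Boundary S → IsotropicFlag p q,
    (∀ l, Continuous fun x => ((ξ x).sub l).starProjection) ∧
    (∀ γ x l, (ξ (Boundary.act γ x)).sub l =
      mapSub (ρ γ : Matrix.SpecialLinearGroup (Fin (p + q)) ℝ).1 ((ξ x).sub l)) ∧
    ∀ z y x : Boundary S, sbtw (φ z) (φ y) (φ x) → IsPositiveTriple (ξ z) (ξ y) (ξ x)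

end Positive

end ThetaPos

end

/-! Directness comes down to one `3 × 3` block. A group element moves a positive triple to `(X, P X,
Z)`, and the sum is then governed by the coordinates `d - k - 2, d - k - 1, d - k` (counted from
`0`), all at least `q + 1` because `k ≤ p - 3`. In that range the factor `E_{p-1}(v)` is the
identity and the factors `E_j(t)` are totally nonnegative. Since `P` is a product of `p - 1 ≥ 2`
matrices `ab` with positive superdiagonal there, its block is totally positive: `0 < P x z < P x y *
P y z` (`posElem_isPosFrom`). According to the cyclic orientation of the three boundary points,
directness is the nonvanishing of the minor `P x y * P y z - P x z` or of the corner `P x z`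
(`sum_eq_zero_imp_of_pos`).

The longer task is to show that the positive flag map `ξ` consists of the boundary maps defined by
Cartan attractors (`isBoundaryMap_flag`). Along a ray `γ_n` ending at `x`, a subsequence satisfies
`γ_n⁻¹ x → w`, `γ_n⁻¹ z → w'` for `z ≠ x`, and `γ_n y → x` for `y ≠ w'`, where `w ≠ w'`
(`exists_attracting_repelling`). Hence `ρ(γ_n)` carries almost constant transverse pairs of flags to
the fixed pair `ξ(x), ξ(z)`: in adapted frames it is block diagonal, with one middle block
preserving a form close to the Lorentzian form `J`. Choose `y` between `w` and `w'`. As `ρ(γ_n) ξ(y)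
→ ξ(x)`, the columns of a positive element are attracted to coordinate axes. Positive superdiagonal
entries turn this into domination between diagonal entries. For the middle block, the relevant part
of the column is a positive vector of `J`, and an almost Lorentzian matrix is bounded by its value
on such a vector (`tendsto_lorentz_div`). The resulting domination (`tendsto_div_diag`) makes the
Cartan attractors converge to `ξ(x)` (`tendsto_cartanAttractor`).

The Anosov conditions in dimensions near `d` follow from those near `0`, because singular values of
elements of `SO(p,q)` satisfy `σ_i σ_{d+1-i} = 1`. -/

noncomputable section
namespace ThetaPos
open Filter Topology

/-! ### Word metrics, geodesics and compactness of spaces of paths -/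

section WordMetric

variable {Γ : Type*} [Group Γ] {S : Finset Γ}

theorem exists_word (hS : Subgroup.closure (S : Set Γ) = ⊤) (g : Γ) :
    ∃ l : List Γ, (∀ s ∈ l, s ∈ S ∨ s⁻¹ ∈ S) ∧ l.prod = g ∧ l.length = wordLength S g := by
  have hne : {n | ∃ l : List Γ, (∀ s ∈ l, s ∈ S ∨ s⁻¹ ∈ S) ∧ l.prod = g ∧ l.length = n}.Nonempty := by
    have hg : g ∈ Subgroup.closure (S : Set Γ) := by rw [hS]; trivial
    rw [← Subgroup.mem_toSubmonoid, Subgroup.closure_toSubmonoid] at hg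
    obtain ⟨l, hl, hp⟩ := Submonoid.exists_list_of_mem_closure hg
    exact ⟨l.length, l, by simpa using hl, hp, rfl⟩
  exact Nat.sInf_mem hne

theorem wordLength_le {l : List Γ} (h : ∀ s ∈ l, s ∈ S ∨ s⁻¹ ∈ S) :
    wordLength S l.prod ≤ l.length :=
  Nat.sInf_le ⟨l, h, rfl, rfl⟩

theorem wordLength_one : wordLength S (1 : Γ) = 0 :=
  Nat.le_zero.mp (by simpa using wordLength_le (S := S) (l := []) (by simp))

theorem wordLength_mul_le (hS : Subgroup.closure (S : Set Γ) = ⊤) (g h : Γ) :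
    wordLength S (g * h) ≤ wordLength S g + wordLength S h := by
  obtain ⟨l, hl, rfl, hlen⟩ := exists_word hS g
  obtain ⟨m, hm, rfl, hmen⟩ := exists_word hS h
  rw [← hlen, ← hmen, ← List.prod_append, ← List.length_append]
  exact wordLength_le fun s hs => (List.mem_append.mp hs).elim (hl s) (hm s)

theorem wordLength_inv_le (hS : Subgroup.closure (S : Set Γ) = ⊤) (g : Γ) :
    wordLength S g⁻¹ ≤ wordLength S g := by
  obtain ⟨l, hl, rfl, hlen⟩ := exists_word hS g
  rw [← hlen, List.prod_inv_reverse]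
  refine (wordLength_le fun s hs => ?_).trans (by simp)
  simp only [List.mem_reverse, List.mem_map] at hs
  obtain ⟨t, ht, rfl⟩ := hs
  simpa [or_comm] using hl t ht

theorem wordLength_inv (hS : Subgroup.closure (S : Set Γ) = ⊤) (g : Γ) :
    wordLength S g⁻¹ = wordLength S g :=
  le_antisymm (wordLength_inv_le hS g) (by simpa using wordLength_inv_le hS g⁻¹)

theorem wordDist_self (g : Γ) : wordDist S g g = 0 := by
  simp [wordDist, wordLength_one]

theorem wordDist_comm (hS : Subgroup.closure (S : Set Γ) = ⊤) (g h : Γ) :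
    wordDist S g h = wordDist S h g := by
  rw [wordDist, ← wordLength_inv hS]; simp [wordDist]

theorem wordDist_triangle (hS : Subgroup.closure (S : Set Γ) = ⊤) (g h k : Γ) :
    wordDist S g k ≤ wordDist S g h + wordDist S h k := by
  have := wordLength_mul_le hS (g⁻¹ * h) (h⁻¹ * k)
  simpa [wordDist, mul_assoc] using this

theorem finite_wordBall (hS : Subgroup.closure (S : Set Γ) = ⊤) (n : ℕ) :
    {g : Γ | wordLength S g ≤ n}.Finite := by
  classical
  let T : Set Γ := (S : Set Γ) ∪ (S : Set Γ)⁻¹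
  have hT : T.Finite := S.finite_toSet.union S.finite_toSet.inv
  have hfin : ∀ n, {g : Γ | ∃ l : List Γ, (∀ s ∈ l, s ∈ S ∨ s⁻¹ ∈ S) ∧ l.prod = g ∧
      l.length = n}.Finite := by
    intro n
    induction n with
    | zero =>
      refine (Set.finite_singleton (1 : Γ)).subset ?_
      rintro g ⟨l, -, rfl, hl⟩
      simp [List.length_eq_zero_iff.mp hl]
    | succ n ih =>
      refine (hT.mul ih).subset ?_
      rintro g ⟨l, hl, rfl, hlen⟩
      cases l with
      | nil => simp at hlen
      | cons a l =>
        refine Set.mem_mul.mpr ⟨a, ?_, l.prod, ⟨l, fun s hs => hl s (by simp [hs]), rfl, by simpa using hlen⟩, by simp⟩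
        simpa [T] using hl a (by simp)
  refine ((Set.finite_Iic n).biUnion fun m _ => hfin m).subset fun g hg => ?_
  obtain ⟨l, hl, hp, hlen⟩ := exists_word hS g
  exact Set.mem_biUnion (show wordLength S g ∈ Set.Iic n from hg) ⟨l, hl, hp, hlen⟩

/-- `β` is a geodesic segment of length `n`, constant from `n` on. -/
theorem exists_geodesic (hS : Subgroup.closure (S : Set Γ) = ⊤) (a b : Γ) :
    ∃ β : ℕ → Γ, β 0 = a ∧ (∀ n, wordDist S a b ≤ n → β n = b) ∧
      (∀ i, wordDist S a (β i) ≤ i) ∧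
      ∀ i j, i ≤ j → j ≤ wordDist S a b → wordDist S (β i) (β j) = j - i := by
  obtain ⟨l, hl, hp, hlen⟩ := exists_word hS (a⁻¹ * b)
  have hle : ∀ i k, wordDist S (a * (l.take i).prod) (a * (l.take (i + k)).prod) ≤ k := by
    intro i k
    rw [wordDist_mul_left, wordDist]
    rw [List.take_add, List.prod_append, inv_mul_cancel_left]
    refine (wordLength_le fun s hs => hl s ?_).trans (by simp)
    exact List.mem_of_mem_drop (List.mem_of_mem_take hs)
  have hend : ∀ n, wordDist S a b ≤ n → a * (l.take n).prod = b := by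
    intro n hn
    rw [List.take_of_length_le (by rw [hlen]; exact hn), hp]; simp
  refine ⟨fun i => a * (l.take i).prod, by simp, hend, fun i => ?_, fun i j hij hj => ?_⟩
  · simpa using hle 0 i
  -- Subwords bound the three consecutive distances from above, and these bounds add up to `wordDist
  -- S a b`; the triangle inequality forces equality in each.
  · have h1 := hle i (j - i)
    rw [Nat.add_sub_cancel' hij] at h1
    have h0 := hle 0 i
    have h2 := hle j (wordDist S a b - j)
    rw [Nat.add_sub_cancel' hj, hend _ le_rfl] at h2
    simp only [zero_add, List.take_zero, List.prod_nil, mul_one] at h0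
    have h3 := wordDist_triangle hS a (a * (l.take i).prod) b
    have h4 := wordDist_triangle hS (a * (l.take i).prod) (a * (l.take j).prod) b
    simp only at *
    omega

/-- Word balls are finite, so by Tychonoff the paths confined at time `i` to the ball of radius `i`
form a compact space for pointwise convergence; convergence in a discrete space is eventual
equality. -/
theorem exists_subseq_eventually_eq (hS : Subgroup.closure (S : Set Γ) = ⊤) (o : Γ)
    (β : ℕ → ℕ → Γ) (h : ∀ n i, wordDist S o (β n i) ≤ i) :
    ∃ (ms : ℕ → ℕ) (b : ℕ → Γ), Tendsto ms atTop atTop ∧ ∀ i, ∀ᶠ n in atTop, β (ms n) i = b i := by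
  let _ : TopologicalSpace Γ := ⊥
  have : DiscreteTopology Γ := ⟨rfl⟩
  have hfin : ∀ i : ℕ, {g : Γ | wordDist S o g ≤ i}.Finite := by
    intro i
    refine ((finite_wordBall hS i).image (o * ·)).subset fun g hg => ⟨o⁻¹ * g, hg, by simp⟩
  have hK : IsCompact (Set.pi Set.univ fun i : ℕ => {g : Γ | wordDist S o g ≤ i}) :=
    isCompact_univ_pi fun i => (hfin i).isCompact
  obtain ⟨b, -, ms, hms, hlim⟩ := hK.tendsto_subseq (x := β) (fun n i _ => h n i)
  refine ⟨ms, b, hms.tendsto_atTop, fun i => ?_⟩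
  have := (tendsto_pi_nhds.mp hlim) i
  rw [nhds_discrete, tendsto_pure] at this
  exact this

theorem tendsto_endpoint {r : ℕ → GeodesicRay S} {s : GeodesicRay S}
    (h : ∀ i, ∀ᶠ n in atTop, (r n).vertex i = s.vertex i) :
    Tendsto (fun n => (r n).endpoint) atTop (𝓝 s.endpoint) := by
  have h1 : Tendsto r atTop (𝓝 s) := by
    let _ : TopologicalSpace Γ := ⊥
    have : DiscreteTopology Γ := ⟨rfl⟩
    rw [nhds_induced, tendsto_comap_iff]
    refine tendsto_pi_nhds.mpr fun i => ?_
    rw [nhds_discrete, tendsto_pure]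
    exact h i
  have h2 : Continuous (fun r : GeodesicRay S => r.endpoint) := continuous_quot_mk
  exact (h2.tendsto s).comp h1

/-- When `S` generates, symmetry and the triangle inequality make being asymptotic an equivalence
relation, so passing to the generated equivalence identifies nothing more. -/
theorem endpoint_eq_iff (hS : Subgroup.closure (S : Set Γ) = ⊤) (r s : GeodesicRay S) :
    r.endpoint = s.endpoint ↔ Asymptotic S r s := by
  have he : Equivalence (Asymptotic S) := by
    refine ⟨fun r => ⟨0, fun n => by rw [wordDist_self]⟩, ?_, ?_⟩
    · rintro r s ⟨C, hC⟩
      exact ⟨C, fun n => by rw [wordDist_comm hS]; exact hC n⟩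
    · rintro r s t ⟨C, hC⟩ ⟨D, hD⟩
      exact ⟨C + D, fun n => (wordDist_triangle hS _ _ _).trans (add_le_add (hC n) (hD n))⟩
  exact (Quot.eq (r := Asymptotic S)).trans he.eqvGen_iff

end WordMetric

/-! ### Convergence dynamics on the Gromov boundary -/

section Dynamics

variable {Γ : Type*} [Group Γ] {S : Finset Γ}

theorem act_endpoint (g : Γ) (r : GeodesicRay S) :
    Boundary.act g r.endpoint = (r.translate g).endpoint := rfl

/-- A ray from any base point asymptotic to a given ray, obtained as a limit of segments. -/
theorem exists_asymptotic_ray (hS : Subgroup.closure (S : Set Γ) = ⊤) (hyp : IsHyperbolic S)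
    (s : GeodesicRay S) (a : Γ) :
    ∃ t : GeodesicRay S, t.vertex 0 = a ∧ t.endpoint = s.endpoint ∧
      ∀ i, ∃ᶠ m in atTop, wordDist S a (t.vertex i) = i ∧
        i + wordDist S (t.vertex i) (s.vertex m) = wordDist S a (s.vertex m) := by
  obtain ⟨δ, hδ⟩ := hyp
  choose β h0 hend hle hgeo using fun m => exists_geodesic hS a (s.vertex m)
  obtain ⟨ms, b, hms, hb⟩ := exists_subseq_eventually_eq hS a β hle
  have hs : ∀ i j, i ≤ j → wordDist S (s.vertex i) (s.vertex j) = j - i := fun i j hij => by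
    have := s.isGeodesic i (j - i); rwa [Nat.add_sub_cancel' hij] at this
  have hlong : ∀ m, m ≤ wordDist S a (s.vertex m) + wordDist S a (s.vertex 0) := fun m => by
    have h1 := wordDist_triangle hS (s.vertex 0) a (s.vertex m)
    rw [hs 0 m (Nat.zero_le m), wordDist_comm hS (s.vertex 0) a] at h1; omega
  have hlen : ∀ i, ∀ᶠ n in atTop, i ≤ wordDist S a (s.vertex (ms n)) := fun i => by
    filter_upwards [hms.eventually_ge_atTop (i + wordDist S a (s.vertex 0))] with n hn
    have := hlong (ms n); omega
  have hgeob : ∀ i k, wordDist S (b i) (b (i + k)) = k := by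
    intro i k
    obtain ⟨n, h1, h2, h3⟩ := ((hb i).and ((hb (i + k)).and (hlen (i + k)))).exists
    rw [← h1, ← h2, hgeo (ms n) i (i + k) (by omega) h3]; omega
  have hb0 : b 0 = a := by
    obtain ⟨n, h1⟩ := (hb 0).exists
    rw [← h1, h0]
  have hfreq : ∀ i, ∃ᶠ m in atTop, wordDist S a (b i) = i ∧
        i + wordDist S (b i) (s.vertex m) = wordDist S a (s.vertex m) := by
    intro i
    have : ∀ᶠ n in atTop, wordDist S a (b i) = i ∧
        i + wordDist S (b i) (s.vertex (ms n)) = wordDist S a (s.vertex (ms n)) := by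
      filter_upwards [hb i, hlen i] with n h1 h2
      have h3 := hgeo (ms n) 0 i (Nat.zero_le i) h2
      have h4 := hgeo (ms n) i _ h2 le_rfl
      rw [h0, h1] at h3
      rw [h1, hend _ _ le_rfl] at h4
      omega
    exact hms.frequently this.frequently
  refine ⟨⟨b, hgeob⟩, hb0, ?_, hfreq⟩
  rw [endpoint_eq_iff hS]
  refine ⟨wordDist S a (s.vertex 0) + δ, fun i => ?_⟩
  obtain ⟨m, ⟨h1, h2⟩, h3⟩ := ((hfreq i).and_eventually (eventually_ge_atTop i)).exists
  -- Both terms of the maximum are at most `wordDist S a (s.vertex m)` plus the distance of the base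
  -- points: one by `hlong`, the other because `b i` lies on a geodesic from `a` to `s.vertex m`.
  have h4 := hδ (b i) (s.vertex i) a (s.vertex m)
  rw [wordDist_comm hS (b i) a, h1, hs i m h3] at h4
  have h5 := wordDist_triangle hS (s.vertex i) (s.vertex 0) a
  rw [wordDist_comm hS (s.vertex i) (s.vertex 0), hs 0 i (Nat.zero_le i),
    wordDist_comm hS (s.vertex 0) a] at h5
  have h6 := hlong m
  show wordDist S (b i) (s.vertex i) ≤ _
  omega

/-- Convergence dynamics: if `g n` maps the far end of the segment from `o'` towards `b'` to `o`
and the segment from `o` to `g n o'` tends to `b`, then `g n` contracts the complement of the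
endpoint of `b'` to the endpoint of `b`. -/
theorem tendsto_act_endpoint (hS : Subgroup.closure (S : Set Γ) = ⊤) (hyp : IsHyperbolic S)
    (g : ℕ → Γ) (o o' : Γ) (l : ℕ → ℕ) (hl : Tendsto l atTop atTop) (β : ℕ → ℕ → Γ)
    (h0 : ∀ n, β n 0 = o) (hend : ∀ n, β n (l n) = g n * o')
    (hgeo : ∀ n i j, i ≤ j → j ≤ l n → wordDist S (β n i) (β n j) = j - i)
    (b b' : GeodesicRay S) (hb : ∀ i, ∀ᶠ n in atTop, β n i = b.vertex i)
    (hb' : ∀ i, ∀ᶠ n in atTop, (g n)⁻¹ * β n (l n - i) = b'.vertex i)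
    (y : Boundary S) (hy : y ≠ b'.endpoint) :
    ∃ ms : ℕ → ℕ, Tendsto ms atTop atTop ∧
      Tendsto (fun n => Boundary.act (g (ms n)) y) atTop (𝓝 b.endpoint) := by
  obtain ⟨s₀, rfl⟩ := Quot.exists_rep y
  obtain ⟨s, hs0, hse, -⟩ := exists_asymptotic_ray hS hyp s₀ o'
  change s₀.endpoint ≠ _ at hy
  change ∃ ms : ℕ → ℕ, Tendsto ms atTop atTop ∧
      Tendsto (fun n => Boundary.act (g (ms n)) s₀.endpoint) atTop (𝓝 b.endpoint)
  rw [← hse] at hy ⊢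
  choose t ht0 hte htf using fun n => exists_asymptotic_ray hS hyp (s.translate (g n)) o
  obtain ⟨δ, hδ⟩ := hyp
  have hsd : ∀ i j, i ≤ j → wordDist S (s.vertex i) (s.vertex j) = j - i := fun i j hij => by
    have := s.isGeodesic i (j - i); rwa [Nat.add_sub_cancel' hij] at this
  -- Rays with distinct endpoints are not asymptotic, so they are more than `2 * δ` apart at some
  -- time `i`; this `i` bounds the Gromov products below.
  obtain ⟨i, hi⟩ : ∃ i, 2 * δ < wordDist S (s.vertex i) (b'.vertex i) := by
    by_contra! hcon
    exact hy ((endpoint_eq_iff hS _ _).mpr ⟨_, hcon⟩)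
  -- Equivalently, the Gromov product of `(g n)⁻¹ * o` and `s.vertex m` at `o'` is at most `i`. The
  -- choice of `i` excludes the first term of the maximum in the four point inequality `f1`, and the
  -- bound obtained excludes the first term in `f2`.
  have hprod : ∀ᶠ n in atTop, ∀ m, i ≤ m →
      l n + m ≤ wordDist S o (g n * s.vertex m) + 2 * i := by
    filter_upwards [hb' i, hl.eventually_ge_atTop i] with n h1 h2 m hm
    have e1 : wordDist S (b'.vertex i) o' = i := by
      rw [← h1, ← wordDist_mul_left S (g n), mul_inv_cancel_left, ← hend,
        hgeo n _ _ (Nat.sub_le _ _) le_rfl]; omega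
    have e2 : wordDist S (b'.vertex i) ((g n)⁻¹ * o) = l n - i := by
      rw [← h1, wordDist_mul_left, ← h0 n, wordDist_comm hS, hgeo n _ _ (Nat.zero_le _) (Nat.sub_le _ _)]
      omega
    have e3 : wordDist S ((g n)⁻¹ * o) o' = l n := by
      rw [← wordDist_mul_left S (g n), mul_inv_cancel_left, ← hend, ← h0 n,
        hgeo n _ _ (Nat.zero_le _) le_rfl]; omega
    have e4 : wordDist S o (g n * s.vertex m) = wordDist S ((g n)⁻¹ * o) (s.vertex m) := by
      rw [← wordDist_mul_left S (g n)⁻¹, inv_mul_cancel_left]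
    have e5 := hsd 0 m (Nat.zero_le m)
    have e6 := hsd 0 i (Nat.zero_le i)
    rw [hs0] at e5 e6
    have f1 := hδ (s.vertex i) (b'.vertex i) (s.vertex m) o'
    have f2 := hδ (b'.vertex i) (s.vertex m) ((g n)⁻¹ * o) o'
    rw [wordDist_comm hS (s.vertex m) o', wordDist_comm hS (s.vertex i) o', hsd i m hm, e1, e5, e6] at f1
    rw [wordDist_comm hS (s.vertex m) o', wordDist_comm hS (s.vertex m) ((g n)⁻¹ * o), e1, e2, e3, e5] at f2
    omega
  -- By `hprod` the path from `o` through `g n * o'` to `g n * s.vertex m` is geodesic up to an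
  -- error `2 * i`, so it fellow-travels a geodesic through `(t n).vertex j`.
  have hclose : ∀ j, ∀ᶠ n in atTop, wordDist S ((t n).vertex j) (β n j) ≤ 2 * i + δ := by
    intro j
    filter_upwards [hprod, hl.eventually_ge_atTop j] with n h1 h2
    obtain ⟨m, ⟨h3, h4⟩, h5⟩ := ((htf n j).and_eventually (eventually_ge_atTop i)).exists
    have h6 := h1 m h5
    change j + wordDist S ((t n).vertex j) (g n * s.vertex m) = wordDist S o (g n * s.vertex m) at h4
    have f1 := hδ ((t n).vertex j) (β n j) o (g n * s.vertex m)
    have f2 := wordDist_triangle hS (β n j) (g n * o') (g n * s.vertex m)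
    rw [wordDist_mul_left, ← hend, hgeo n _ _ h2 le_rfl, ← hs0, hsd 0 m (Nat.zero_le m)] at f2
    have f3 : wordDist S (β n j) o = j := by
      rw [← h0 n, wordDist_comm hS, hgeo n _ _ (Nat.zero_le _) h2]; omega
    rw [wordDist_comm hS _ o, h3, f3] at f1
    omega
  have htd : ∀ n i, wordDist S o ((t n).vertex i) ≤ i := fun n i => by
    have := (t n).isGeodesic 0 i
    rw [ht0, zero_add] at this; omega
  obtain ⟨ms, c, hms, hc⟩ := exists_subseq_eventually_eq hS o (fun n => (t n).vertex) htd
  let c' : GeodesicRay S := ⟨c, fun m k => by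
    obtain ⟨n, h1, h2⟩ := ((hc m).and (hc (m + k))).exists
    rw [← h1, ← h2, (t (ms n)).isGeodesic]⟩
  refine ⟨ms, hms, ?_⟩
  have hcb : c'.endpoint = b.endpoint := by
    rw [endpoint_eq_iff hS]
    refine ⟨2 * i + δ, fun j => ?_⟩
    obtain ⟨n, h1, h2, h3⟩ := ((hc j).and ((hms.eventually (hclose j)).and (hms.eventually (hb j)))).exists
    show wordDist S (c j) _ ≤ _
    rw [← h1, ← h3]; exact h2
  rw [← hcb]
  have := tendsto_endpoint (r := fun n => t (ms n)) (s := c') hc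
  refine this.congr fun n => ?_
  rw [hte, act_endpoint]

/-- The hypotheses are inherited by subsequences, so the convergence along some subsequence upgrades
to the whole sequence. -/
theorem tendsto_act_endpoint_full (hS : Subgroup.closure (S : Set Γ) = ⊤) (hyp : IsHyperbolic S)
    (g : ℕ → Γ) (o o' : Γ) (l : ℕ → ℕ) (hl : Tendsto l atTop atTop) (β : ℕ → ℕ → Γ)
    (h0 : ∀ n, β n 0 = o) (hend : ∀ n, β n (l n) = g n * o')
    (hgeo : ∀ n i j, i ≤ j → j ≤ l n → wordDist S (β n i) (β n j) = j - i)
    (b b' : GeodesicRay S) (hb : ∀ i, ∀ᶠ n in atTop, β n i = b.vertex i)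
    (hb' : ∀ i, ∀ᶠ n in atTop, (g n)⁻¹ * β n (l n - i) = b'.vertex i)
    (y : Boundary S) (hy : y ≠ b'.endpoint) :
    Tendsto (fun n => Boundary.act (g n) y) atTop (𝓝 b.endpoint) := by
  refine tendsto_of_subseq_tendsto fun ns hns => ?_
  obtain ⟨ms, -, h⟩ := tendsto_act_endpoint hS hyp (fun n => g (ns n)) o o' (fun n => l (ns n))
    (hl.comp hns) (fun n => β (ns n)) (fun n => h0 _) (fun n => hend _) (fun n => hgeo _) b b'
    (fun i => hns.eventually (hb i)) (fun i => hns.eventually (hb' i)) y hy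
  exact ⟨ms, h⟩

/-- The action of the vertices of a geodesic ray on the boundary, along a subsequence. -/
theorem exists_attracting_repelling (hS : Subgroup.closure (S : Set Γ) = ⊤)
    (hyp : IsHyperbolic S) (r : GeodesicRay S) (ns : ℕ → ℕ) (hns : Tendsto ns atTop atTop) :
    ∃ (ms : ℕ → ℕ) (w w' : Boundary S), Tendsto ms atTop atTop ∧ w ≠ w' ∧
      Tendsto (fun n => Boundary.act (r.vertex (ns (ms n)))⁻¹ r.endpoint) atTop (𝓝 w) ∧
      (∀ z, z ≠ r.endpoint →
        Tendsto (fun n => Boundary.act (r.vertex (ns (ms n)))⁻¹ z) atTop (𝓝 w')) ∧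
      ∀ y, y ≠ w' →
        Tendsto (fun n => Boundary.act (r.vertex (ns (ms n))) y) atTop (𝓝 r.endpoint) := by
  have hr : ∀ i j, i ≤ j → wordDist S (r.vertex i) (r.vertex j) = j - i := fun i j hij => by
    have := r.isGeodesic i (j - i); rwa [Nat.add_sub_cancel' hij] at this
  -- Seen from the vertex `r.vertex (ns n)`, the part of the ray already travelled converges to a
  -- ray `b` and the part still ahead to a ray `c`. Their endpoints are `w'` and `w`.
  obtain ⟨ms₁, b₁, hms₁, hb₁⟩ := exists_subseq_eventually_eq hS (1 : Γ)
    (fun n i => (r.vertex (ns n))⁻¹ * r.vertex (ns n - i)) (fun n i => by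
      have : wordDist S (r.vertex (ns n)) (r.vertex (ns n - i)) ≤ i := by
        rw [wordDist_comm hS, hr _ _ (Nat.sub_le _ _)]; omega
      rwa [← wordDist_mul_left S (r.vertex (ns n))⁻¹, inv_mul_cancel] at this)
  obtain ⟨ms₂, c₁, hms₂, hc₁⟩ := exists_subseq_eventually_eq hS (1 : Γ)
    (fun n i => (r.vertex (ns (ms₁ n)))⁻¹ * r.vertex (ns (ms₁ n) + i)) (fun n i => by
      have : wordDist S (r.vertex (ns (ms₁ n))) (r.vertex (ns (ms₁ n) + i)) ≤ i := by
        rw [hr _ _ (Nat.le_add_right _ _)]; omega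
      rwa [← wordDist_mul_left S (r.vertex (ns (ms₁ n)))⁻¹, inv_mul_cancel] at this)
  set ms := fun n => ms₁ (ms₂ n) with hmsdef
  have hms : Tendsto ms atTop atTop := hms₁.comp hms₂
  have hN : Tendsto (fun n => ns (ms n)) atTop atTop := hns.comp hms
  have hb : ∀ i, ∀ᶠ n in atTop, (r.vertex (ns (ms n)))⁻¹ * r.vertex (ns (ms n) - i) = b₁ i :=
    fun i => hms₂.eventually (hb₁ i)
  let c : GeodesicRay S := ⟨c₁, fun m k => by
    obtain ⟨n, h1, h2⟩ := ((hc₁ m).and (hc₁ (m + k))).exists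
    rw [← h1, ← h2, wordDist_mul_left, hr _ _ (by omega)]; omega⟩
  let b : GeodesicRay S := ⟨b₁, fun m k => by
    obtain ⟨n, h1, h2, h3⟩ := ((hb m).and ((hb (m + k)).and (hN.eventually_ge_atTop (m + k)))).exists
    rw [← h1, ← h2, wordDist_mul_left, wordDist_comm hS, hr _ _ (by omega)]; omega⟩
  refine ⟨ms, c.endpoint, b.endpoint, hms, ?_, ?_, ?_, ?_⟩
  -- `b` and `c` are opposite halves of a limit of translated geodesics, so at time `C + 1` they are
  -- `2 * (C + 1)` apart.
  · intro heq
    obtain ⟨C, hC⟩ := (endpoint_eq_iff hS _ _).mp heq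
    obtain ⟨n, h1, h2, h3⟩ := ((hc₁ (C + 1)).and ((hb (C + 1)).and
      (hN.eventually_ge_atTop (C + 1)))).exists
    have h4 := hC (C + 1)
    change wordDist S (c₁ (C + 1)) (b₁ (C + 1)) ≤ C at h4
    have e : ms₁ (ms₂ n) = ms n := rfl
    rw [← h1, ← h2, wordDist_mul_left, wordDist_comm hS, e, hr _ _ (by omega)] at h4
    omega
  · let R : ℕ → GeodesicRay S := fun n =>
      ⟨fun i => (r.vertex (ns (ms n)))⁻¹ * r.vertex (ns (ms n) + i), fun m k => by
        rw [wordDist_mul_left, hr _ _ (by omega)]; omega⟩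
    have h := tendsto_endpoint (r := R) (s := c) hc₁
    refine h.congr fun n => ?_
    rw [act_endpoint, endpoint_eq_iff hS]
    refine ⟨ns (ms n), fun i => ?_⟩
    show wordDist S ((r.vertex (ns (ms n)))⁻¹ * r.vertex (ns (ms n) + i))
      ((r.vertex (ns (ms n)))⁻¹ * r.vertex i) ≤ _
    rw [wordDist_mul_left, wordDist_comm hS, hr _ _ (by omega)]; omega
  · intro z hz
    refine tendsto_act_endpoint_full hS hyp (fun n => (r.vertex (ns (ms n)))⁻¹) 1 (r.vertex 0)
      (fun n => ns (ms n)) hN (fun n i => (r.vertex (ns (ms n)))⁻¹ * r.vertex (ns (ms n) - i))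
      (fun n => by simp) (fun n => by simp) (fun n i j hij hj => ?_) b r hb (fun i => ?_) z hz
    · show wordDist S ((r.vertex (ns (ms n)))⁻¹ * _) ((r.vertex (ns (ms n)))⁻¹ * _) = _
      rw [wordDist_mul_left, wordDist_comm hS, hr _ _ (by omega)]
      omega
    · filter_upwards [hN.eventually_ge_atTop i] with n hn
      rw [inv_inv, mul_inv_cancel_left, Nat.sub_sub_self hn]
  · intro y hy
    exact tendsto_act_endpoint_full hS hyp (fun n => r.vertex (ns (ms n))) (r.vertex 0) 1
      (fun n => ns (ms n)) hN (fun n => r.vertex) (fun n => rfl) (fun n => by simp)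
      (fun n i j hij hj => hr i j hij) r b (fun i => Eventually.of_forall fun n => rfl) hb y hy

end Dynamics

/-! ### Matrices acting on Euclidean space and coordinate subspaces -/

section EuclideanLin

variable {d : ℕ}

theorem lin_apply (A : Matrix (Fin d) (Fin d) ℝ) (v : E d) (i : Fin d) :
    Matrix.toEuclideanLin A v i = ∑ j, A i j * v j := rfl

theorem lin_mul (A B : Matrix (Fin d) (Fin d) ℝ) (v : E d) :
    Matrix.toEuclideanLin (A * B) v = Matrix.toEuclideanLin A (Matrix.toEuclideanLin B v) := by
  simp [Matrix.toLpLin_apply, Matrix.mulVec_mulVec]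

theorem lin_one (v : E d) : Matrix.toEuclideanLin (1 : Matrix (Fin d) (Fin d) ℝ) v = v := by
  ext i
  simp

theorem lin_injective {A B : Matrix (Fin d) (Fin d) ℝ} (h : A * B = 1) :
    Function.Injective (Matrix.toEuclideanLin B) := fun v w hvw => by
  have := congrArg (Matrix.toEuclideanLin A) hvw
  rwa [← lin_mul, ← lin_mul, h, lin_one, lin_one] at this

theorem lin_single (A : Matrix (Fin d) (Fin d) ℝ) (i j : Fin d) :
    Matrix.toEuclideanLin A (EuclideanSpace.single j 1) i = A i j := by
  simp [lin_apply]

theorem mem_span_single_iff (p : Fin d → Prop) (v : E d) :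
    v ∈ Submodule.span ℝ {v : E d | ∃ i : Fin d, p i ∧ v = EuclideanSpace.single i 1} ↔
      ∀ i, ¬ p i → v i = 0 := by
  classical
  constructor
  · intro h i hi
    refine Submodule.span_induction (p := fun v _ => v i = 0) ?_ (by simp) ?_ ?_ h
    · rintro _ ⟨j, hj, rfl⟩
      have : i ≠ j := fun h => hi (h ▸ hj)
      simp [this]
    · intro x y _ _ hx hy; simp [hx, hy]
    · intro a x _ hx; simp [hx]
  · intro h
    have hv : v = ∑ i, v i • (EuclideanSpace.single i (1 : ℝ) : E d) := by
      ext i; simp [Pi.single_apply]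
    rw [hv]
    refine Submodule.sum_mem _ fun i _ => ?_
    by_cases hp : p i
    · exact Submodule.smul_mem _ _ (Submodule.subset_span ⟨i, hp, rfl⟩)
    · simp [h i hp]

theorem mem_firstSpan {l : ℕ} {v : E d} : v ∈ firstSpan d l ↔ ∀ i : Fin d, l ≤ i → v i = 0 := by
  rw [firstSpan, mem_span_single_iff]
  simp only [not_lt]

theorem mem_lastSpan {l : ℕ} {v : E d} :
    v ∈ lastSpan d l ↔ ∀ i : Fin d, (i : ℕ) + l < d → v i = 0 := by
  rw [lastSpan, mem_span_single_iff]
  simp only [not_le]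

theorem finrank_firstSpan {l : ℕ} (hl : l ≤ d) : Module.finrank ℝ (firstSpan d l) = l := by
  have h : firstSpan d l = Submodule.span ℝ (Set.range fun i : Fin l =>
      (EuclideanSpace.single (Fin.castLE hl i) (1 : ℝ) : E d)) := by
    rw [firstSpan]
    congr 1
    ext v
    constructor
    · rintro ⟨i, hi, rfl⟩
      exact ⟨⟨i, hi⟩, rfl⟩
    · rintro ⟨i, rfl⟩
      exact ⟨Fin.castLE hl i, i.2, rfl⟩
  rw [h, finrank_span_eq_card, Fintype.card_fin]
  have := (EuclideanSpace.basisFun (Fin d) ℝ).orthonormal.linearIndependent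
  simpa [Function.comp_def] using this.comp (Fin.castLE hl) (Fin.castLE_injective hl)

theorem finrank_mapSub {A B : Matrix (Fin d) (Fin d) ℝ} (h : A * B = 1)
    (W : Submodule ℝ (E d)) : Module.finrank ℝ (mapSub B W) = Module.finrank ℝ W :=
  (Submodule.equivMapOfInjective _ (lin_injective h) W).finrank_eq.symm

theorem norm_lin_orthogonal {K : Matrix (Fin d) (Fin d) ℝ}
    (hK : K ∈ Matrix.specialOrthogonalGroup (Fin d) ℝ) (v : E d) :
    ‖Matrix.toEuclideanLin K v‖ = ‖v‖ := by
  have h1 : K.conjTranspose * K = 1 := by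
    have := (Matrix.mem_specialOrthogonalGroup_iff.mp hK).1
    simpa [Matrix.star_eq_conjTranspose] using (Matrix.mem_orthogonalGroup_iff' _ _).mp this
  have h2 : inner ℝ (Matrix.toEuclideanLin K v) (Matrix.toEuclideanLin K v) = inner ℝ v v := by
    rw [← LinearMap.adjoint_inner_left, ← Matrix.toEuclideanLin_conjTranspose_eq_adjoint, ← lin_mul,
      h1, lin_one]
  rw [real_inner_self_eq_norm_sq, real_inner_self_eq_norm_sq] at h2
  exact (sq_eq_sq₀ (norm_nonneg _) (norm_nonneg _)).mp h2

theorem exists_norm_lin_le (A : Matrix (Fin d) (Fin d) ℝ) :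
    ∃ C > 0, ∀ v : E d, ‖Matrix.toEuclideanLin A v‖ ≤ C * ‖v‖ := by
  obtain ⟨C, hC, h⟩ := (LinearMap.toContinuousLinearMap (Matrix.toEuclideanLin A)).bound
  exact ⟨C, hC, h⟩

theorem tendsto_euclidean {v : ℕ → E d} {v₀ : E d}
    (h : ∀ i, Tendsto (fun n => v n i) atTop (𝓝 (v₀ i))) : Tendsto v atTop (𝓝 v₀) :=
  ((PiLp.continuous_toLp 2 (fun _ : Fin d => ℝ)).tendsto v₀.ofLp).comp (tendsto_pi_nhds.mpr h)

theorem Tendsto.euclidean_apply {v : ℕ → E d} {v₀ : E d} (h : Tendsto v atTop (𝓝 v₀)) (i : Fin d) :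
    Tendsto (fun n => v n i) atTop (𝓝 (v₀ i)) :=
  tendsto_pi_nhds.mp (((PiLp.continuous_ofLp 2 (fun _ : Fin d => ℝ)).tendsto v₀).comp h) i

theorem tendsto_lin {A : ℕ → Matrix (Fin d) (Fin d) ℝ} {A₀ : Matrix (Fin d) (Fin d) ℝ}
    (hA : ∀ i j, Tendsto (fun n => A n i j) atTop (𝓝 (A₀ i j))) {v : ℕ → E d} {v₀ : E d}
    (hv : Tendsto v atTop (𝓝 v₀)) :
    Tendsto (fun n => Matrix.toEuclideanLin (A n) (v n)) atTop (𝓝 (Matrix.toEuclideanLin A₀ v₀)) :=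
  tendsto_euclidean fun i => by
    simp only [lin_apply]
    exact tendsto_finsetSum _ fun j _ => (hA i j).mul (Tendsto.euclidean_apply hv j)

theorem abs_apply_le_norm (v : E d) (i : Fin d) : |v i| ≤ ‖v‖ := by
  simpa using PiLp.norm_apply_le v i

theorem norm_le_sum_abs (v : E d) : ‖v‖ ≤ ∑ i, |v i| := by
  classical
  have hv : v = ∑ i, v i • (EuclideanSpace.single i (1 : ℝ) : E d) := by
    ext i; simp [Pi.single_apply]
  calc ‖v‖ = ‖∑ i, v i • (EuclideanSpace.single i (1 : ℝ) : E d)‖ := by rw [← hv]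
    _ ≤ ∑ i, ‖v i • (EuclideanSpace.single i (1 : ℝ) : E d)‖ := norm_sum_le _ _
    _ = ∑ i, |v i| := by simp [norm_smul]

end EuclideanLin

/-! ### Convergence of subspaces through orthogonal projections -/

section Projections

variable {d : ℕ}

theorem tendsto_clm_of_apply {T : ℕ → E d →L[ℝ] E d} {T₀ : E d →L[ℝ] E d}
    (h : ∀ i, Tendsto (fun n => T n (EuclideanSpace.single i 1)) atTop
      (𝓝 (T₀ (EuclideanSpace.single i 1)))) : Tendsto T atTop (𝓝 T₀) := by
  let b := (EuclideanSpace.basisFun (Fin d) ℝ).toBasis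
  let f : (Fin d → E d) →ₗ[ℝ] (E d →L[ℝ] E d) :=
    (LinearMap.toContinuousLinearMap (𝕜 := ℝ) (E := E d) (F' := E d)).toLinearMap ∘ₗ
      (b.constr ℝ).toLinearMap
  have hf : Continuous f := f.continuous_of_finiteDimensional
  have key : ∀ U : E d →L[ℝ] E d, f (fun i => U (EuclideanSpace.single i 1)) = U := by
    intro U
    ext1 v
    have : b.constr ℝ (fun i => U (EuclideanSpace.single i 1)) = U.toLinearMap :=
      b.ext fun i => by rw [Module.Basis.constr_basis]; simp [b]
    exact LinearMap.congr_fun this v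
  rw [← key T₀]
  exact ((hf.tendsto _).comp (tendsto_pi_nhds.mpr h)).congr fun n => key _

theorem tendsto_clm_apply {F G : Type*} [NormedAddCommGroup F] [NormedSpace ℝ F]
    [NormedAddCommGroup G] [NormedSpace ℝ G] {T : ℕ → F →L[ℝ] G} {T₀ : F →L[ℝ] G}
    (hT : Tendsto T atTop (𝓝 T₀)) {v : ℕ → F} {v₀ : F} (hv : Tendsto v atTop (𝓝 v₀)) :
    Tendsto (fun n => T n (v n)) atTop (𝓝 (T₀ v₀)) :=
  ((continuous_fst.clm_apply continuous_snd).tendsto (T₀, v₀)).comp (hT.prodMk_nhds hv)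

/-- Transverse intersections of convergent sequences of subspaces are lower semicontinuous. -/
theorem exists_tendsto_mem_inter {A C : ℕ → Submodule ℝ (E d)} {A₀ C₀ : Submodule ℝ (E d)}
    (hA : Tendsto (fun n => (A n).starProjection) atTop (𝓝 A₀.starProjection))
    (hC : Tendsto (fun n => (C n).starProjection) atTop (𝓝 C₀.starProjection))
    (htop : A₀ ⊔ C₀ = ⊤) {v : E d} (hvA : v ∈ A₀) (hvC : v ∈ C₀) :
    ∃ u : ℕ → E d, (∀ n, u n ∈ A n) ∧ (∀ n, u n ∈ C n) ∧ Tendsto u atTop (𝓝 v) := by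
  let pr₁ := ContinuousLinearMap.fst ℝ (E d) (E d)
  let pr₂ := ContinuousLinearMap.snd ℝ (E d) (E d)
  -- A pair in the kernel of `D n` yields a common vector of `A n` and `C n`. Since `A₀ ⊔ C₀ = ⊤`,
  -- the map `D₀` has a right inverse `T`, and `D n ∘ T` is eventually invertible. This gives a
  -- correction `c n → 0` moving `(v, v)`, which lies in the kernel of `D₀`, into the kernel of `D
  -- n`.
  let D₀ : E d × E d →L[ℝ] E d := A₀.starProjection ∘L pr₁ - C₀.starProjection ∘L pr₂
  let D : ℕ → E d × E d →L[ℝ] E d := fun n =>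
    (A n).starProjection ∘L pr₁ - (C n).starProjection ∘L pr₂
  have hD : Tendsto D atTop (𝓝 D₀) :=
    ((((ContinuousLinearMap.precomp (E d) pr₁).continuous.tendsto _).comp hA)).sub
      (((ContinuousLinearMap.precomp (E d) pr₂).continuous.tendsto _).comp hC)
  have hsurj : LinearMap.range D₀.toLinearMap = ⊤ := by
    rw [LinearMap.range_eq_top]
    intro x
    have hx : x ∈ A₀ ⊔ C₀ := by rw [htop]; trivial
    obtain ⟨y, hy, z, hz, rfl⟩ := Submodule.mem_sup.mp hx
    refine ⟨(y, -z), ?_⟩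
    simp [D₀, pr₁, pr₂, Submodule.starProjection_eq_self_iff.mpr hy,
      Submodule.starProjection_eq_self_iff.mpr hz]
  obtain ⟨T₀, hT₀⟩ := D₀.toLinearMap.exists_rightInverse_of_surjective hsurj
  let T := LinearMap.toContinuousLinearMap T₀
  have hDT : D₀ ∘L T = 1 := by
    ext1 x
    exact LinearMap.congr_fun hT₀ x
  have hlim : Tendsto (fun n => D n ∘L T) atTop (𝓝 1) := by
    rw [← hDT]
    exact ((ContinuousLinearMap.precomp (E d) T).continuous.tendsto _).comp hD
  have hunit : ∀ᶠ n in atTop, IsUnit (D n ∘L T) :=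
    hlim.eventually (Units.isOpen.mem_nhds isUnit_one)
  have hinv : Tendsto (fun n => Ring.inverse (D n ∘L T)) atTop (𝓝 1) := by
    have := NormedRing.inverse_continuousAt (1 : (E d →L[ℝ] E d)ˣ)
    have h2 := this.tendsto.comp hlim
    simpa [Function.comp_def] using h2
  let c : ℕ → E d × E d := fun n => T (Ring.inverse (D n ∘L T) (D n (v, v)))
  have hc : Tendsto c atTop (𝓝 0) := by
    have h1 : Tendsto (fun n => D n (v, v)) atTop (𝓝 (D₀ (v, v))) := tendsto_clm_apply hD tendsto_const_nhds
    have h2 : D₀ (v, v) = 0 := by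
      simp [D₀, pr₁, pr₂, Submodule.starProjection_eq_self_iff.mpr hvA,
        Submodule.starProjection_eq_self_iff.mpr hvC]
    rw [h2] at h1
    have h3 := tendsto_clm_apply hinv h1
    have h4 := (T.continuous.tendsto _).comp h3
    rwa [map_zero, map_zero] at h4
  have hu : Tendsto (fun n => (A n).starProjection (v - (c n).1)) atTop (𝓝 v) := by
    have h1 : Tendsto (fun n => v - (c n).1) atTop (𝓝 v) := by
      simpa using tendsto_const_nhds.sub ((continuous_fst.tendsto _).comp hc)
    have h2 := tendsto_clm_apply hA h1
    rwa [Submodule.starProjection_eq_self_iff.mpr hvA] at h2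
  have hmem : ∀ᶠ n in atTop, (A n).starProjection (v - (c n).1) ∈ C n := by
    filter_upwards [hunit] with n hn
    have h1 : D n ((v, v) - c n) = 0 := by
      have h2 : (D n ∘L T) ((Ring.inverse (D n ∘L T)) (D n (v, v))) = D n (v, v) := by
        rw [← mul_apply_eq_comp, Ring.mul_inverse_cancel _ hn]; rfl
      rw [map_sub, sub_eq_zero]; exact h2.symm
    have h3 : (A n).starProjection (v - (c n).1) = (C n).starProjection (v - (c n).2) :=
      sub_eq_zero.mp h1
    rw [h3]
    exact Submodule.starProjection_apply_mem _ _
  classical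
  -- The corrected vector lies in `C n` only eventually; `0` serves as a default elsewhere.
  refine ⟨fun n => if (A n).starProjection (v - (c n).1) ∈ C n then
    (A n).starProjection (v - (c n).1) else 0, fun n => ?_, fun n => ?_, ?_⟩
  · dsimp only; split_ifs
    · exact Submodule.starProjection_apply_mem _ _
    · exact zero_mem _
  · dsimp only; split_ifs with h
    · exact h
    · exact zero_mem _
  · refine hu.congr' ?_
    filter_upwards [hmem] with n hn
    rw [if_pos hn]

theorem trace_starProjection (W : Submodule ℝ (E d)) :
    LinearMap.trace ℝ (E d) W.starProjection.toLinearMap = Module.finrank ℝ W := by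
  refine LinearMap.IsProj.trace ⟨fun v => ?_, fun v hv => ?_⟩
  · exact Submodule.starProjection_apply_mem _ _
  · exact Submodule.starProjection_eq_self_iff.mpr hv

/-- Subspaces of constant dimension converge to `W` as soon as their projections tend to the
identity on `W`. -/
theorem tendsto_starProjection {U : ℕ → Submodule ℝ (E d)} {W : Submodule ℝ (E d)}
    (hdim : ∀ n, Module.finrank ℝ (U n) = Module.finrank ℝ W)
    (h : ∀ w ∈ W, Tendsto (fun n => (U n).starProjection w) atTop (𝓝 w)) :
    Tendsto (fun n => (U n).starProjection) atTop (𝓝 W.starProjection) := by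
  let b := EuclideanSpace.basisFun (Fin d) ℝ
  let P := W.starProjection
  have hPP : ∀ v, P (P v) = P v := fun v =>
    Submodule.starProjection_eq_self_iff.mpr (Submodule.starProjection_apply_mem _ _)
  -- In Hilbert–Schmidt norm, `‖U (1 - P)‖² = tr U - tr (P U P)` with `tr U = dim W`. If `U` tends
  -- to the identity on `W`, the right side tends to `0`, so `U` tends to `0` on the complement.
  have htr : ∀ n, ∑ i, ‖(U n).starProjection (b i - P (b i))‖ ^ 2 =
      Module.finrank ℝ W - ∑ i, inner ℝ (P (b i)) ((U n).starProjection (P (b i))) := by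
    intro n
    have e1 : ∀ x : E d, ‖(U n).starProjection x‖ ^ 2 = inner ℝ x ((U n).starProjection x) := by
      intro x
      have := Submodule.starProjection_inner_eq_zero (K := U n) x ((U n).starProjection x)
        (Submodule.starProjection_apply_mem _ _)
      rw [inner_sub_left, real_inner_self_eq_norm_sq] at this
      linarith
    let u := (U n).starProjection.toLinearMap
    let p := P.toLinearMap
    have hpp : p * p = p := LinearMap.ext hPP
    have e2 : LinearMap.trace ℝ (E d) ((1 - p) * u * (1 - p)) =
        LinearMap.trace ℝ (E d) u - LinearMap.trace ℝ (E d) (p * u * p) := by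
      have hq : (1 - p) * (1 - p) = 1 - p := by
        rw [sub_mul, mul_sub, mul_sub, hpp]; simp
      rw [LinearMap.trace_mul_comm, ← mul_assoc, hq, LinearMap.trace_mul_comm ℝ (p * u) p, ← mul_assoc, hpp,
        sub_mul, one_mul, map_sub]
    have hsa : ∀ x y : E d, inner ℝ (P x) y = inner ℝ x (P y) := fun x y =>
      Submodule.inner_starProjection_left_eq_right W x y
    have e3 : LinearMap.trace ℝ (E d) ((1 - p) * u * (1 - p)) =
        ∑ i, ‖(U n).starProjection (b i - P (b i))‖ ^ 2 := by
      rw [LinearMap.trace_eq_sum_inner _ b]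
      refine Finset.sum_congr rfl fun i _ => ?_
      rw [e1]
      simp only [Module.End.mul_apply, LinearMap.sub_apply, Module.End.one_apply, inner_sub_right,
        inner_sub_left, u, p, ContinuousLinearMap.coe_coe, map_sub, hsa]
    have e4 : LinearMap.trace ℝ (E d) (p * u * p) =
        ∑ i, inner ℝ (P (b i)) ((U n).starProjection (P (b i))) := by
      rw [LinearMap.trace_eq_sum_inner _ b]
      refine Finset.sum_congr rfl fun i _ => ?_
      rw [hsa]; rfl
    rw [← e3, e2, e4, trace_starProjection, hdim]
  have hlim : Tendsto (fun n => ∑ i, ‖(U n).starProjection (b i - P (b i))‖ ^ 2) atTop (𝓝 0) := by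
    have h1 : Tendsto (fun n => ∑ i, inner ℝ (P (b i)) ((U n).starProjection (P (b i)))) atTop
        (𝓝 (∑ i, inner ℝ (P (b i)) (P (b i)))) :=
      tendsto_finsetSum _ fun i _ => tendsto_const_nhds.inner
        (h _ (Submodule.starProjection_apply_mem _ _))
    have h2 : (∑ i, inner ℝ (P (b i)) (P (b i))) = (Module.finrank ℝ W : ℝ) := by
      rw [← trace_starProjection, LinearMap.trace_eq_sum_inner _ b]
      refine Finset.sum_congr rfl fun i _ => ?_
      rw [Submodule.inner_starProjection_left_eq_right, hPP]; rfl
    rw [h2] at h1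
    simp_rw [htr]
    simpa using (tendsto_const_nhds (x := (Module.finrank ℝ W : ℝ))).sub h1
  refine tendsto_clm_of_apply fun i => ?_
  have h3 : Tendsto (fun n => (U n).starProjection (b i - P (b i))) atTop (𝓝 0) := by
    rw [tendsto_zero_iff_norm_tendsto_zero]
    have h4 : Tendsto (fun n => ‖(U n).starProjection (b i - P (b i))‖ ^ 2) atTop (𝓝 0) :=
      squeeze_zero (fun n => by positivity)
        (fun n => Finset.single_le_sum (f := fun i => ‖(U n).starProjection (b i - P (b i))‖ ^ 2)
          (fun i _ => by positivity) (Finset.mem_univ i)) hlim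
    have h5 := (Real.continuous_sqrt.tendsto _).comp h4
    simpa [Function.comp_def, Real.sqrt_sq (norm_nonneg _)] using h5
  have h6 := h3.add (h (P (b i)) (Submodule.starProjection_apply_mem _ _))
  have hbi : b i = EuclideanSpace.single i 1 := by simp [b]
  rw [← hbi]
  simpa using h6

end Projections

/-! ### Singular values and convergence of Cartan attractors -/

section Attractor

variable {d : ℕ}

theorem sigma_nonneg (g : Matrix (Fin d) (Fin d) ℝ) (i : ℕ) : 0 ≤ sigma g i :=
  LinearMap.singularValues_nonneg _ _

theorem sigma_antitone (g : Matrix (Fin d) (Fin d) ℝ) : Antitone (sigma g) := fun _ _ h =>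
  LinearMap.singularValues_antitone _ (Nat.sub_le_sub_right h 1)

theorem lin_diagonal (f : Fin d → ℝ) (v : E d) (i : Fin d) :
    Matrix.toEuclideanLin (Matrix.diagonal f) v i = f i * v i := by
  simp [lin_apply, Matrix.diagonal_apply]

theorem norm_le_of_abs_le {v w : E d} (h : ∀ i, |v i| ≤ |w i|) : ‖v‖ ≤ ‖w‖ := by
  rw [EuclideanSpace.norm_eq, EuclideanSpace.norm_eq]
  exact Real.sqrt_le_sqrt (Finset.sum_le_sum fun i _ => by
    simpa using pow_le_pow_left₀ (abs_nonneg _) (h i) 2)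

theorem mul_transpose_of_mem {K : Matrix (Fin d) (Fin d) ℝ}
    (hK : K ∈ Matrix.specialOrthogonalGroup (Fin d) ℝ) : K * K.transpose = 1 := by
  have := (Matrix.mem_specialOrthogonalGroup_iff.mp hK).1
  simpa [Matrix.star_eq_conjTranspose] using (Matrix.mem_orthogonalGroup_iff _ _).mp this

theorem transpose_mul_of_mem {K : Matrix (Fin d) (Fin d) ℝ}
    (hK : K ∈ Matrix.specialOrthogonalGroup (Fin d) ℝ) : K.transpose * K = 1 := by
  have := (Matrix.mem_specialOrthogonalGroup_iff.mp hK).1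
  simpa [Matrix.star_eq_conjTranspose] using (Matrix.mem_orthogonalGroup_iff' _ _).mp this

/-- If `g` expands by at most `a` on a subspace of codimension `j`, then `σ_{j+1}(g) ≤ a`. -/
theorem sigma_le_of_finrank {j : ℕ} (hj : j < d) {g K L : Matrix (Fin d) (Fin d) ℝ}
    (hK : K ∈ Matrix.specialOrthogonalGroup (Fin d) ℝ)
    (hL : L ∈ Matrix.specialOrthogonalGroup (Fin d) ℝ)
    (hg : g = K * Matrix.diagonal (fun i : Fin d => sigma g ((i : ℕ) + 1)) * L)
    {C : Submodule ℝ (E d)} (hC : Module.finrank ℝ C = d - j) {a : ℝ}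
    (ha : ∀ v ∈ C, ‖Matrix.toEuclideanLin g v‖ ≤ a * ‖v‖) : sigma g (j + 1) ≤ a := by
  -- The span of the first `j + 1` right singular directions has dimension `j + 1` and so meets `C`;
  -- on it `g` expands by at least `σ_{j+1}`.
  obtain ⟨v, hv, hv0⟩ : ∃ v ∈ mapSub L.transpose (firstSpan d (j + 1)) ⊓ C, v ≠ 0 := by
    rw [← Submodule.ne_bot_iff]
    intro hbot
    have h1 := Submodule.finrank_sup_add_finrank_inf_eq (mapSub L.transpose (firstSpan d (j + 1))) C
    rw [hbot, finrank_bot, finrank_mapSub (mul_transpose_of_mem hL), finrank_firstSpan hj, hC] at h1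
    have h2 := Submodule.finrank_le (mapSub L.transpose (firstSpan d (j + 1)) ⊔ C)
    rw [finrank_euclideanSpace_fin] at h2
    omega
  obtain ⟨⟨t, ht, rfl⟩, hvC⟩ := hv
  have ht' := mem_firstSpan.mp ht
  have h1 := ha _ hvC
  have hLt : ∀ t : E d, ‖Matrix.toEuclideanLin L.transpose t‖ = ‖t‖ := fun t => by
    rw [← norm_lin_orthogonal hL, ← lin_mul, mul_transpose_of_mem hL, lin_one]
  have h2 : ‖Matrix.toEuclideanLin g (Matrix.toEuclideanLin L.transpose t)‖ =
      ‖Matrix.toEuclideanLin (Matrix.diagonal (fun i : Fin d => sigma g ((i : ℕ) + 1))) t‖ := by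
    conv_lhs => rw [hg]
    rw [← lin_mul, mul_assoc, mul_transpose_of_mem hL, mul_one, lin_mul, norm_lin_orthogonal hK]
  rw [h2, hLt] at h1
  have h3 : ‖sigma g (j + 1) • t‖ ≤
      ‖Matrix.toEuclideanLin (Matrix.diagonal (fun i : Fin d => sigma g ((i : ℕ) + 1))) t‖ := by
    refine norm_le_of_abs_le fun i => ?_
    rw [lin_diagonal, PiLp.smul_apply, smul_eq_mul, abs_mul, abs_mul]
    by_cases hi : j + 1 ≤ (i : ℕ)
    · simp [ht' i hi]
    · refine mul_le_mul_of_nonneg_right ?_ (abs_nonneg _)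
      rw [abs_of_nonneg (sigma_nonneg _ _), abs_of_nonneg (sigma_nonneg _ _)]
      exact sigma_antitone g (by omega)
  rw [norm_smul, Real.norm_eq_abs, abs_of_nonneg (sigma_nonneg _ _)] at h3
  have htpos : 0 < ‖t‖ := norm_pos_iff.mpr fun h => hv0 (by simp [h])
  exact le_of_mul_le_mul_right (h3.trans h1) htpos

/-- Dominated sequences have convergent Cartan attractors. -/
theorem tendsto_cartanAttractor {j : ℕ} (hj : j < d) {g : ℕ → Matrix (Fin d) (Fin d) ℝ}
    {U C : ℕ → Submodule ℝ (E d)} {W : Submodule ℝ (E d)}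
    (hU : ∀ n, IsCartanAttractor j (g n) (U n)) (hW : Module.finrank ℝ W = j)
    (hC : ∀ᶠ n in atTop, Module.finrank ℝ (C n) = d - j) {a b : ℕ → ℝ}
    (ha : ∀ᶠ n in atTop, ∀ v ∈ C n, ‖Matrix.toEuclideanLin (g n) v‖ ≤ a n * ‖v‖)
    (hb : ∀ᶠ n in atTop, ∀ w ∈ W, ∃ v, Matrix.toEuclideanLin (g n) v = w ∧ ‖v‖ ≤ b n * ‖w‖)
    (hab : Tendsto (fun n => a n * b n) atTop (𝓝 0)) :
    Tendsto (fun n => (U n).starProjection) atTop (𝓝 W.starProjection) := by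
  refine tendsto_starProjection (fun n => ?_) fun w hw => ?_
  · obtain ⟨K, hK, L, hL, -, hUn⟩ := hU n
    rw [hUn, finrank_mapSub (transpose_mul_of_mem hK), finrank_firstSpan hj.le, hW]
  · rw [tendsto_iff_norm_sub_tendsto_zero]
    refine squeeze_zero' (Eventually.of_forall fun n => norm_nonneg _) ?_
      (by simpa using hab.mul_const ‖w‖)
    filter_upwards [hC, ha, hb] with n hCn han hbn
    obtain ⟨K, hK, L, hL, hg, hUn⟩ := hU n
    have hs := sigma_le_of_finrank hj hK hL hg hCn han
    obtain ⟨v, hv, hvb⟩ := hbn w hw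
    set t := Matrix.toEuclideanLin L v with ht
    have htn : ‖t‖ = ‖v‖ := norm_lin_orthogonal hL v
    let s : E d := Matrix.toEuclideanLin
      (Matrix.diagonal (fun i : Fin d => sigma (g n) ((i : ℕ) + 1))) t
    -- Truncating `s = diag(σ) L v` to its first `j` coordinates gives a vector `K s₁` of `U n` at
    -- distance at most `σ_{j+1} ‖v‖` from `w = K s`.
    let s₁ : E d := WithLp.toLp 2 fun i => if (i : ℕ) < j then s i else 0
    have hu : Matrix.toEuclideanLin K s₁ ∈ U n := by
      rw [hUn]
      refine ⟨s₁, mem_firstSpan.mpr fun i hi => ?_, rfl⟩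
      simp [s₁, not_lt.mpr hi]
    have hw' : w = Matrix.toEuclideanLin K s := by
      rw [← hv, hg, lin_mul, lin_mul]
    have h1 : ‖w - (U n).starProjection w‖ ≤ ‖w - Matrix.toEuclideanLin K s₁‖ := by
      rw [Submodule.starProjection_minimal]
      exact ciInf_le ⟨0, by rintro _ ⟨x, rfl⟩; positivity⟩ (⟨_, hu⟩ : U n)
    have h2 : ‖w - Matrix.toEuclideanLin K s₁‖ = ‖s - s₁‖ := by
      rw [hw', ← map_sub, norm_lin_orthogonal hK]
    have h3 : ‖s - s₁‖ ≤ ‖sigma (g n) (j + 1) • t‖ := by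
      refine norm_le_of_abs_le fun i => ?_
      rw [PiLp.sub_apply, PiLp.smul_apply, smul_eq_mul]
      by_cases hi : (i : ℕ) < j
      · simp only [s₁, hi, if_true, sub_self, abs_zero]; positivity
      · simp only [s₁, hi, if_false, sub_zero, s, lin_diagonal, abs_mul]
        refine mul_le_mul_of_nonneg_right ?_ (abs_nonneg _)
        rw [abs_of_nonneg (sigma_nonneg _ _), abs_of_nonneg (sigma_nonneg _ _)]
        exact sigma_antitone _ (by omega)
    rw [norm_smul, Real.norm_eq_abs, abs_of_nonneg (sigma_nonneg _ _), htn] at h3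
    rw [norm_sub_rev]
    calc _ ≤ sigma (g n) (j + 1) * ‖v‖ := h1.trans (h2.le.trans h3)
      _ ≤ a n * (b n * ‖w‖) := mul_le_mul hs hvb (norm_nonneg _) ((sigma_nonneg _ _).trans hs)
      _ = a n * b n * ‖w‖ := by ring

end Attractor

/-! ### Total positivity of `3 × 3` diagonal blocks -/

section Unitriangular

variable {d : ℕ}

/-- Upper unitriangular matrices. -/
def IsUnip (A : Matrix (Fin d) (Fin d) ℝ) : Prop :=
  (∀ i j, j < i → A i j = 0) ∧ ∀ i, A i i = 1

theorem isUnip_one : IsUnip (1 : Matrix (Fin d) (Fin d) ℝ) :=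
  ⟨fun _ _ h => Matrix.one_apply_ne h.ne', fun _ => Matrix.one_apply_eq _⟩

theorem IsUnip.mul_apply {A B : Matrix (Fin d) (Fin d) ℝ} (hA : IsUnip A) (hB : IsUnip B)
    (i j : Fin d) : (A * B) i j = ∑ l ∈ Finset.Icc i j, A i l * B l j := by
  rw [Matrix.mul_apply]
  refine (Finset.sum_subset (Finset.subset_univ _) fun l _ hl => ?_).symm
  simp only [Finset.mem_Icc, not_and_or, not_le] at hl
  rcases hl with h | h
  · rw [hA.1 _ _ h, zero_mul]
  · rw [hB.1 _ _ h, mul_zero]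

theorem IsUnip.mul {A B : Matrix (Fin d) (Fin d) ℝ} (hA : IsUnip A) (hB : IsUnip B) :
    IsUnip (A * B) := by
  refine ⟨fun i j h => ?_, fun i => ?_⟩
  · rw [hA.mul_apply hB, Finset.Icc_eq_empty (not_le.mpr h), Finset.sum_empty]
  · rw [hA.mul_apply hB, Finset.Icc_self, Finset.sum_singleton, hA.2, hB.2, one_mul]

theorem IsUnip.mul_apply_succ {A B : Matrix (Fin d) (Fin d) ℝ} (hA : IsUnip A) (hB : IsUnip B)
    {x y : Fin d} (hxy : (y : ℕ) = x + 1) : (A * B) x y = A x y + B x y := by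
  have h : Finset.Icc x y = {x, y} := by
    ext l; simp only [Finset.mem_Icc, Finset.mem_insert, Finset.mem_singleton, Fin.le_def, Fin.ext_iff]
    omega
  have hne : x ≠ y := by intro h; rw [h] at hxy; omega
  rw [hA.mul_apply hB, h, Finset.sum_pair hne, hA.2, hB.2]; ring

theorem IsUnip.mul_apply_succ_succ {A B : Matrix (Fin d) (Fin d) ℝ} (hA : IsUnip A)
    (hB : IsUnip B) {x y z : Fin d} (hxy : (y : ℕ) = x + 1) (hyz : (z : ℕ) = y + 1) :
    (A * B) x z = A x z + A x y * B y z + B x z := by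
  have h : Finset.Icc x z = {x, y, z} := by
    ext l; simp only [Finset.mem_Icc, Finset.mem_insert, Finset.mem_singleton, Fin.le_def, Fin.ext_iff]
    omega
  have hne : x ≠ y := by intro h; rw [h] at hxy; omega
  have hne' : y ≠ z := by intro h; rw [h] at hyz; omega
  have hne'' : x ≠ z := by intro h; rw [h] at hxy; omega
  rw [hA.mul_apply hB, h, Finset.sum_insert (by simp [hne, hne'']), Finset.sum_pair hne', hA.2, hB.2]
  ring

/-- Unipotent upper triangular matrices whose `3 × 3` diagonal blocks with indices at least `m` are
totally nonnegative. -/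
def IsNonnegFrom (m : ℕ) (A : Matrix (Fin d) (Fin d) ℝ) : Prop :=
  IsUnip A ∧ (∀ x y : Fin d, m ≤ x → (y : ℕ) = x + 1 → 0 ≤ A x y) ∧
    ∀ x y z : Fin d, m ≤ x → (y : ℕ) = x + 1 → (z : ℕ) = y + 1 →
      0 ≤ A x z ∧ A x z ≤ A x y * A y z

theorem isNonnegFrom_one (m : ℕ) : IsNonnegFrom m (1 : Matrix (Fin d) (Fin d) ℝ) := by
  have h : ∀ x y : Fin d, (x : ℕ) < y → (1 : Matrix (Fin d) (Fin d) ℝ) x y = 0 := fun x y h =>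
    Matrix.one_apply_ne (Fin.ne_of_lt h)
  refine ⟨isUnip_one, fun x y _ hxy => (h x y (by omega)).ge, fun x y z _ hxy hyz => ?_⟩
  rw [h x z (by omega), h x y (by omega)]; simp

/-- Cauchy–Binet on a `3 × 3` block: the cross term `A x y * B y z` enters the corner entry and `B x
y * A y z` enters the minor `xy · yz - xz`, both with a plus sign. -/
theorem IsNonnegFrom.mul {m : ℕ} {A B : Matrix (Fin d) (Fin d) ℝ} (hA : IsNonnegFrom m A)
    (hB : IsNonnegFrom m B) : IsNonnegFrom m (A * B) := by
  refine ⟨hA.1.mul hB.1, fun x y hx hxy => ?_, fun x y z hx hxy hyz => ?_⟩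
  · rw [hA.1.mul_apply_succ hB.1 hxy]
    exact add_nonneg (hA.2.1 x y hx hxy) (hB.2.1 x y hx hxy)
  · rw [hA.1.mul_apply_succ hB.1 hxy, hA.1.mul_apply_succ hB.1 hyz,
      hA.1.mul_apply_succ_succ hB.1 hxy hyz]
    have a1 := hA.2.1 x y hx hxy
    have a2 := hA.2.1 y z (by omega) hyz
    have b1 := hB.2.1 x y hx hxy
    have b2 := hB.2.1 y z (by omega) hyz
    have ⟨a3, a4⟩ := hA.2.2 x y z hx hxy hyz
    have ⟨b3, b4⟩ := hB.2.2 x y z hx hxy hyz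
    have := mul_nonneg a1 b2
    have := mul_nonneg b1 a2
    constructor <;> nlinarith

theorem isNonnegFrom_list_prod {m : ℕ} {l : List (Matrix (Fin d) (Fin d) ℝ)}
    (h : ∀ A ∈ l, IsNonnegFrom m A) : IsNonnegFrom m l.prod := by
  induction l with
  | nil => simpa using isNonnegFrom_one m
  | cons A l ih =>
    rw [List.prod_cons]
    exact (h A (by simp)).mul (ih fun B hB => h B (by simp [hB]))

/-- Superdiagonal entries of unitriangular matrices add under multiplication, so with nonnegative
entries each factor is a lower bound. -/
theorem apply_le_list_prod_apply {m : ℕ} {l : List (Matrix (Fin d) (Fin d) ℝ)}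
    (h : ∀ A ∈ l, IsNonnegFrom m A) {x y : Fin d} (hx : m ≤ x) (hxy : (y : ℕ) = x + 1)
    {A : Matrix (Fin d) (Fin d) ℝ} (hA : A ∈ l) : A x y ≤ l.prod x y := by
  induction l with
  | nil => simp at hA
  | cons B l ih =>
    have hB := h B (by simp)
    have hl := isNonnegFrom_list_prod fun A hA => h A (List.mem_cons_of_mem B hA)
    rw [List.prod_cons, hB.1.mul_apply_succ hl.1 hxy]
    rcases List.mem_cons.mp hA with rfl | hA
    · linarith [hl.2.1 x y hx hxy]
    · linarith [hB.2.1 x y hx hxy, ih (fun A hA => h A (List.mem_cons_of_mem B hA)) hA]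

/-- Unipotent upper triangular matrices whose `3 × 3` diagonal blocks with indices at least `m` are
totally positive. -/
def IsPosFrom (m : ℕ) (A : Matrix (Fin d) (Fin d) ℝ) : Prop :=
  IsNonnegFrom m A ∧ (∀ x y : Fin d, m ≤ x → (y : ℕ) = x + 1 → 0 < A x y) ∧
    ∀ x y z : Fin d, m ≤ x → (y : ℕ) = x + 1 → (z : ℕ) = y + 1 →
      0 < A x z ∧ A x z < A x y * A y z

/-- The two cross terms of the product are now strictly positive. Positive superdiagonals in just
two factors therefore give a strictly positive corner and minor. -/
theorem isPosFrom_mul {m : ℕ} {A B : Matrix (Fin d) (Fin d) ℝ} (hA : IsNonnegFrom m A)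
    (hB : IsNonnegFrom m B) (hA' : ∀ x y : Fin d, m ≤ x → (y : ℕ) = x + 1 → 0 < A x y)
    (hB' : ∀ x y : Fin d, m ≤ x → (y : ℕ) = x + 1 → 0 < B x y) : IsPosFrom m (A * B) := by
  refine ⟨hA.mul hB, fun x y hx hxy => ?_, fun x y z hx hxy hyz => ?_⟩
  · rw [hA.1.mul_apply_succ hB.1 hxy]
    exact add_pos (hA' x y hx hxy) (hB' x y hx hxy)
  · rw [hA.1.mul_apply_succ hB.1 hxy, hA.1.mul_apply_succ hB.1 hyz,
      hA.1.mul_apply_succ_succ hB.1 hxy hyz]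
    have a1 := hA' x y hx hxy
    have a2 := hA' y z (by omega) hyz
    have b1 := hB' x y hx hxy
    have b2 := hB' y z (by omega) hyz
    have ⟨a3, a4⟩ := hA.2.2 x y z hx hxy hyz
    have ⟨b3, b4⟩ := hB.2.2 x y z hx hxy hyz
    have := mul_pos a1 b2
    have := mul_pos b1 a2
    constructor <;> nlinarith

/-- An upper unitriangular matrix reflects membership in the standard flag. -/
theorem IsUnip.mem_firstSpan_of_lin {A : Matrix (Fin d) (Fin d) ℝ} (hA : IsUnip A) {l : ℕ}
    {t : E d} (h : Matrix.toEuclideanLin A t ∈ firstSpan d l) : t ∈ firstSpan d l := by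
  rw [mem_firstSpan] at h ⊢
  -- Back substitution from the last coordinate; `n` counts the coordinates already treated.
  have key : ∀ n, ∀ i : Fin d, l ≤ i → d ≤ (i : ℕ) + n → t i = 0 := by
    intro n
    induction n with
    | zero => intro i _ hi; omega
    | succ n ih =>
      intro i hli hi
      have h1 := h i hli
      rw [lin_apply, Finset.sum_eq_single i] at h1
      · rwa [hA.2, one_mul] at h1
      · intro j _ hj
        rcases lt_or_gt_of_ne hj with hj | hj
        · rw [hA.1 _ _ hj, zero_mul]
        · rw [ih j (hli.trans hj.le) (by have : (i : ℕ) < j := hj; omega), mul_zero]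
      · simp
  exact fun i hi => key d i hi (by omega)

end Unitriangular

/-! ### The lower right block of a positive element -/

section PositiveElements

variable {p q : ℕ}

theorem elemShort_isUnip (k : ℕ) (t : ℝ) : IsUnip (elemShort p q k t) := by
  refine ⟨fun i j h => ?_, fun i => by simp [elemShort]⟩
  have h' : (j : ℕ) < i := h
  rw [elemShort, Matrix.of_apply, if_neg h.ne', if_neg (by omega)]

theorem elemLast_isUnip (hpq : p < q) (v : Fin (q + 2 - p) → ℝ) : IsUnip (elemLast p q v) := by
  refine ⟨fun i j h => ?_, fun i => by simp [elemLast]⟩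
  have h' : (j : ℕ) < i := h
  rw [elemLast, Matrix.of_apply, if_neg h.ne', if_neg (by omega), dif_neg (by omega),
    dif_neg (by omega)]

theorem elemShort_apply_lower (hpq : p < q) {k : ℕ} (hk : k + 2 ≤ p) (t : ℝ) {x y : Fin (p + q)}
    (hx : q + 1 ≤ x) (hxy : (y : ℕ) = x + 1) :
    elemShort p q k t x y = if (x : ℕ) + k + 1 = p + q then t else 0 := by
  rw [elemShort, Matrix.of_apply, if_neg (by intro h; rw [h] at hxy; omega)]
  by_cases h : (x : ℕ) + k + 1 = p + q
  · rw [if_pos (by omega), if_pos h]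
  · rw [if_neg (by omega), if_neg h]

theorem elemLast_apply_lower (hpq : p < q) (v : Fin (q + 2 - p) → ℝ) {x y : Fin (p + q)}
    (hx : q + 1 ≤ x) (hxy : (x : ℕ) < y) : elemLast p q v x y = 0 := by
  rw [elemLast, Matrix.of_apply, if_neg (Fin.ne_of_lt hxy), if_neg (by omega), dif_neg (by omega),
    dif_neg (by omega)]

/-- From row `q + 1` on, `E_j(t)` has at most the single entry `t > 0` off the diagonal and
`E_{p-1}(v)` agrees with the identity, so the vector parameter is invisible in these blocks. -/
theorem elem_isNonnegFrom (hpq : p < q) (v : VTheta p q) (j : ℕ) :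
    IsNonnegFrom (q + 1) (v.elem j) := by
  rw [VTheta.elem]
  split_ifs with h
  · have ht := (v.coef_pos ⟨j - 1, by omega⟩).le
    set t := v.coef ⟨j - 1, by omega⟩
    have h0 : ∀ x y : Fin (p + q), q + 1 ≤ (x : ℕ) → (y : ℕ) = x + 1 → 0 ≤ elemShort p q j t x y := by
      intro x y hx hxy
      rw [elemShort_apply_lower hpq (by omega) t hx hxy]
      split_ifs <;> simp [ht]
    refine ⟨elemShort_isUnip j t, h0, fun x y z hx hxy hyz => ?_⟩
    have hz : elemShort p q j t x z = 0 := by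
      rw [elemShort, Matrix.of_apply, if_neg (by intro h; rw [h] at hxy; omega), if_neg (by omega)]
    rw [hz]
    exact ⟨le_rfl, mul_nonneg (h0 x y hx hxy) (h0 y z (by omega) hyz)⟩
  · refine ⟨elemLast_isUnip hpq _, fun x y hx hxy => ?_, fun x y z hx hxy hyz => ?_⟩
    · rw [elemLast_apply_lower hpq _ hx (by omega)]
    · rw [elemLast_apply_lower hpq _ hx (by omega), elemLast_apply_lower hpq _ hx (by omega)]; simp

theorem ab_isNonnegFrom (hpq : p < q) (v : VTheta p q) : IsNonnegFrom (q + 1) v.ab := by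
  refine IsNonnegFrom.mul ?_ ?_ <;>
  · refine isNonnegFrom_list_prod fun A hA => ?_
    obtain ⟨j, -, rfl⟩ := List.mem_map.mp hA
    exact elem_isNonnegFrom hpq v j

theorem ab_apply_pos (hpq : p < q) (v : VTheta p q) (x y : Fin (p + q)) (hx : q + 1 ≤ x)
    (hxy : (y : ℕ) = x + 1) : 0 < v.ab x y := by
  have hnn : ∀ f : ℕ → Bool, ∀ A ∈ (((List.range' 1 (p - 1)).filter f).map v.elem),
      IsNonnegFrom (q + 1) A := by
    intro f A hA
    obtain ⟨j, -, rfl⟩ := List.mem_map.mp hA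
    exact elem_isNonnegFrom hpq v j
  have hy := y.2
  -- Counting from `0`, the lower entry of `E_j` sits in row `d - 1 - j`. The bounds on `x` give `1
  -- ≤ j ≤ p - 2`, so `E_j` occurs in either the even or the odd product.
  set j := p + q - 1 - (x : ℕ) with hj
  have hel : 0 < v.elem j x y := by
    rw [VTheta.elem, dif_pos (by omega), elemShort_apply_lower hpq (by omega) _ hx hxy,
      if_pos (by omega)]
    exact v.coef_pos _
  have hmem : j ∈ List.range' 1 (p - 1) := by rw [List.mem_range'_1]; omega
  rw [VTheta.ab, (isNonnegFrom_list_prod (hnn _)).1.mul_apply_succ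
    (isNonnegFrom_list_prod (hnn _)).1 hxy]
  have h1 := (isNonnegFrom_list_prod (hnn fun j => decide (j % 2 = 0))).2.1 x y hx hxy
  have h2 := (isNonnegFrom_list_prod (hnn fun j => decide (j % 2 = 1))).2.1 x y hx hxy
  rcases Nat.mod_two_eq_zero_or_one j with h | h
  · have := apply_le_list_prod_apply (hnn fun j => decide (j % 2 = 0)) hx hxy
      (List.mem_map.mpr ⟨j, List.mem_filter.mpr ⟨hmem, by simpa using h⟩, rfl⟩)
    linarith
  · have := apply_le_list_prod_apply (hnn fun j => decide (j % 2 = 1)) hx hxy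
      (List.mem_map.mpr ⟨j, List.mem_filter.mpr ⟨hmem, by simpa using h⟩, rfl⟩)
    linarith

/-- Two factors `ab` suffice for strict positivity, and `p - 1 ≥ 2` of them are present. -/
theorem posElem_isPosFrom (hpq : p < q) (hp : 3 ≤ p) (v : Fin (p - 1) → VTheta p q) :
    IsPosFrom (q + 1) (posElem v) := by
  have key : ∀ l : List (VTheta p q), 2 ≤ l.length →
      IsPosFrom (q + 1) (l.map VTheta.ab).prod := by
    intro l hl
    obtain ⟨a, l, rfl⟩ := List.exists_cons_of_length_pos (by omega : 0 < l.length)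
    obtain ⟨b, l, rfl⟩ := List.exists_cons_of_length_pos (l := l) (by simp at hl; omega)
    have hl : IsNonnegFrom (q + 1) ((b :: l).map VTheta.ab).prod := by
      refine isNonnegFrom_list_prod fun A hA => ?_
      obtain ⟨w, -, rfl⟩ := List.mem_map.mp hA
      exact ab_isNonnegFrom hpq w
    rw [List.map_cons, List.prod_cons]
    refine isPosFrom_mul (ab_isNonnegFrom hpq a) hl (ab_apply_pos hpq a) fun x y hx hxy => ?_
    refine (ab_apply_pos hpq b x y hx hxy).trans_le ?_
    refine apply_le_list_prod_apply (fun A hA => ?_) hx hxy (by simp)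
    obtain ⟨w, -, rfl⟩ := List.mem_map.mp hA
    exact ab_isNonnegFrom hpq w
  have := key (List.ofFn v) (by simp; omega)
  rwa [List.map_ofFn] at this

end PositiveElements

/-! ### Directness of the sum from total positivity -/

section Transversality

variable {p q : ℕ}

/-- Supports leave only the rows `x, y, z`. In the first case `s₂` is a multiple of `e_z` and `s₃ =
P t` with `t` in the span of `e_y, e_z`; vanishing of the coordinates `x` and `y` of `P t` is a
linear system whose determinant is, up to sign, the minor `P x y * P y z - P x z`. In the second
case `s₂ = P (t z • e_z)` and coordinate `x` gives `P x z * t z = 0`. -/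
theorem sum_eq_zero_imp_of_pos (hpq : p < q) {P : Matrix (Fin (p + q)) (Fin (p + q)) ℝ}
    (hP : IsPosFrom (q + 1) P) {k : ℕ} (hk : 1 ≤ k) (hkp : k + 3 ≤ p) {s₁ s₂ s₃ : E (p + q)}
    (h₁ : s₁ ∈ firstSpan (p + q) (p + q - k - 2)) (h₂ : s₂ ∈ firstSpan (p + q) (p + q - k + 1))
    (hsum : s₁ + s₂ + s₃ = 0)
    (h : (s₂ ∈ lastSpan (p + q) k ∧ s₃ ∈ mapSub P (lastSpan (p + q) (k + 1))) ∨
      (s₂ ∈ mapSub P (lastSpan (p + q) k) ∧ s₃ ∈ lastSpan (p + q) (k + 1))) :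
    s₁ = 0 ∧ s₂ = 0 ∧ s₃ = 0 := by
  let x : Fin (p + q) := ⟨p + q - k - 2, by omega⟩
  let y : Fin (p + q) := ⟨p + q - k - 1, by omega⟩
  let z : Fin (p + q) := ⟨p + q - k, by omega⟩
  have hx : q + 1 ≤ (x : ℕ) := by simp only [x]; omega
  have hxy : (y : ℕ) = x + 1 := by simp only [x, y]; omega
  have hyz : (z : ℕ) = y + 1 := by simp only [z, y]; omega
  have hco : ∀ i, s₁ i + s₂ i + s₃ i = 0 := fun i => by
    have := congrArg (fun v : E (p + q) => v i) hsum; simpa using this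
  have h1 := mem_firstSpan.mp h₁
  have h2 := mem_firstSpan.mp h₂
  have hPu := hP.1.1
  have hneyz : y ≠ z := by intro h; rw [h] at hyz; omega
  rcases h with ⟨hs2, t, ht, rfl⟩ | ⟨⟨t, ht, rfl⟩, hs3⟩
  · have hs3 : Matrix.toEuclideanLin P t ∈ firstSpan (p + q) (p + q - k + 1) := by
      refine mem_firstSpan.mpr fun i hi => ?_
      have := hco i
      rw [h1 i (by omega), h2 i hi] at this
      simpa using this
    have ht' := mem_firstSpan.mp (hPu.mem_firstSpan_of_lin hs3)
    have ht := mem_lastSpan.mp ht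
    have hs2' := mem_lastSpan.mp hs2
    have hPt : ∀ i, Matrix.toEuclideanLin P t i = P i y * t y + P i z * t z := by
      intro i
      rw [lin_apply, ← Finset.sum_pair (f := fun j => P i j * t j) hneyz]
      refine (Finset.sum_subset (Finset.subset_univ _) fun j _ hj => ?_).symm
      simp only [Finset.mem_insert, Finset.mem_singleton, not_or, Fin.ext_iff] at hj
      rcases lt_or_ge (j : ℕ) y with h | h
      · rw [ht j (by simp only [y] at h; omega), mul_zero]
      · rw [ht' j (by simp only [y] at h hj; simp only [z] at hj; omega), mul_zero]
    have ex := hco x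
    have ey := hco y
    have ez := hco z
    have e2x : s₂ x = 0 := hs2' x (by simp only [x]; omega)
    have e2y : s₂ y = 0 := hs2' y (by simp only [y]; omega)
    have e1y : s₁ y = 0 := h1 y (by simp only [y]; omega)
    rw [hPt, e2x, h1 x le_rfl] at ex
    rw [hPt, e2y, e1y, hPu.2] at ey
    have hty : t y = -(P y z * t z) := by linarith
    have hmul : (P x z - P x y * P y z) * t z = 0 := by rw [hty] at ex; linarith
    have htz : t z = 0 := by
      rcases mul_eq_zero.mp hmul with h | h
      · linarith [(hP.2.2 x y z hx hxy hyz).2]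
      · exact h
    rw [htz, mul_zero, neg_zero] at hty
    have hs30 : Matrix.toEuclideanLin P t = 0 := by
      ext i; rw [hPt, hty, htz]; simp
    rw [hs30] at hsum hco ⊢
    have hs20 : s₂ = 0 := by
      ext i
      rcases lt_or_ge (i : ℕ) (p + q - k) with h | h
      · exact hs2' i (by omega)
      · have := hco i
        rw [h1 i (by omega)] at this
        simpa using this
    refine ⟨?_, hs20, rfl⟩
    simpa [hs20] using hsum
  · have ht' := mem_firstSpan.mp (hPu.mem_firstSpan_of_lin h₂)
    have ht := mem_lastSpan.mp ht
    have hs3' := mem_lastSpan.mp hs3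
    have hPt : ∀ i, Matrix.toEuclideanLin P t i = P i z * t z := by
      intro i
      rw [lin_apply, Finset.sum_eq_single z]
      · intro j _ hj
        simp only [ne_eq, Fin.ext_iff] at hj
        rcases lt_or_ge (j : ℕ) z with h | h
        · rw [ht j (by simp only [z] at h; omega), mul_zero]
        · rw [ht' j (by simp only [z] at h hj; omega), mul_zero]
      · simp
    have ex := hco x
    rw [hPt, h1 x le_rfl, hs3' x (by simp only [x]; omega)] at ex
    have htz : t z = 0 := by
      have : P x z * t z = 0 := by linarith
      exact (mul_eq_zero.mp this).resolve_left (hP.2.2 x y z hx hxy hyz).1.ne'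
    have hs20 : Matrix.toEuclideanLin P t = 0 := by
      ext i; rw [hPt, htz]; simp
    rw [hs20] at hsum hco ⊢
    have hs10 : s₁ = 0 := by
      ext i
      rcases lt_or_ge (i : ℕ) (p + q - k - 2) with h | h
      · have := hco i
        rw [hs3' i (by omega)] at this
        simpa using this
      · exact h1 i h
    refine ⟨hs10, rfl, ?_⟩
    simpa [hs10] using hsum

end Transversality

/-! ### Lorentzian geometry of the form `J` -/

section Lorentz

variable {p q : ℕ}

/-- The Lorentzian bilinear form of `J`. -/
def lor (u v : Fin (q + 2 - p) → ℝ) : ℝ := u ⬝ᵥ (formJ p q).mulVec v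

theorem formJ_mulVec_apply (hpq : p < q) (v : Fin (q + 2 - p) → ℝ) (s : Fin (q + 2 - p)) :
    (formJ p q).mulVec v s = if (s : ℕ) = 0 then (-1) ^ (p - 1) * v ⟨q + 1 - p, by omega⟩
      else if (s : ℕ) = q + 1 - p then (-1) ^ (p - 1) * v ⟨0, by omega⟩ else - v s := by
  have hs := s.2
  simp only [Matrix.mulVec, dotProduct, formJ, Matrix.of_apply]
  split_ifs with h0 hl
  · rw [Finset.sum_eq_single ⟨q + 1 - p, by omega⟩]
    · rw [if_pos ⟨by simp only; omega, Or.inl h0⟩]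
    · intro t _ ht
      rw [Ne, Fin.ext_iff] at ht
      simp only at ht
      rw [if_neg (by omega), if_neg (by omega), zero_mul]
    · simp
  · rw [Finset.sum_eq_single ⟨0, by omega⟩]
    · rw [if_pos ⟨by simp only; omega, Or.inr rfl⟩]
    · intro t _ ht
      rw [Ne, Fin.ext_iff] at ht
      simp only at ht
      rw [if_neg (by omega), if_neg (by omega), zero_mul]
    · simp
  · rw [Finset.sum_eq_single s]
    · rw [if_neg (by omega), if_pos ⟨rfl, by omega, by omega⟩]; ring
    · intro t _ ht
      rw [Ne, Fin.ext_iff] at ht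
      rw [if_neg (by omega), if_neg (fun h => ht (by rw [h.1])), zero_mul]
    · simp

theorem neg_one_pow_mul_self (n : ℕ) : ((-1 : ℝ) ^ n) * (-1) ^ n = 1 := by
  rw [← mul_pow]; simp

theorem formJ_mulVec_mulVec (hpq : p < q) (v : Fin (q + 2 - p) → ℝ) :
    (formJ p q).mulVec ((formJ p q).mulVec v) = v := by
  ext s
  have h1 := neg_one_pow_mul_self (p - 1)
  rw [formJ_mulVec_apply hpq]
  split_ifs with h0 hl
  · have hs : s = ⟨0, by omega⟩ := Fin.ext h0
    rw [formJ_mulVec_apply hpq, if_neg (by simp only; omega), if_pos rfl, ← mul_assoc, h1, hs, one_mul]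
  · have hs : s = ⟨q + 1 - p, by omega⟩ := Fin.ext hl
    rw [formJ_mulVec_apply hpq, if_pos rfl, ← mul_assoc, h1, hs, one_mul]
  · rw [formJ_mulVec_apply hpq, if_neg h0, if_neg hl, neg_neg]

/-- Indices strictly between the first and the last one. -/
def innerIdx (p q : ℕ) : Finset (Fin (q + 2 - p)) :=
  Finset.univ.filter fun s => (s : ℕ) ≠ 0 ∧ (s : ℕ) ≠ q + 1 - p

theorem lor_eq (hpq : p < q) (u v : Fin (q + 2 - p) → ℝ) :
    lor u v = (-1) ^ (p - 1) * (u ⟨0, by omega⟩ * v ⟨q + 1 - p, by omega⟩ +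
      u ⟨q + 1 - p, by omega⟩ * v ⟨0, by omega⟩) - ∑ s ∈ innerIdx p q, u s * v s := by
  have hne : (⟨0, by omega⟩ : Fin (q + 2 - p)) ≠ ⟨q + 1 - p, by omega⟩ := by
    rw [Ne, Fin.ext_iff]; simp only; omega
  have hdis : Disjoint ({⟨0, by omega⟩, ⟨q + 1 - p, by omega⟩} : Finset (Fin (q + 2 - p)))
      (innerIdx p q) := by
    rw [Finset.disjoint_left]
    intro s hs hs'
    simp only [Finset.mem_insert, Finset.mem_singleton] at hs
    simp only [innerIdx, Finset.mem_filter, Finset.mem_univ, true_and] at hs'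
    rcases hs with rfl | rfl
    · exact hs'.1 rfl
    · exact hs'.2 rfl
  have hun : (Finset.univ : Finset (Fin (q + 2 - p))) =
      ({⟨0, by omega⟩, ⟨q + 1 - p, by omega⟩} : Finset (Fin (q + 2 - p))) ∪ innerIdx p q := by
    ext s
    simp only [Finset.mem_univ, Finset.mem_union, Finset.mem_insert, Finset.mem_singleton,
      innerIdx, Finset.mem_filter, true_and, Fin.ext_iff, true_iff]
    omega
  rw [lor, dotProduct, hun, Finset.sum_union hdis, Finset.sum_pair hne,
    formJ_mulVec_apply hpq, formJ_mulVec_apply hpq, if_pos rfl, if_neg (by simp only; omega), if_pos rfl]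
  have : ∑ s ∈ innerIdx p q, u s * (formJ p q).mulVec v s = - ∑ s ∈ innerIdx p q, u s * v s := by
    rw [← Finset.sum_neg_distrib]
    refine Finset.sum_congr rfl fun s hs => ?_
    simp only [innerIdx, Finset.mem_filter, Finset.mem_univ, true_and] at hs
    rw [formJ_mulVec_apply hpq, if_neg hs.1, if_neg hs.2]; ring
  rw [this]; ring

theorem lor_comm (hpq : p < q) (u v : Fin (q + 2 - p) → ℝ) : lor u v = lor v u := by
  rw [lor_eq hpq, lor_eq hpq, Finset.sum_congr rfl fun s _ => mul_comm (u s) (v s)]; ring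

theorem lor_add_left (u u' v : Fin (q + 2 - p) → ℝ) : lor (u + u') v = lor u v + lor u' v := by
  simp [lor, add_dotProduct]

theorem lor_add_right (u v v' : Fin (q + 2 - p) → ℝ) : lor u (v + v') = lor u v + lor u v' := by
  simp [lor, Matrix.mulVec_add, dotProduct_add]

theorem lor_smul_left (a : ℝ) (u v : Fin (q + 2 - p) → ℝ) : lor (a • u) v = a * lor u v := by
  simp [lor]

theorem lor_smul_right (a : ℝ) (u v : Fin (q + 2 - p) → ℝ) : lor u (a • v) = a * lor u v := by
  simp [lor, Matrix.mulVec_smul]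

/-- The open positive cone. -/
def InCone (u : Fin (q + 2 - p) → ℝ) : Prop :=
  0 < lor u u ∧ ∀ i : Fin (q + 2 - p), (i : ℕ) = 0 → 0 < u i

/-- Reverse Cauchy–Schwarz in light-cone coordinates. There `lor u u = 2 a b - m` with `m ≥ 0`, so
`a > 0` forces `b > 0`; then `c² ≤ m m' < 4 (a b) (a' b') ≤ (a b' + b a')²` bounds the inner product
`c` of the remaining coordinates. -/
theorem lor_pos_of_inCone (hpq : p < q) {u v : Fin (q + 2 - p) → ℝ} (hu : InCone u)
    (hv : InCone v) : 0 < lor u v := by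
  obtain ⟨hu, hu0⟩ := hu
  obtain ⟨hv, hv0⟩ := hv
  have ha := hu0 ⟨0, by omega⟩ rfl
  have ha' := hv0 ⟨0, by omega⟩ rfl
  rw [lor_eq hpq] at hu hv ⊢
  set a := u ⟨0, by omega⟩
  set a' := v ⟨0, by omega⟩
  set b := (-1) ^ (p - 1) * u ⟨q + 1 - p, by omega⟩ with hb
  set b' := (-1) ^ (p - 1) * v ⟨q + 1 - p, by omega⟩ with hb'
  have hcs := Finset.sum_mul_sq_le_sq_mul_sq (innerIdx p q) u v
  have e1 : ∑ s ∈ innerIdx p q, u s * u s = ∑ s ∈ innerIdx p q, u s ^ 2 :=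
    Finset.sum_congr rfl fun s _ => (sq _).symm
  have e2 : ∑ s ∈ innerIdx p q, v s * v s = ∑ s ∈ innerIdx p q, v s ^ 2 :=
    Finset.sum_congr rfl fun s _ => (sq _).symm
  rw [e1] at hu
  rw [e2] at hv
  set m := ∑ s ∈ innerIdx p q, u s ^ 2 with hm
  set m' := ∑ s ∈ innerIdx p q, v s ^ 2 with hm'
  set c := ∑ s ∈ innerIdx p q, u s * v s
  have hm0 : 0 ≤ m := Finset.sum_nonneg fun s _ => sq_nonneg _
  have hm0' : 0 ≤ m' := Finset.sum_nonneg fun s _ => sq_nonneg _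
  have hu1 : m < 2 * (a * b) := by rw [hb]; linarith
  have hv1 : m' < 2 * (a' * b') := by rw [hb']; linarith
  have hbp : 0 < b := by
    by_contra! h
    linarith [mul_nonpos_of_nonneg_of_nonpos ha.le h]
  have hbp' : 0 < b' := by
    by_contra! h
    linarith [mul_nonpos_of_nonneg_of_nonpos ha'.le h]
  have key : c ^ 2 < (a * b' + b * a') ^ 2 := by
    have h1 : m * m' < (2 * (a * b)) * (2 * (a' * b')) :=
      mul_lt_mul'' hu1 hv1 hm0 hm0'
    nlinarith [sq_nonneg (a * b' - b * a')]
  have h2 : c < a * b' + b * a' := lt_of_pow_lt_pow_left₀ 2 (by positivity) key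
  rw [hb, hb'] at h2
  linarith

theorem InCone.add (hpq : p < q) {u v : Fin (q + 2 - p) → ℝ} (hu : InCone u) (hv : InCone v) :
    InCone (u + v) := by
  refine ⟨?_, fun i hi => add_pos (hu.2 i hi) (hv.2 i hi)⟩
  rw [lor_add_left, lor_add_right, lor_add_right, lor_comm hpq v u]
  have := lor_pos_of_inCone hpq hu hv
  linarith [hu.1, hv.1]

/-- The form is negative definite on the orthogonal of a positive vector. -/
theorem lor_neg_of_orthogonal (hpq : p < q) {w v : Fin (q + 2 - p) → ℝ} (hw : 0 < lor w w)
    (hwv : lor w v = 0) (hv : v ≠ 0) : lor v v < 0 := by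
  by_contra! hvv
  apply hv
  rw [lor_eq hpq] at hw hwv hvv
  have hε := neg_one_pow_mul_self (p - 1)
  set ε : ℝ := (-1) ^ (p - 1)
  set a := w ⟨0, by omega⟩
  set b := ε * w ⟨q + 1 - p, by omega⟩ with hb
  set x := v ⟨0, by omega⟩ with hx
  set y := ε * v ⟨q + 1 - p, by omega⟩ with hy
  have hcs := Finset.sum_mul_sq_le_sq_mul_sq (innerIdx p q) w v
  have e1 : ∑ s ∈ innerIdx p q, w s * w s = ∑ s ∈ innerIdx p q, w s ^ 2 :=
    Finset.sum_congr rfl fun s _ => (sq _).symm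
  have e2 : ∑ s ∈ innerIdx p q, v s * v s = ∑ s ∈ innerIdx p q, v s ^ 2 :=
    Finset.sum_congr rfl fun s _ => (sq _).symm
  rw [e1] at hw
  rw [e2] at hvv
  have hm0 : 0 ≤ ∑ s ∈ innerIdx p q, w s ^ 2 := Finset.sum_nonneg fun s _ => sq_nonneg _
  have hn0 : 0 ≤ ∑ s ∈ innerIdx p q, v s ^ 2 := Finset.sum_nonneg fun s _ => sq_nonneg _
  set m := ∑ s ∈ innerIdx p q, w s ^ 2
  set n := ∑ s ∈ innerIdx p q, v s ^ 2 with hn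
  have h1 : m < 2 * (a * b) := by rw [hb]; linarith
  have h2 : ∑ s ∈ innerIdx p q, w s * v s = a * y + b * x := by rw [hb, hy]; linarith
  have h3 : n ≤ 2 * (x * y) := by rw [hy]; linarith
  rw [h2] at hcs
  have hab : 0 < a * b := by linarith
  -- If `n > 0`, Cauchy–Schwarz would give `(a y + b x)² ≤ m n < 4 (a b) (x y)`, contradicting this
  -- inequality. So the inner coordinates of `v` vanish, and the two extreme ones follow.
  have h4 : 4 * (a * b) * (x * y) ≤ (a * y + b * x) ^ 2 := by nlinarith [sq_nonneg (a * y - b * x)]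
  have hnz : n = 0 := by
    by_contra hne
    have hnp : 0 < n := lt_of_le_of_ne hn0 (Ne.symm hne)
    have h5 : m * n < 2 * (a * b) * n := mul_lt_mul_of_pos_right h1 hnp
    have h6 : 2 * (a * b) * n ≤ 2 * (a * b) * (2 * (x * y)) :=
      mul_le_mul_of_nonneg_left h3 (by linarith)
    nlinarith
  rw [hnz] at hcs h3
  have h7 : a * y + b * x = 0 := by
    have : (a * y + b * x) ^ 2 ≤ 0 := by simpa using hcs
    exact pow_eq_zero_iff (two_ne_zero) |>.mp (le_antisymm this (sq_nonneg _))
  have h8 : a * b * (x * y) = -(a * y) ^ 2 := by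
    have : b * x = -(a * y) := by linarith
    calc a * b * (x * y) = (a * y) * (b * x) := by ring
      _ = _ := by rw [this]; ring
  have h9 : (a * y) ^ 2 = 0 := by
    have : 0 ≤ a * b * (x * y) := mul_nonneg hab.le (by linarith)
    nlinarith [sq_nonneg (a * y)]
  have ha : a ≠ 0 := fun h => by rw [h] at hab; simp at hab
  have hb0 : b ≠ 0 := fun h => by rw [h] at hab; simp at hab
  have hay : a * y = 0 := pow_eq_zero_iff (two_ne_zero) |>.mp h9
  have hy0 : y = 0 := (mul_eq_zero.mp hay).resolve_left ha
  have hx0 : x = 0 := by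
    rw [hay, zero_add] at h7
    exact (mul_eq_zero.mp h7).resolve_left hb0
  have hl0 : v ⟨q + 1 - p, by omega⟩ = 0 := by
    have : ε * y = 0 := by rw [hy0, mul_zero]
    rwa [hy, ← mul_assoc, hε, one_mul] at this
  ext s
  by_cases hs0 : (s : ℕ) = 0
  · rw [show s = ⟨0, by omega⟩ from Fin.ext hs0]; exact hx0
  · by_cases hsl : (s : ℕ) = q + 1 - p
    · rw [show s = ⟨q + 1 - p, by omega⟩ from Fin.ext hsl]; exact hl0
    · have := (Finset.sum_eq_zero_iff_of_nonneg (fun s _ => sq_nonneg (v s))).mp (hn.symm.trans hnz) s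
        (by simp [innerIdx, hs0, hsl])
      exact pow_eq_zero_iff (two_ne_zero) |>.mp this

/-- The dual majorant of the Lorentzian form defined by a positive vector is positive definite. -/
theorem exists_majorant (hpq : p < q) {w : Fin (q + 2 - p) → ℝ} (hw : 0 < lor w w) :
    ∃ c > 0, ∀ v : Fin (q + 2 - p) → ℝ,
      c * ‖v‖ ^ 2 ≤ 2 / lor w w * (w ⬝ᵥ v) ^ 2 - lor v v := by
  have hpos : ∀ v : Fin (q + 2 - p) → ℝ, v ≠ 0 → 0 < 2 / lor w w * (w ⬝ᵥ v) ^ 2 - lor v v := by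
    intro v hv
    -- As `J² = 1`, passing to `u = J v` preserves the form and turns the dot product with `w` into
    -- `lor w u`. The expression becomes the form with its sign reversed on the orthogonal of `w`.
    set u := (formJ p q).mulVec v with hu
    have h1 : w ⬝ᵥ v = lor w u := by rw [lor, hu, formJ_mulVec_mulVec hpq]
    have h2 : lor v v = lor u u := by
      rw [lor, lor, hu, formJ_mulVec_mulVec hpq, dotProduct_comm]
    have hu0 : u ≠ 0 := fun h => hv (by
      rw [← formJ_mulVec_mulVec hpq v, ← hu, h, Matrix.mulVec_zero])
    set c := lor w u / lor w w with hc
    have hcw : lor w u = c * lor w w := by rw [hc]; field_simp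
    set u' := u + (-c) • w with hu'
    have huu : u = u' + c • w := by rw [hu']; module
    have horth : lor w u' = 0 := by rw [hu', lor_add_right, lor_smul_right, hcw]; ring
    have h3 : lor u u = lor u' u' + c ^ 2 * lor w w := by
      rw [huu]
      simp only [lor_add_left, lor_add_right, lor_smul_left, lor_smul_right, lor_comm hpq u' w, horth]
      ring
    have h4 : 2 / lor w w * (w ⬝ᵥ v) ^ 2 = 2 * c ^ 2 * lor w w := by
      rw [h1, hcw]; field_simp
    rw [h4, h2, h3]
    by_cases h0 : u' = 0
    · have hc0 : c ≠ 0 := fun h => hu0 (by rw [huu, h0, h]; simp)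
      have : lor u' u' = 0 := by rw [h0, lor]; simp
      have := mul_pos (pow_pos (abs_pos.mpr hc0) 2) hw
      rw [sq_abs] at this
      linarith
    · have := lor_neg_of_orthogonal hpq hw horth h0
      have := mul_nonneg (sq_nonneg c) hw.le
      linarith
  -- The constant `c` is the minimum on the unit sphere, extended to all vectors by homogeneity.
  have hne : (Metric.sphere (0 : Fin (q + 2 - p) → ℝ) 1).Nonempty := by
    have : Nonempty (Fin (q + 2 - p)) := ⟨⟨0, by omega⟩⟩
    exact NormedSpace.sphere_nonempty.mpr zero_le_one
  have hcont : Continuous fun v : Fin (q + 2 - p) → ℝ =>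
      2 / lor w w * (w ⬝ᵥ v) ^ 2 - lor v v := by
    unfold lor dotProduct Matrix.mulVec dotProduct
    fun_prop
  obtain ⟨v₀, hv₀, hmin⟩ := (isCompact_sphere (0 : Fin (q + 2 - p) → ℝ) 1).exists_isMinOn hne
    hcont.continuousOn
  have hv₀' : v₀ ≠ 0 := by
    intro h; rw [h] at hv₀; simp at hv₀
  refine ⟨_, hpos v₀ hv₀', fun v => ?_⟩
  by_cases hv : v = 0
  · simp [hv, lor]
  have hvn : 0 < ‖v‖ := norm_pos_iff.mpr hv
  have hmem : ‖v‖⁻¹ • v ∈ Metric.sphere (0 : Fin (q + 2 - p) → ℝ) 1 := by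
    simp [norm_smul, hvn.ne']
  have h5 := hmin hmem
  simp only [Set.mem_ofPred_eq] at h5
  rw [dotProduct_smul, lor_smul_left, lor_smul_right, smul_eq_mul] at h5
  have h6 : 2 / lor w w * (‖v‖⁻¹ * w ⬝ᵥ v) ^ 2 - ‖v‖⁻¹ * (‖v‖⁻¹ * lor v v) =
      (‖v‖ ^ 2)⁻¹ * (2 / lor w w * (w ⬝ᵥ v) ^ 2 - lor v v) := by
    field_simp
  rw [h6] at h5
  have h7 := mul_le_mul_of_nonneg_right h5 (sq_nonneg ‖v‖)
  have h8 : (‖v‖ ^ 2)⁻¹ * (2 / lor w w * (w ⬝ᵥ v) ^ 2 - lor v v) * ‖v‖ ^ 2 =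
      2 / lor w w * (w ⬝ᵥ v) ^ 2 - lor v v := by
    field_simp
  rwa [h8] at h7

/-- An approximately Lorentzian transformation has the size of its value on a positive vector. -/
theorem tendsto_lorentz_div (hpq : p < q)
    {M K L : ℕ → Matrix (Fin (q + 2 - p)) (Fin (q + 2 - p)) ℝ}
    (hK : ∀ s t, Tendsto (fun n => K n s t) atTop (𝓝 (formJ p q s t)))
    (hL : ∀ s t, Tendsto (fun n => L n s t) atTop (𝓝 (formJ p q s t)))
    (hMK : ∀ᶠ n in atTop, M n * K n * (M n).transpose = formJ p q)
    (hML : ∀ n, (M n).transpose * formJ p q * M n = L n)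
    {w : ℕ → Fin (q + 2 - p) → ℝ} {w₀ : Fin (q + 2 - p) → ℝ}
    (hw : ∀ s, Tendsto (fun n => w n s) atTop (𝓝 (w₀ s))) (hw₀ : 0 < lor w₀ w₀) {μ : ℕ → ℝ}
    (hμ : ∀ s, Tendsto (fun n => (M n).mulVec (w n) s / μ n) atTop (𝓝 0)) :
    Tendsto (fun n => (μ n)⁻¹) atTop (𝓝 0) ∧
      ∀ s t, Tendsto (fun n => M n s t / μ n) atTop (𝓝 0) := by
  have hquad : ∀ (A : Matrix (Fin (q + 2 - p)) (Fin (q + 2 - p)) ℝ) (v : Fin (q + 2 - p) → ℝ),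
      v ⬝ᵥ A.mulVec v = ∑ s, ∑ t, A s t * (v s * v t) := by
    intro A v
    simp only [dotProduct, Matrix.mulVec, Finset.mul_sum]
    exact Finset.sum_congr rfl fun s _ => Finset.sum_congr rfl fun t _ => by ring
  -- The `J`-norm of `M w / μ` tends to `0` and equals `μ⁻²` times the `L`-norm of `w`, which tends
  -- to `lor w₀ w₀ > 0`.
  have hinv2 : Tendsto (fun n => ((μ n)⁻¹) ^ 2) atTop (𝓝 0) := by
    have h1 : Tendsto (fun n => w n ⬝ᵥ (L n).mulVec (w n)) atTop (𝓝 (lor w₀ w₀)) := by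
      simp only [lor, hquad]
      exact tendsto_finsetSum _ fun s _ => tendsto_finsetSum _ fun t _ =>
        (hL s t).mul ((hw s).mul (hw t))
    have h2 : Tendsto (fun n => ((μ n)⁻¹ • (M n).mulVec (w n)) ⬝ᵥ
        (formJ p q).mulVec ((μ n)⁻¹ • (M n).mulVec (w n))) atTop (𝓝 0) := by
      simp only [hquad]
      have : ∀ s t, Tendsto (fun n => formJ p q s t * (((μ n)⁻¹ • (M n).mulVec (w n)) s *
          ((μ n)⁻¹ • (M n).mulVec (w n)) t)) atTop (𝓝 0) := fun s t => by
        have := ((hμ s).mul (hμ t)).const_mul (formJ p q s t)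
        simpa [div_eq_inv_mul] using this
      have h3 := tendsto_finsetSum Finset.univ fun s _ => tendsto_finsetSum Finset.univ fun t _ => this s t
      simpa using h3
    have h4 : ∀ n, ((μ n)⁻¹ • (M n).mulVec (w n)) ⬝ᵥ
        (formJ p q).mulVec ((μ n)⁻¹ • (M n).mulVec (w n)) =
        ((μ n)⁻¹) ^ 2 * (w n ⬝ᵥ (L n).mulVec (w n)) := by
      intro n
      rw [← hML n, Matrix.mulVec_smul, smul_dotProduct, dotProduct_smul, smul_eq_mul, smul_eq_mul,
        ← Matrix.mulVec_mulVec, ← Matrix.mulVec_mulVec, Matrix.dotProduct_mulVec (w n),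
        Matrix.vecMul_transpose]
      ring
    simp only [h4] at h2
    have h5 := h2.div h1 hw₀.ne'
    rw [zero_div] at h5
    refine h5.congr' ?_
    filter_upwards [h1.eventually (lt_mem_nhds hw₀)] with n hn
    exact mul_div_cancel_right₀ _ hn.ne'
  refine ⟨?_, fun s t => ?_⟩
  · rw [tendsto_zero_iff_abs_tendsto_zero]
    have := (Real.continuous_sqrt.tendsto _).comp hinv2
    simpa [Function.comp_def, Real.sqrt_sq_eq_abs] using this
  obtain ⟨c, hc, hmaj⟩ := exists_majorant hpq hw₀
  set A := 2 / lor w₀ w₀ with hA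
  have hA0 : 0 < A := by positivity
  let T : ℕ → Fin (q + 2 - p) → Fin (q + 2 - p) → ℝ := fun n s t => A * (w n s * w n t) - K n s t
  let T₀ : Fin (q + 2 - p) → Fin (q + 2 - p) → ℝ := fun s t => A * (w₀ s * w₀ t) - formJ p q s t
  have hT : ∀ s t, Tendsto (fun n => T n s t) atTop (𝓝 (T₀ s t)) := fun s t =>
    (((hw s).mul (hw t)).const_mul A).sub (hK s t)
  have hquad' : ∀ (B : Matrix (Fin (q + 2 - p)) (Fin (q + 2 - p)) ℝ) (w v : Fin (q + 2 - p) → ℝ),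
      A * (w ⬝ᵥ v) ^ 2 - v ⬝ᵥ B.mulVec v = ∑ s, ∑ t, (A * (w s * w t) - B s t) * (v s * v t) := by
    intro B w v
    rw [hquad, sq, dotProduct, Finset.sum_mul_sum, Finset.mul_sum, ← Finset.sum_sub_distrib]
    refine Finset.sum_congr rfl fun s _ => ?_
    rw [Finset.mul_sum, ← Finset.sum_sub_distrib]
    exact Finset.sum_congr rfl fun t _ => by ring
  have hdiff : Tendsto (fun n => ∑ s, ∑ t, |T n s t - T₀ s t|) atTop (𝓝 0) := by
    have h3 := tendsto_finsetSum Finset.univ fun s _ => tendsto_finsetSum Finset.univ fun t _ =>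
      ((hT s t).sub_const (T₀ s t)).abs
    simpa using h3
  -- For the row `v` of index `s`, `M K Mᵀ = J` prescribes the value `J s s` of the form `K`, while
  -- `w ⬝ᵥ v` is the coordinate `s` of `M w`. The majorant thus bounds the row; replacing `w₀`, `J`
  -- by `w n`, `K n` costs at most `c / 2`, which is absorbed.
  have hbound : ∀ᶠ n in atTop, (M n s t) ^ 2 ≤ 2 / c * (A * ((M n).mulVec (w n) s) ^ 2 +
      |formJ p q s s|) := by
    filter_upwards [hMK, hdiff.eventually (gt_mem_nhds (half_pos hc))] with n hn hd
    set v : Fin (q + 2 - p) → ℝ := M n s with hv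
    have h1 := hmaj v
    rw [lor, hquad' (formJ p q) w₀ v] at h1
    have h2 : |(∑ s, ∑ t, T n s t * (v s * v t)) - ∑ s, ∑ t, T₀ s t * (v s * v t)| ≤
        (∑ s, ∑ t, |T n s t - T₀ s t|) * ‖v‖ ^ 2 := by
      rw [← Finset.sum_sub_distrib, Finset.sum_mul]
      refine (Finset.abs_sum_le_sum_abs _ _).trans (Finset.sum_le_sum fun i _ => ?_)
      rw [← Finset.sum_sub_distrib, Finset.sum_mul]
      refine (Finset.abs_sum_le_sum_abs _ _).trans (Finset.sum_le_sum fun j _ => ?_)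
      rw [← sub_mul, abs_mul, abs_mul, sq]
      refine mul_le_mul_of_nonneg_left ?_ (abs_nonneg _)
      exact mul_le_mul (norm_le_pi_norm v i) (norm_le_pi_norm v j) (abs_nonneg _) (norm_nonneg _)
    have h3 : (∑ s, ∑ t, T n s t * (v s * v t)) = A * ((M n).mulVec (w n) s) ^ 2 - formJ p q s s := by
      rw [← hquad' (K n) (w n) v, ← hn, dotProduct_comm]
      congr 1
      rw [Matrix.mul_apply]
      simp only [dotProduct, Matrix.mulVec, Matrix.mul_apply, Matrix.transpose_apply, hv,
        Finset.mul_sum, Finset.sum_mul]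
      rw [Finset.sum_comm]
      exact Finset.sum_congr rfl fun i _ => Finset.sum_congr rfl fun j _ => by ring
    rw [h3] at h2
    have h4 := (abs_le.mp h2).1
    have h5 : (∑ s, ∑ t, |T n s t - T₀ s t|) * ‖v‖ ^ 2 ≤ c / 2 * ‖v‖ ^ 2 :=
      mul_le_mul_of_nonneg_right hd.le (sq_nonneg _)
    have h6 := neg_le_abs (formJ p q s s)
    have h7 : (M n s t) ^ 2 ≤ ‖v‖ ^ 2 := by
      rw [← sq_abs]
      exact pow_le_pow_left₀ (abs_nonneg _) (norm_le_pi_norm v t) 2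
    refine h7.trans ?_
    rw [div_mul_eq_mul_div, le_div_iff₀ hc]
    change c * ‖v‖ ^ 2 ≤ ∑ s, ∑ t, T₀ s t * (v s * v t) at h1
    linarith
  have hsq : Tendsto (fun n => (M n s t / μ n) ^ 2) atTop (𝓝 0) := by
    have h8 : Tendsto (fun n => 2 / c * (A * ((M n).mulVec (w n) s / μ n) ^ 2 +
        |formJ p q s s| * ((μ n)⁻¹) ^ 2)) atTop (𝓝 0) := by
      have := ((((hμ s).pow 2).const_mul A).add (hinv2.const_mul |formJ p q s s|)).const_mul (2 / c)
      simpa using this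
    refine squeeze_zero' (Eventually.of_forall fun n => sq_nonneg _) ?_ h8
    filter_upwards [hbound] with n hn
    have := mul_le_mul_of_nonneg_right hn (sq_nonneg (μ n)⁻¹)
    calc (M n s t / μ n) ^ 2 = M n s t ^ 2 * (μ n)⁻¹ ^ 2 := by rw [div_eq_mul_inv, mul_pow]
      _ ≤ _ := this
      _ = _ := by rw [div_eq_mul_inv ((M n).mulVec (w n) s), mul_pow]; ring
  rw [tendsto_zero_iff_abs_tendsto_zero]
  have := (Real.continuous_sqrt.tendsto _).comp hsq
  simpa [Function.comp_def, Real.sqrt_sq_eq_abs] using this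

end Lorentz

/-! ### The middle part of column `q + 1` of a positive element -/

section MiddleBlock

variable {p q : ℕ}

/-- The position in `Fin (p + q)` of an index of the middle block. -/
def midIdx (hp : 1 ≤ p) (s : Fin (q + 2 - p)) : Fin (p + q) := ⟨s + (p - 1), by omega⟩

theorem elemLast_mid (hpq : p < q) (hp : 2 ≤ p) (v : Fin (q + 2 - p) → ℝ)
    (s t : Fin (q + 2 - p)) :
    elemLast p q v (midIdx (by omega) s) (midIdx (by omega) t) = if s = t then 1 else 0 := by
  have hs := s.2
  have ht := t.2
  by_cases h : s = t
  · rw [h, elemLast, Matrix.of_apply, if_pos rfl, if_pos rfl]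
  · have h' : (s : ℕ) ≠ t := fun h' => h (Fin.ext h')
    simp only [elemLast, Matrix.of_apply, midIdx, Fin.ext_iff]
    rw [if_neg (by omega), if_neg (by omega), dif_neg (by omega), dif_neg (by omega), if_neg h']

theorem elemShort_mid (hpq : p < q) (hp : 2 ≤ p) {k : ℕ} (hk : k + 2 ≤ p) (a : ℝ)
    (s t : Fin (q + 2 - p)) :
    elemShort p q k a (midIdx (by omega) s) (midIdx (by omega) t) = if s = t then 1 else 0 := by
  have hs := s.2
  have ht := t.2
  by_cases h : s = t
  · rw [h, elemShort, Matrix.of_apply, if_pos rfl, if_pos rfl]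
  · have h' : (s : ℕ) ≠ t := fun h' => h (Fin.ext h')
    simp only [elemShort, Matrix.of_apply, midIdx, Fin.ext_iff]
    rw [if_neg (by omega), if_neg (by omega), if_neg h']

/-- The index of the column to the right of the middle block. -/
def nextIdx (hp : 2 ≤ p) : Fin (p + q) := ⟨q + 1, by omega⟩

/-- `A` is unitriangular with trivial middle block, and `u` describes the part of the column
`q + 1` in the middle block. -/
def HasMidVector (hp : 2 ≤ p) (A : Matrix (Fin (p + q)) (Fin (p + q)) ℝ)
    (u : Fin (q + 2 - p) → ℝ) : Prop :=
  IsUnip A ∧ (∀ s t, A (midIdx (by omega) s) (midIdx (by omega) t) = if s = t then 1 else 0) ∧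
    ∀ s, A (midIdx (by omega) s) (nextIdx hp) = (-1) ^ (p - 1) * (formJ p q).mulVec u s

/-- Since the middle blocks are trivial, only the indices `midIdx s` and `q + 1` contribute to the
entry in column `q + 1`, with coefficient `1` each; the vectors add. -/
theorem HasMidVector.mul (hpq : p < q) {hp : 2 ≤ p} {A B : Matrix (Fin (p + q)) (Fin (p + q)) ℝ}
    {u v : Fin (q + 2 - p) → ℝ} (hA : HasMidVector hp A u) (hB : HasMidVector hp B v) :
    HasMidVector hp (A * B) (u + v) := by
  have hmid : ∀ l : Fin (p + q), p - 1 ≤ (l : ℕ) → (l : ℕ) ≤ q →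
      ∃ r : Fin (q + 2 - p), midIdx (by omega) r = l := fun l h1 h2 =>
    ⟨⟨l - (p - 1), by omega⟩, Fin.ext (by simp only [midIdx]; omega)⟩
  have hinj : ∀ r s : Fin (q + 2 - p), midIdx (by omega) r = midIdx (by omega) s → r = s := by
    intro r s h
    simp only [midIdx, Fin.mk.injEq] at h
    exact Fin.ext (by omega)
  refine ⟨hA.1.mul hB.1, fun s t => ?_, fun s => ?_⟩
  · have ht := t.2
    rw [hA.1.mul_apply hB.1]
    by_cases hst : s ≤ t
    · rw [Finset.sum_eq_single (midIdx (by omega) s)]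
      · rw [hA.2.1, if_pos rfl, one_mul, hB.2.1]
      · intro l hl hls
        rw [Finset.mem_Icc, Fin.le_def, Fin.le_def] at hl
        simp only [midIdx] at hl
        obtain ⟨r, rfl⟩ := hmid l (by omega) (by omega)
        rw [hA.2.1, if_neg fun h => hls (by rw [h]), zero_mul]
      · intro h
        exact absurd (Finset.mem_Icc.mpr ⟨le_rfl, by
          rw [Fin.le_def] at hst ⊢; simp only [midIdx]; omega⟩) h
    · rw [Finset.Icc_eq_empty, Finset.sum_empty, if_neg (fun h => hst (by rw [h]))]
      rw [Fin.le_def] at hst ⊢; simp only [midIdx]; omega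
  · have hs := s.2
    rw [hA.1.mul_apply hB.1, Matrix.mulVec_add, Pi.add_apply, mul_add, ← hA.2.2, ← hB.2.2]
    have hne : midIdx (by omega) s ≠ (nextIdx hp : Fin (p + q)) := by
      simp only [midIdx, nextIdx, Ne, Fin.ext_iff]; omega
    rw [← Finset.sum_subset (s₁ := {nextIdx hp, midIdx (by omega) s}), Finset.sum_pair hne.symm,
      hB.1.2, hA.1.2, mul_one, one_mul]
    · intro l hl
      simp only [Finset.mem_insert, Finset.mem_singleton] at hl
      rw [Finset.mem_Icc, Fin.le_def, Fin.le_def]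
      rcases hl with rfl | rfl <;> simp only [midIdx, nextIdx] <;> omega
    · intro l hl hl'
      rw [Finset.mem_Icc, Fin.le_def, Fin.le_def] at hl
      simp only [Finset.mem_insert, Finset.mem_singleton, not_or] at hl'
      have h1 : (l : ℕ) ≠ q + 1 := fun h => hl'.1 (Fin.ext h)
      simp only [midIdx, nextIdx] at hl
      obtain ⟨r, rfl⟩ := hmid l (by omega) (by omega)
      rw [hA.2.1, if_neg fun h => hl'.2 (by rw [h]), zero_mul]

theorem hasMidVector_one (hpq : p < q) (hp : 2 ≤ p) : HasMidVector (q := q) hp 1 0 := by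
  refine ⟨isUnip_one, fun s t => ?_, fun s => ?_⟩
  · rw [Matrix.one_apply]
    have : (midIdx (q := q) (by omega : 1 ≤ p) s = midIdx (by omega) t) ↔ s = t := by
      simp only [midIdx, Fin.ext_iff]; omega
    simp only [this]
  · have hs := s.2
    rw [Matrix.one_apply_ne]
    · simp
    · simp only [midIdx, nextIdx, Ne, Fin.ext_iff]; omega

theorem hasMidVector_elemLast (hpq : p < q) (hp : 2 ≤ p) (v : Fin (q + 2 - p) → ℝ) :
    HasMidVector hp (elemLast p q v) v := by
  refine ⟨elemLast_isUnip hpq v, elemLast_mid hpq hp v, fun s => ?_⟩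
  have hs := s.2
  have e : (⟨(s : ℕ) + (p - 1) + 1 - p, by omega⟩ : Fin (q + 2 - p)) = s :=
    Fin.ext (by simp only; omega)
  simp only [elemLast, Matrix.of_apply, midIdx, nextIdx, Fin.ext_iff]
  rw [if_neg (by omega), if_neg (by omega), dif_neg (by omega), dif_pos ⟨trivial, by omega, by omega⟩, e]

theorem hasMidVector_elemShort (hpq : p < q) (hp : 2 ≤ p) {k : ℕ} (hk : k + 2 ≤ p) (a : ℝ) :
    HasMidVector (q := q) hp (elemShort p q k a) 0 := by
  refine ⟨elemShort_isUnip k a, elemShort_mid hpq hp hk a, fun s => ?_⟩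
  have hs := s.2
  simp only [elemShort, Matrix.of_apply, midIdx, nextIdx, Fin.ext_iff]
  rw [if_neg (by omega), if_neg (by omega)]
  simp

/-- The open cone is stable under addition, so a sum of zeros and cone vectors lies in the cone as
soon as one summand does. This applies because only `E_{p-1}` contributes a nonzero vector. -/
theorem exists_midVector_list (hpq : p < q) (hp : 2 ≤ p)
    {l : List (Matrix (Fin (p + q)) (Fin (p + q)) ℝ)}
    (h : ∀ A ∈ l, ∃ u, HasMidVector hp A u ∧ (u = 0 ∨ InCone u)) :
    ∃ u, HasMidVector hp l.prod u ∧ (u = 0 ∨ InCone u) ∧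
      ((∃ A ∈ l, ∃ u, HasMidVector hp A u ∧ InCone u) → InCone u) := by
  induction l with
  | nil => exact ⟨0, hasMidVector_one hpq hp, Or.inl rfl, by simp⟩
  | cons B l ih =>
    obtain ⟨u, hu, hu', hu''⟩ := ih fun A hA => h A (List.mem_cons_of_mem B hA)
    rw [List.prod_cons]
    by_cases hB : ∃ v, HasMidVector hp B v ∧ InCone v
    · obtain ⟨v, hv, hv'⟩ := hB
      have : InCone (v + u) := by
        rcases hu' with rfl | hu'
        · simpa using hv'
        · exact hv'.add hpq hu'
      exact ⟨v + u, hv.mul hpq hu, Or.inr this, fun _ => this⟩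
    · obtain ⟨v, hv, hv'⟩ := h B (by simp)
      rcases hv' with rfl | hv'
      · refine ⟨0 + u, hv.mul hpq hu, by simpa using hu', ?_⟩
        rintro ⟨A, hA, w, hw⟩
        rw [zero_add]
        rcases List.mem_cons.mp hA with rfl | hA
        · exact absurd ⟨w, hw⟩ hB
        · exact hu'' ⟨A, hA, w, hw⟩
      · exact absurd ⟨v, hv, hv'⟩ hB

theorem elem_midVector (hpq : p < q) (hp : 2 ≤ p) (v : VTheta p q) (j : ℕ) :
    ∃ u, HasMidVector hp (v.elem j) u ∧ (u = 0 ∨ InCone u) := by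
  rw [VTheta.elem]
  split_ifs with h
  · exact ⟨0, hasMidVector_elemShort hpq hp (by omega) _, Or.inl rfl⟩
  · exact ⟨_, hasMidVector_elemLast hpq hp _, Or.inr ⟨v.last_pos, v.last_first⟩⟩

theorem ab_midVector (hpq : p < q) (hp : 2 ≤ p) (v : VTheta p q) :
    ∃ u, HasMidVector hp v.ab u ∧ InCone u := by
  have hel : ∀ f : ℕ → Bool, ∀ A ∈ (((List.range' 1 (p - 1)).filter f).map v.elem),
      ∃ u, HasMidVector hp A u ∧ (u = 0 ∨ InCone u) := by
    intro f A hA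
    obtain ⟨j, -, rfl⟩ := List.mem_map.mp hA
    exact elem_midVector hpq hp v j
  have hlast : ∃ u, HasMidVector hp (v.elem (p - 1)) u ∧ InCone u := by
    rw [VTheta.elem, dif_neg (by omega)]
    exact ⟨_, hasMidVector_elemLast hpq hp _, v.last_pos, v.last_first⟩
  have hmem : p - 1 ∈ List.range' 1 (p - 1) := by rw [List.mem_range'_1]; omega
  obtain ⟨u, hu, hu', hu''⟩ := exists_midVector_list hpq hp (hel fun j => decide (j % 2 = 0))
  obtain ⟨w, hw, hw', hw''⟩ := exists_midVector_list hpq hp (hel fun j => decide (j % 2 = 1))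
  refine ⟨u + w, hu.mul hpq hw, ?_⟩
  rcases Nat.mod_two_eq_zero_or_one (p - 1) with h | h
  · have h1 := hu'' ⟨_, List.mem_map.mpr ⟨p - 1, List.mem_filter.mpr ⟨hmem, by simpa using h⟩, rfl⟩,
      hlast⟩
    rcases hw' with rfl | hw'
    · simpa using h1
    · exact h1.add hpq hw'
  · have h1 := hw'' ⟨_, List.mem_map.mpr ⟨p - 1, List.mem_filter.mpr ⟨hmem, by simpa using h⟩, rfl⟩,
      hlast⟩
    rcases hu' with rfl | hu'
    · simpa using h1
    · exact hu'.add hpq h1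

theorem posElem_midVector (hpq : p < q) (hp : 2 ≤ p) (v : Fin (p - 1) → VTheta p q) :
    ∃ u, HasMidVector hp (posElem v) u ∧ InCone u := by
  obtain ⟨u, hu, -, hu'⟩ := exists_midVector_list hpq hp (l := List.ofFn fun i => (v i).ab)
    (fun A hA => by
      obtain ⟨i, rfl⟩ := (List.mem_ofFn' _ _).mp hA
      obtain ⟨w, hw, hw'⟩ := ab_midVector hpq hp (v i)
      exact ⟨w, hw, Or.inr hw'⟩)
  refine ⟨u, hu, hu' ⟨(v ⟨0, by omega⟩).ab, ?_, ab_midVector hpq hp _⟩⟩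
  exact (List.mem_ofFn' _ _).mpr ⟨⟨0, by omega⟩, rfl⟩

/-- The actual column is `± J u`, and `J` is an isometry of its own form because `J² = 1`. -/
theorem lor_midVector_pos (hpq : p < q) {u : Fin (q + 2 - p) → ℝ} (hu : InCone u) :
    0 < lor (fun s => (-1) ^ (p - 1) * (formJ p q).mulVec u s)
      (fun s => (-1) ^ (p - 1) * (formJ p q).mulVec u s) := by
  have h : (fun s => (-1) ^ (p - 1) * (formJ p q).mulVec u s) =
      ((-1) ^ (p - 1) : ℝ) • (formJ p q).mulVec u := rfl
  rw [h, lor_smul_left, lor_smul_right, ← mul_assoc, neg_one_pow_mul_self, one_mul, lor,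
    formJ_mulVec_mulVec hpq, dotProduct_comm]
  exact hu.1

end MiddleBlock

/-! ### Entries and involutivity of the form `Q` -/

section FormQ

variable {p q : ℕ}

theorem formQ_apply_of_ne (i j : Fin (p + q)) (hi : (i : ℕ) < p ∨ q ≤ (i : ℕ)) :
    formQ p q i j = if (i : ℕ) + j + 1 = p + q then (-1) ^ (min (i : ℕ) j) else 0 := by
  rw [formQ, Matrix.of_apply, if_neg (by omega)]

theorem formQ_apply_of_mem (i j : Fin (p + q)) (hi : p ≤ (i : ℕ)) (hi' : (i : ℕ) < q) :
    formQ p q i j = if i = j then -1 else 0 := by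
  rw [formQ, Matrix.of_apply, if_pos ⟨hi, hi'⟩]

theorem formQ_transpose : (formQ p q).transpose = formQ p q := by
  ext i j
  rw [Matrix.transpose_apply]
  by_cases hi : p ≤ (i : ℕ) ∧ (i : ℕ) < q
  · rw [formQ_apply_of_mem i j hi.1 hi.2]
    by_cases hj : p ≤ (j : ℕ) ∧ (j : ℕ) < q
    · rw [formQ_apply_of_mem j i hj.1 hj.2]; simp only [eq_comm]
    · rw [formQ_apply_of_ne j i (by omega), if_neg (by omega), if_neg (by rintro rfl; exact hj hi)]
  · rw [formQ_apply_of_ne i j (by omega)]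
    by_cases hj : p ≤ (j : ℕ) ∧ (j : ℕ) < q
    · rw [formQ_apply_of_mem j i hj.1 hj.2, if_neg (by rintro rfl; exact hi hj), if_neg (by omega)]
    · rw [formQ_apply_of_ne j i (by omega), min_comm, add_comm (j : ℕ)]

theorem formQ_mul_self : formQ p q * formQ p q = 1 := by
  ext i j
  rw [Matrix.mul_apply]
  by_cases hi : p ≤ (i : ℕ) ∧ (i : ℕ) < q
  · rw [Finset.sum_eq_single i]
    · rw [formQ_apply_of_mem i i hi.1 hi.2, formQ_apply_of_mem i j hi.1 hi.2, if_pos rfl,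
        Matrix.one_apply]
      split_ifs <;> simp
    · intro l _ hl
      rw [formQ_apply_of_mem i l hi.1 hi.2, if_neg hl.symm, zero_mul]
    · simp
  · have hi2 := i.2
    rw [Finset.sum_eq_single ⟨p + q - 1 - i, by omega⟩]
    · rw [formQ_apply_of_ne i _ (by omega), formQ_apply_of_ne _ j (by simp only; omega),
        if_pos (by simp only; omega), Matrix.one_apply]
      by_cases h : i = j
      · subst h
        rw [if_pos rfl, if_pos (by simp only; omega), min_comm, neg_one_pow_mul_self]
      · have h' : (i : ℕ) ≠ j := fun h' => h (Fin.ext h')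
        rw [if_neg h, if_neg (by simp only; omega), mul_zero]
    · intro l _ hl
      have h' : (l : ℕ) ≠ p + q - 1 - i := fun h' => hl (Fin.ext h')
      rw [formQ_apply_of_ne i l (by omega), if_neg (by omega), zero_mul]
    · simp

theorem formQ_mid (hpq : p < q) (hp : 1 ≤ p) (s t : Fin (q + 2 - p)) :
    formQ p q (midIdx hp s) (midIdx hp t) = formJ p q s t := by
  have hs := s.2
  have ht := t.2
  simp only [formQ, formJ, Matrix.of_apply, midIdx, Fin.ext_iff]
  by_cases h1 : (s : ℕ) = 0 ∨ (s : ℕ) = q + 1 - p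
  · rw [if_neg (by omega)]
    by_cases h2 : (s : ℕ) + t + 1 = q + 2 - p
    · rw [if_pos (by omega), if_pos (by omega)]
      congr 1; omega
    · rw [if_neg (by omega), if_neg (by omega), if_neg (by omega)]
  · by_cases h2 : (s : ℕ) = t
    · rw [if_pos (by omega), if_pos (by omega), if_neg (by omega), if_pos (by omega)]
    · rw [if_pos (by omega), if_neg (by omega), if_neg (by omega), if_neg (by omega)]

end FormQ

/-! ### Symmetry of the singular values in `SO(p,q)` -/

section SingularValues

/-- Antitone families with the same multiset of values agree. -/
theorem eq_of_antitone_of_map_eq {d : ℕ} {f h : Fin d → ℝ} (hf : Antitone f) (hh : Antitone h)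
    (hm : Multiset.map f Finset.univ.val = Multiset.map h Finset.univ.val) : f = h := by
  rw [← List.ofFn_inj]
  rw [Fin.univ_val_map, Fin.univ_val_map, Multiset.coe_eq_coe] at hm
  exact hm.eq_of_sortedGE hf.sortedGE_ofFn hh.sortedGE_ofFn

variable {d : ℕ}

theorem charpoly_lin (A : Matrix (Fin d) (Fin d) ℝ) :
    (Matrix.toEuclideanLin A).charpoly = A.charpoly := by
  rw [Matrix.toEuclideanLin, Matrix.toLpLin_eq_toLin, Matrix.charpoly_toLin]

open Polynomial in
/-- If `gᵀ g` is conjugate to its inverse, the singular values of `g` are symmetric. -/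
theorem singularValues_mul_rev {g Q : Matrix (Fin d) (Fin d) ℝ} (hQQ : Q * Q = 1)
    (h : g.transpose * Q * g = Q) (i : Fin d) :
    (Matrix.toEuclideanLin g).singularValues i *
      (Matrix.toEuclideanLin g).singularValues (Fin.rev i) = 1 := by
  set T := Matrix.toEuclideanLin g with hT
  set S := g.transpose * g with hS
  have hadj : LinearMap.adjoint T ∘ₗ T = Matrix.toEuclideanLin S := by
    rw [hT, ← Matrix.toEuclideanLin_conjTranspose_eq_adjoint]
    refine LinearMap.ext fun v => ?_
    rw [LinearMap.comp_apply, ← lin_mul, Matrix.conjTranspose_eq_transpose_of_trivial]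
  have hsym := T.isSymmetric_adjoint_comp_self
  have hn : Module.finrank ℝ (E d) = d := finrank_euclideanSpace_fin
  set ev := hsym.eigenvalues hn with hev
  have hgQ : g * (Q * g.transpose * Q) = 1 := by
    rw [mul_eq_one_comm]
    rw [mul_assoc, mul_assoc, ← mul_assoc g.transpose, h, hQQ]
  -- So `Q S Q` is the inverse of `S = gᵀ g`, and it is conjugate to `S` because `Q² = 1`. Computing
  -- its characteristic polynomial in both ways shows that the eigenvalues of `S` are permuted by
  -- inversion.
  have hSinv : S * (Q * S * Q) = 1 := by
    calc S * (Q * S * Q) = g.transpose * (g * (Q * g.transpose * Q)) * Q * g * Q := by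
          rw [hS]
          have : Q * Q = 1 := hQQ
          calc g.transpose * g * (Q * (g.transpose * g) * Q)
              = g.transpose * g * Q * g.transpose * 1 * g * Q := by simp only [mul_assoc, mul_one]
            _ = g.transpose * g * Q * g.transpose * (Q * Q) * g * Q := by rw [this]
            _ = _ := by simp only [mul_assoc]
      _ = 1 := by rw [hgQ, mul_one, h, hQQ]
  have hinj : Function.Injective T := lin_injective (A := Q * g.transpose * Q)
    (by rw [mul_assoc, mul_assoc, ← mul_assoc g.transpose, h, hQQ])
  have hpos : ∀ i, 0 < ev i := fun i => by
    have h1 := (LinearMap.injective_iff_forall_lt_finrank_singularValues_pos T).mp hinj i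
      (by rw [hn]; exact i.2)
    rw [hev, ← T.sq_singularValues_fin hn i]
    positivity
  let b := hsym.eigenvectorBasis hn
  let N := Matrix.toEuclideanLin (Q * S * Q)
  have hNb : ∀ i, N (b i) = (ev i)⁻¹ • b i := by
    intro i
    have h1 : Matrix.toEuclideanLin S (b i) = ev i • b i := by
      rw [← hadj]; exact hsym.apply_eigenvectorBasis hn i
    have h2 : N (Matrix.toEuclideanLin S (b i)) = b i := by
      rw [← lin_mul, mul_eq_one_comm.mp hSinv, lin_one]
    rw [h1, map_smul] at h2
    rw [eq_inv_smul_iff₀ (hpos i).ne', h2]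
  have hNchar : N.charpoly = ∏ i, (X - C (ev i)⁻¹) := by
    rw [← N.charpoly_toMatrix b.toBasis]
    have : N.toMatrix b.toBasis b.toBasis = Matrix.diagonal fun i => (ev i)⁻¹ := by
      ext i j
      rw [LinearMap.toMatrix_apply, OrthonormalBasis.coe_toBasis, hNb, map_smul,
        ← OrthonormalBasis.coe_toBasis, Module.Basis.repr_self, Finsupp.smul_apply,
        Finsupp.single_apply, Matrix.diagonal_apply]
      by_cases hij : j = i
      · subst hij; simp
      · simp [hij, Ne.symm hij]
    rw [this, Matrix.charpoly_diagonal]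
  have hSchar : N.charpoly = ∏ i, (X - C (ev i)) := by
    have h1 : S.charpoly = ∏ i, (X - C (ev i)) := by
      rw [← charpoly_lin, ← hadj]
      exact hsym.charpoly_eq hn
    rw [charpoly_lin, Matrix.charpoly_mul_comm, ← mul_assoc, hQQ, one_mul, h1]
  have hroots : Multiset.map ev Finset.univ.val = Multiset.map (fun i => (ev i)⁻¹) Finset.univ.val := by
    have h1 := congrArg Polynomial.roots (hSchar.symm.trans hNchar)
    rw [Polynomial.roots_prod _ _ (by simp [Finset.prod_ne_zero_iff, Polynomial.X_sub_C_ne_zero]),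
      Polynomial.roots_prod _ _ (by simp [Finset.prod_ne_zero_iff, Polynomial.X_sub_C_ne_zero])] at h1
    simpa only [Polynomial.roots_X_sub_C, Multiset.bind_singleton] using h1
  have hanti : Antitone ev := hsym.eigenvalues_antitone hn
  -- Inversion reverses the order of positive numbers, hence the decreasing list of eigenvalues is
  -- the inverse of itself read backwards.
  have hrev : ev = fun i => (ev (Fin.rev i))⁻¹ := by
    refine eq_of_antitone_of_map_eq hanti (fun i j hij => ?_) ?_
    · exact inv_anti₀ (hpos _) (hanti (Fin.rev_le_rev.mpr hij))
    · rw [hroots]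
      have : (fun i => (ev (Fin.rev i))⁻¹) = (fun i => (ev i)⁻¹) ∘ Fin.revPerm := rfl
      rw [this, ← Multiset.map_map]
      congr 1
      have := congrArg Finset.val (Finset.map_univ_equiv (Fin.revPerm : Equiv.Perm (Fin d)))
      rw [Finset.map_val] at this
      exact this.symm
  have h1 : ev i * ev (Fin.rev i) = 1 := by
    have := congrFun hrev i
    rw [this]
    exact inv_mul_cancel₀ (hpos _).ne'
  rw [hev, ← T.sq_singularValues_fin hn, ← T.sq_singularValues_fin hn, ← mul_pow] at h1
  exact (pow_eq_one_iff_of_nonneg (mul_nonneg (T.singularValues_nonneg _)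
    (T.singularValues_nonneg _)) two_ne_zero).mp h1

/-- Since `σ_i σ_{d+1-i} = 1`, the gap at `d - j` is the gap at `j` read from the other end. -/
theorem sigma_div_symm {g Q : Matrix (Fin d) (Fin d) ℝ} (hQQ : Q * Q = 1)
    (h : g.transpose * Q * g = Q) {j : ℕ} (hj : 1 ≤ j) (hjd : j < d) :
    sigma g (d - j) / sigma g (d - j + 1) = sigma g j / sigma g (j + 1) := by
  have h1 := singularValues_mul_rev hQQ h ⟨j, hjd⟩
  have h2 := singularValues_mul_rev hQQ h ⟨j - 1, by omega⟩
  rw [Fin.val_rev] at h1 h2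
  simp only at h1 h2
  have e1 : d - (j - 1 + 1) = d - j := by omega
  have e2 : d - (j + 1) = d - j - 1 := by omega
  rw [e1] at h2
  rw [e2] at h1
  simp only [sigma, Nat.add_sub_cancel]
  have a1 := left_ne_zero_of_mul_eq_one h1
  have a2 := right_ne_zero_of_mul_eq_one h2
  rw [div_eq_div_iff a2 a1]
  linarith [mul_comm ((Matrix.toEuclideanLin g).singularValues j) ((Matrix.toEuclideanLin g).singularValues (d - j - 1))]

theorem isAnosov_symm {Γ : Type*} [Group Γ] {p q : ℕ} {S : Finset Γ} {ρ : Γ →* SO p q} {j : ℕ}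
    (hj : 1 ≤ j) (hjd : j < p + q) (h : IsAnosov S ((SO p q).subtype.comp ρ) j) :
    IsAnosov S ((SO p q).subtype.comp ρ) (p + q - j) := by
  obtain ⟨c, hc, μ, hμ, hγ⟩ := h
  refine ⟨c, hc, μ, hμ, fun γ => ?_⟩
  exact (hγ γ).trans (sigma_div_symm formQ_mul_self (ρ γ).2 hj hjd).ge

end SingularValues

/-! ### Domination between the entries of almost isometric block diagonal matrices -/

section Domination

variable {p q : ℕ}

/-- Two indices are in the same block of the Levi subgroup. -/
def SameBlock (i j : Fin (p + q)) : Prop :=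
  i = j ∨ (p ≤ (i : ℕ) + 1 ∧ (i : ℕ) ≤ q ∧ p ≤ (j : ℕ) + 1 ∧ (j : ℕ) ≤ q)

theorem midIdx_injective (hp : 1 ≤ p) : Function.Injective (midIdx (q := q) hp) := fun r s h => by
  simp only [midIdx, Fin.mk.injEq] at h
  exact Fin.ext (by omega)

theorem exists_midIdx_eq (hpq : p < q) (hp : 1 ≤ p) {l : Fin (p + q)} (h1 : p ≤ (l : ℕ) + 1)
    (h2 : (l : ℕ) ≤ q) : ∃ r, midIdx hp r = l :=
  ⟨⟨l - (p - 1), by omega⟩, Fin.ext (by simp only [midIdx]; omega)⟩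

theorem sum_eq_sum_midIdx (hpq : p < q) (hp : 1 ≤ p) {f : Fin (p + q) → ℝ}
    (hf : ∀ l : Fin (p + q), ¬ (p ≤ (l : ℕ) + 1 ∧ (l : ℕ) ≤ q) → f l = 0) :
    ∑ l, f l = ∑ s, f (midIdx hp s) := by
  rw [← Finset.sum_image (s := Finset.univ) (g := midIdx hp) (f := f)
    (fun r _ s _ h => midIdx_injective hp h)]
  refine (Finset.sum_subset (Finset.subset_univ _) fun l _ hl => hf l fun h => hl ?_).symm
  obtain ⟨r, rfl⟩ := exists_midIdx_eq hpq hp h.1 h.2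
  exact Finset.mem_image_of_mem _ (Finset.mem_univ r)

theorem midIdx_bounds (hp : 1 ≤ p) (s : Fin (q + 2 - p)) :
    p ≤ (midIdx hp s : ℕ) + 1 ∧ (midIdx hp s : ℕ) ≤ q := by
  have := s.2
  simp only [midIdx]; omega

/-- The rows of `D` in the middle block are supported there, so all the sums restrict to that block.
-/
theorem sandwich_mid (hpq : p < q) (hp : 1 ≤ p) {D A : Matrix (Fin (p + q)) (Fin (p + q)) ℝ}
    (hD : ∀ r s, ¬ SameBlock r s → D r s = 0) (s t : Fin (q + 2 - p)) :
    (D * A * D.transpose) (midIdx hp s) (midIdx hp t) =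
      (D.submatrix (midIdx hp) (midIdx hp) * A.submatrix (midIdx hp) (midIdx hp) *
        (D.submatrix (midIdx hp) (midIdx hp)).transpose) s t := by
  have hb := midIdx_bounds (q := q) hp
  have hz : ∀ (s : Fin (q + 2 - p)) (l : Fin (p + q)), ¬ (p ≤ (l : ℕ) + 1 ∧ (l : ℕ) ≤ q) →
      D (midIdx hp s) l = 0 := by
    intro s l hl
    refine hD _ _ fun h => ?_
    rcases h with h | h
    · rw [← h] at hl; exact hl (hb s)
    · exact hl ⟨h.2.2.1, h.2.2.2⟩
  rw [Matrix.mul_apply, sum_eq_sum_midIdx hpq hp, Matrix.mul_apply]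
  · refine Finset.sum_congr rfl fun b _ => ?_
    congr 1
    rw [Matrix.mul_apply, sum_eq_sum_midIdx hpq hp, Matrix.mul_apply]
    · rfl
    · intro l hl; rw [hz s l hl, zero_mul]
  · intro l hl; rw [Matrix.transpose_apply, hz t l hl, mul_zero]

theorem sameBlock_comm {i j : Fin (p + q)} : SameBlock i j ↔ SameBlock j i := by
  simp only [SameBlock, eq_comm]
  constructor <;> rintro (h | h)
  exacts [Or.inl h, Or.inr ⟨h.2.2.1, h.2.2.2, h.1, h.2.1⟩, Or.inl h,
    Or.inr ⟨h.2.2.1, h.2.2.2, h.1, h.2.1⟩]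

theorem formQ_rev (i : Fin (p + q)) (hi : (i : ℕ) < p ∨ q ≤ (i : ℕ)) :
    formQ p q i (Fin.rev i) = (-1) ^ (min (i : ℕ) (Fin.rev i)) := by
  rw [formQ_apply_of_ne i _ hi, if_pos]
  rw [Fin.val_rev]; omega

theorem eq_rev_of_formQ_ne_zero {b s : Fin (p + q)} (h : formQ p q b s ≠ 0) :
    b = Fin.rev s ∨ (b = s ∧ p ≤ (s : ℕ) ∧ (s : ℕ) < q) := by
  by_cases hb : p ≤ (b : ℕ) ∧ (b : ℕ) < q
  · rw [formQ_apply_of_mem b s hb.1 hb.2] at h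
    have hbs : b = s := by by_contra h'; exact h (if_neg h')
    exact Or.inr ⟨hbs, hbs ▸ hb⟩
  · rw [formQ_apply_of_ne b s (by omega)] at h
    left
    by_contra h'
    refine h (if_neg fun h'' => h' (Fin.ext ?_))
    rw [Fin.val_rev]; omega

variable {D Q' R : ℕ → Matrix (Fin (p + q)) (Fin (p + q)) ℝ}

/-- Outside the middle block a column of `D` has only its diagonal entry, so `Q' i (rev i)` reduces
to `D i i * Q i (rev i) * D (rev i) (rev i)`, and `Q' → Q`. Opposite diagonal entries are thus
asymptotically inverse. -/
theorem tendsto_diag_mul_rev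
    (hD : ∀ n r s, ¬ SameBlock r s → D n r s = 0)
    (hQ' : ∀ n, (D n).transpose * formQ p q * D n = Q' n)
    (hQlim : ∀ i j, Tendsto (fun n => Q' n i j) atTop (𝓝 (formQ p q i j))) {i : Fin (p + q)}
    (hi : (i : ℕ) + 1 < p ∨ q + 1 ≤ (i : ℕ)) :
    Tendsto (fun n => D n i i * D n (Fin.rev i) (Fin.rev i)) atTop (𝓝 1) := by
  have hi2 := i.2
  have hrev : ((Fin.rev i : Fin (p + q)) : ℕ) = p + q - (i + 1) := Fin.val_rev i
  have hz : ∀ n (j : Fin (p + q)), ((j : ℕ) + 1 < p ∨ q + 1 ≤ (j : ℕ)) → ∀ a, a ≠ j →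
      D n a j = 0 := fun n j hj a ha => hD n a j (by
    rintro (h | h)
    · exact ha h
    · omega)
  have hval : ∀ n, Q' n i (Fin.rev i) =
      D n i i * formQ p q i (Fin.rev i) * D n (Fin.rev i) (Fin.rev i) := by
    intro n
    rw [← hQ' n, Matrix.mul_apply, Finset.sum_eq_single (Fin.rev i), Matrix.mul_apply,
      Finset.sum_eq_single i]
    · rfl
    · intro a _ ha
      rw [Matrix.transpose_apply, hz n i hi a ha, zero_mul]
    · simp
    · intro b _ hb
      rw [hz n (Fin.rev i) (by omega) b hb, mul_zero]
    · simp
  have h1 := (hQlim i (Fin.rev i)).mul_const (formQ p q i (Fin.rev i))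
  have hsq : formQ p q i (Fin.rev i) * formQ p q i (Fin.rev i) = 1 := by
    rw [formQ_rev i (by omega), neg_one_pow_mul_self]
  rw [hsq] at h1
  refine h1.congr fun n => ?_
  rw [hval]
  calc _ = D n i i * D n (Fin.rev i) (Fin.rev i) *
        (formQ p q i (Fin.rev i) * formQ p q i (Fin.rev i)) := by ring
    _ = _ := by rw [hsq, mul_one]

theorem tendsto_div_of_ratio {a b m e : ℕ → ℝ} {b₀ : ℝ} (hb : Tendsto b atTop (𝓝 b₀))
    (hb₀ : b₀ ≠ 0) (he : Tendsto e atTop (𝓝 1))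
    (h : Tendsto (fun n => a n * b n / (m n * e n)) atTop (𝓝 0)) :
    Tendsto (fun n => a n / m n) atTop (𝓝 0) := by
  have h1 := (h.mul he).mul (hb.inv₀ hb₀)
  rw [zero_mul, zero_mul] at h1
  refine h1.congr' ?_
  filter_upwards [hb.eventually_ne hb₀, he.eventually_ne one_ne_zero] with n h2 h3
  by_cases hm : m n = 0
  · simp [hm]
  · field_simp

/-- The diagonal entries in the lower block dominate all the entries before them. -/
theorem tendsto_div_diag (hpq : p < q) (hp : 2 ≤ p)
    (hD : ∀ n r s, ¬ SameBlock r s → D n r s = 0)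
    (hQ' : ∀ n, (D n).transpose * formQ p q * D n = Q' n)
    (hQlim : ∀ i j, Tendsto (fun n => Q' n i j) atTop (𝓝 (formQ p q i j)))
    (hR : ∀ᶠ n in atTop, D n * R n * (D n).transpose = formQ p q)
    (hRlim : ∀ i j, Tendsto (fun n => R n i j) atTop (𝓝 (formQ p q i j)))
    {P : Matrix (Fin (p + q)) (Fin (p + q)) ℝ} (hP : IsPosFrom (q + 1) P)
    {u : Fin (q + 2 - p) → ℝ} (hPu : HasMidVector hp P u) (hu : InCone u)
    {c : Fin (p + q) → ℕ → E (p + q)}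
    (hc : ∀ x : Fin (p + q), q + 1 ≤ (x : ℕ) → ∀ i, Tendsto (fun n => c x n i) atTop (𝓝 (P i x)))
    (hdom : ∀ x : Fin (p + q), q + 1 ≤ (x : ℕ) → ∀ i, i ≠ x →
      Tendsto (fun n => Matrix.toEuclideanLin (D n) (c x n) i /
        Matrix.toEuclideanLin (D n) (c x n) x) atTop (𝓝 0))
    (x : Fin (p + q)) (hx : q + 1 ≤ (x : ℕ)) (r s : Fin (p + q)) (hs : s < x) :
    Tendsto (fun n => D n r s / D n x x) atTop (𝓝 0) := by
  have hp1 : 1 ≤ p := by omega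
  have hz : ∀ n (j : Fin (p + q)), ((j : ℕ) + 1 < p ∨ q + 1 ≤ (j : ℕ)) → ∀ a, a ≠ j →
      D n a j = 0 ∧ D n j a = 0 := fun n j hj a ha => by
    have : ¬ SameBlock a j := by
      rintro (h | h)
      · exact ha h
      · omega
    exact ⟨hD n a j this, hD n j a fun h => this (sameBlock_comm.mp h)⟩
  have hDc : ∀ n (j : Fin (p + q)), ((j : ℕ) + 1 < p ∨ q + 1 ≤ (j : ℕ)) → ∀ v : E (p + q),
      Matrix.toEuclideanLin (D n) v j = D n j j * v j := by
    intro n j hj v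
    rw [lin_apply, Finset.sum_eq_single j]
    · intro a _ ha; rw [(hz n j hj a ha).2, zero_mul]
    · simp
  have hdiag : ∀ x : Fin (p + q), q + 1 ≤ (x : ℕ) → Tendsto (fun n => c x n x) atTop (𝓝 1) := by
    intro x hx
    simpa [hP.1.1.2] using hc x hx x
  -- The image of column `y` of `P` is attracted to the axis `y`, while its coordinate `x` is about
  -- `P x y * D x x`. Positivity of `P x y` allows division by it.
  have hstep : ∀ x y : Fin (p + q), q + 1 ≤ (x : ℕ) → (y : ℕ) = x + 1 →
      Tendsto (fun n => D n x x / D n y y) atTop (𝓝 0) := by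
    intro x y hx hxy
    have hne : x ≠ y := by intro h; rw [h] at hxy; omega
    have h1 := hdom y (by omega) x hne
    simp only [hDc _ x (Or.inr hx), hDc _ y (Or.inr (by omega))] at h1
    exact tendsto_div_of_ratio (hc y (by omega) x) (hP.2.1 x y hx hxy).ne' (hdiag y (by omega)) h1
  set x₀ : Fin (p + q) := nextIdx hp with hx₀
  have hx₀v : (x₀ : ℕ) = q + 1 := rfl
  -- The same contraction for column `q + 1`, whose middle part is a positive vector of `J`,
  -- controls the whole middle block.
  have hmid : Tendsto (fun n => (D n x₀ x₀)⁻¹) atTop (𝓝 0) ∧ ∀ s t : Fin (q + 2 - p),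
      Tendsto (fun n => D n (midIdx hp1 s) (midIdx hp1 t) / D n x₀ x₀) atTop (𝓝 0) := by
    refine tendsto_lorentz_div hpq (M := fun n => (D n).submatrix (midIdx hp1) (midIdx hp1))
      (K := fun n => (R n).submatrix (midIdx hp1) (midIdx hp1))
      (L := fun n => (Q' n).submatrix (midIdx hp1) (midIdx hp1))
      (w := fun n s => c x₀ n (midIdx hp1 s)) ?_ ?_ ?_ ?_ (fun s => hc x₀ hx₀v.ge _) ?_ ?_
    · intro s t
      rw [← formQ_mid hpq hp1]
      exact hRlim _ _
    · intro s t
      rw [← formQ_mid hpq hp1]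
      exact hQlim _ _
    · filter_upwards [hR] with n hn
      ext s t
      rw [← sandwich_mid hpq hp1 (hD n), hn, formQ_mid hpq hp1]
    · intro n
      ext s t
      have h1 := sandwich_mid hpq hp1 (D := (D n).transpose) (A := formQ p q)
        (fun r s h => hD n s r fun h' => h (sameBlock_comm.mp h')) s t
      rw [Matrix.transpose_transpose, hQ' n] at h1
      have h2 : (formQ p q).submatrix (midIdx hp1) (midIdx hp1) = formJ p q := by
        ext s t; exact formQ_mid hpq hp1 s t
      rw [h2] at h1
      exact h1.symm
    · have h1 := lor_midVector_pos hpq hu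
      simp only [← hPu.2.2] at h1
      exact h1
    · intro s
      have hb := midIdx_bounds (q := q) hp1 s
      have hne : midIdx hp1 s ≠ x₀ := by
        intro h; rw [h] at hb; omega
      have h1 := hdom x₀ hx₀v.ge (midIdx hp1 s) hne
      simp only [hDc _ x₀ (Or.inr hx₀v.ge)] at h1
      have h2 : ∀ n, Matrix.toEuclideanLin (D n) (c x₀ n) (midIdx hp1 s) =
          ((D n).submatrix (midIdx hp1) (midIdx hp1)).mulVec (fun s => c x₀ n (midIdx hp1 s)) s := by
        intro n
        rw [lin_apply, sum_eq_sum_midIdx hpq hp1]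
        · rfl
        · intro l hl
          rw [hD n _ _, zero_mul]
          rintro (h | h)
          · rw [← h] at hl; exact hl hb
          · exact hl ⟨h.2.2.1, h.2.2.2⟩
      simp only [h2] at h1
      refine tendsto_div_of_ratio (b := fun _ => 1) tendsto_const_nhds one_ne_zero
        (hdiag x₀ hx₀v.ge) ?_
      simpa using h1
  -- Starting from `D x₀ x₀`, the ratios in `hstep` telescope and all lower diagonal entries tend to
  -- infinity in absolute value.
  have hinv : ∀ n : ℕ, ∀ y : Fin (p + q), (y : ℕ) = q + 1 + n →
      Tendsto (fun n => (D n y y)⁻¹) atTop (𝓝 0) := by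
    intro n
    induction n with
    | zero =>
      intro y hy
      rw [show y = x₀ from Fin.ext (by omega)]
      exact hmid.1
    | succ n ih =>
      intro y hy
      have hy2 := y.2
      let x : Fin (p + q) := ⟨q + 1 + n, by omega⟩
      have h1 := (ih x rfl).mul (hstep x y (by simp only [x]; omega) (by simp only [x]; omega))
      rw [zero_mul] at h1
      have h2 := tendsto_diag_mul_rev hD hQ' hQlim (i := x) (Or.inr (by simp only [x]; omega))
      refine h1.congr' ?_
      filter_upwards [h2.eventually_ne one_ne_zero] with n hn
      have := left_ne_zero_of_mul hn
      field_simp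
  -- At `y = x₀` the middle columns are handled by `hmid`; an upper diagonal entry is asymptotically
  -- inverse to a lower one, hence tends to `0`. Lower rows follow by inserting the ratio `D x x / D
  -- y y`.
  have key : ∀ n : ℕ, ∀ y : Fin (p + q), (y : ℕ) = q + 1 + n → ∀ r s, s < y →
      Tendsto (fun n => D n r s / D n y y) atTop (𝓝 0) := by
    intro n
    induction n with
    | zero =>
      intro y hy r s hs
      rw [show y = x₀ from Fin.ext (by omega)] at hs ⊢
      have hs' : (s : ℕ) < q + 1 := hs
      by_cases hsb : SameBlock r s
      · by_cases hsm : p ≤ (s : ℕ) + 1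
        · have hrm : p ≤ (r : ℕ) + 1 ∧ (r : ℕ) ≤ q := by
            rcases hsb with rfl | h
            · exact ⟨hsm, by omega⟩
            · exact ⟨h.1, h.2.1⟩
          obtain ⟨s', rfl⟩ := exists_midIdx_eq hpq hp1 hsm (by omega)
          obtain ⟨r', rfl⟩ := exists_midIdx_eq hpq hp1 hrm.1 hrm.2
          exact hmid.2 r' s'
        · have hrs : r = s := by
            rcases hsb with rfl | h
            · rfl
            · omega
          subst hrs
          have hrev : ((Fin.rev r : Fin (p + q)) : ℕ) = p + q - (r + 1) := Fin.val_rev r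
          have h1 := tendsto_diag_mul_rev hD hQ' hQlim (i := r) (Or.inl (by omega))
          have h2 := hinv (p + q - (r + 1) - (q + 1)) (Fin.rev r) (by omega)
          have h3 := (h1.mul h2).mul hmid.1
          simp only [mul_zero] at h3
          refine h3.congr' ?_
          filter_upwards [h1.eventually_ne one_ne_zero] with n hn
          have := right_ne_zero_of_mul hn
          rw [mul_assoc (D n r r), mul_inv_cancel₀ this, mul_one, div_eq_mul_inv]
      · simp [hD _ r s hsb]
    | succ n ih =>
      intro y hy r s hs
      have hy2 := y.2
      have hs' : (s : ℕ) < y := hs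
      let x : Fin (p + q) := ⟨q + 1 + n, by omega⟩
      have hxv : (x : ℕ) = q + 1 + n := rfl
      have h0 := hstep x y (by omega) (by omega)
      by_cases hsx : s < x
      · have h1 := (ih x rfl r s hsx).mul h0
        rw [zero_mul] at h1
        have h2 := tendsto_diag_mul_rev hD hQ' hQlim (i := x) (Or.inr (by omega))
        refine h1.congr' ?_
        filter_upwards [h2.eventually_ne one_ne_zero] with n hn
        have := left_ne_zero_of_mul hn
        field_simp
      · have hsx' : s = x := by
          rw [Fin.lt_def] at hsx
          exact Fin.ext (by omega)
        by_cases hr : r = s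
        · rw [hr, hsx']; exact h0
        · simp [(hz _ s (Or.inr (by rw [hsx']; omega)) r hr).1]
  exact key (x - (q + 1)) x (by omega) r s hs

/-- Domination across the cuts of the partial flags. -/
theorem tendsto_mul_inv_entry
    (hD : ∀ n r s, ¬ SameBlock r s → D n r s = 0)
    (hQ' : ∀ n, (D n).transpose * formQ p q * D n = Q' n)
    (hQlim : ∀ i j, Tendsto (fun n => Q' n i j) atTop (𝓝 (formQ p q i j)))
    (hRlim : ∀ i j, Tendsto (fun n => R n i j) atTop (𝓝 (formQ p q i j)))
    (hdiv : ∀ x : Fin (p + q), q + 1 ≤ (x : ℕ) → ∀ r s : Fin (p + q), s < x →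
      Tendsto (fun n => D n r s / D n x x) atTop (𝓝 0))
    {s s' : Fin (p + q)} (hss : s < s') (hcut : (s : ℕ) + 1 < p ∨ q + 1 ≤ (s' : ℕ))
    (r r' : Fin (p + q)) :
    Tendsto (fun n => D n r s * (R n * (D n).transpose * formQ p q) r' s') atTop (𝓝 0) := by
  have hss' : (s : ℕ) < s' := hss
  have hs2 := s'.2
  -- In the application `R Dᵀ Q` is the inverse of `D`. Each term is a product of two entries of `D`
  -- with a convergent factor, and few `b` have `Q b s' ≠ 0`.
  have hexp : ∀ n, D n r s * (R n * (D n).transpose * formQ p q) r' s' =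
      ∑ b, ∑ a, D n r s * D n b a * (R n r' a * formQ p q b s') := by
    intro n
    simp only [Matrix.mul_apply, Matrix.transpose_apply, Finset.sum_mul, Finset.mul_sum]
    exact Finset.sum_congr rfl fun b _ => Finset.sum_congr rfl fun a _ => by ring
  simp only [hexp]
  rw [show (0 : ℝ) = ∑ b : Fin (p + q), ∑ a : Fin (p + q), 0 by simp]
  refine tendsto_finsetSum _ fun b _ => tendsto_finsetSum _ fun a _ => ?_
  by_cases hQ : formQ p q b s' = 0
  · simp [hQ]
  by_cases hba : SameBlock b a
  swap
  · simp [hD _ b a hba]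
  have hb := eq_rev_of_formQ_ne_zero hQ
  have hrev : ((Fin.rev s' : Fin (p + q)) : ℕ) = p + q - (s' + 1) := Fin.val_rev s'
  have hrevs : ((Fin.rev s : Fin (p + q)) : ℕ) = p + q - (s + 1) := Fin.val_rev s
  have hmain : ∀ x : Fin (p + q), q + 1 ≤ (x : ℕ) → ∀ f g : ℕ → ℝ,
      Tendsto (fun n => f n / D n x x) atTop (𝓝 0) →
      (∀ n, g n = D n (Fin.rev x) (Fin.rev x)) →
      Tendsto (fun n => f n * g n * (R n r' a * formQ p q b s')) atTop (𝓝 0) := by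
    intro x hx f g hf hg
    have h1 := tendsto_diag_mul_rev hD hQ' hQlim (i := x) (Or.inr hx)
    have h2 := (hf.mul h1).mul ((hRlim r' a).mul_const (formQ p q b s'))
    rw [zero_mul, zero_mul] at h2
    refine h2.congr' ?_
    filter_upwards [h1.eventually_ne one_ne_zero] with n hn
    have := left_ne_zero_of_mul hn
    rw [hg]
    field_simp
  -- If `s'` is in the lower block, `D b a` is the diagonal entry opposite to `D s' s'`, and so
  -- asymptotic to its inverse. Otherwise `s` is in the upper block and the roles are exchanged: `D
  -- s s` is asymptotically inverse to the entry at `rev s`, which dominates `D b a`.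
  by_cases hs' : q + 1 ≤ (s' : ℕ)
  · have hbr : b = Fin.rev s' := by
      rcases hb with h | h
      · exact h
      · omega
    have hab : a = b := by
      rcases hba with h | h
      · exact h.symm
      · have := congrArg Fin.val hbr; omega
    subst hab
    exact hmain s' hs' (fun n => D n r s) (fun n => D n a a) (hdiv s' hs' r s hss)
      (fun n => by rw [hbr])
  · have hs : (s : ℕ) + 1 < p := hcut.resolve_right hs'
    by_cases hrs : r = s
    · subst hrs
      have hb' : (b : ℕ) < Fin.rev r := by
        rcases hb with h | h
        · rw [h]; omega
        · rw [h.1]; omega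
      have ha : a < Fin.rev r := by
        rw [Fin.lt_def]
        rcases hba with h | h
        · rw [← h]; exact hb'
        · omega
      have h1 := hmain (Fin.rev r) (by omega) (fun n => D n b a) (fun n => D n r r)
        (hdiv (Fin.rev r) (by omega) b a ha) (fun n => by rw [Fin.rev_rev])
      exact h1.congr fun n => by ring
    · have : ∀ n, D n r s = 0 := fun n => hD n r s (by
        rintro (h | h)
        · exact hrs h
        · omega)
      simp [this]

end Domination

/-! ### Norm bounds and limits of matrices -/

section MatrixBounds

variable {d : ℕ}

theorem abs_lin_apply_le (A : Matrix (Fin d) (Fin d) ℝ) (T : Finset (Fin d)) {v : E d}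
    (hv : ∀ i, i ∉ T → v i = 0) :
    ‖Matrix.toEuclideanLin A v‖ ≤ (∑ r, ∑ s ∈ T, |A r s|) * ‖v‖ := by
  refine (norm_le_sum_abs _).trans ?_
  rw [Finset.sum_mul]
  refine Finset.sum_le_sum fun r _ => ?_
  rw [lin_apply, ← Finset.sum_subset (Finset.subset_univ T) fun s _ hs => by rw [hv s hs, mul_zero],
    Finset.sum_mul]
  refine (Finset.abs_sum_le_sum_abs _ _).trans (Finset.sum_le_sum fun s _ => ?_)
  rw [abs_mul]
  exact mul_le_mul_of_nonneg_left (abs_apply_le_norm v s) (abs_nonneg _)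

theorem finrank_lastSpan {l : ℕ} (hl : l ≤ d) : Module.finrank ℝ (lastSpan d l) = l := by
  let e : Fin l → Fin d := fun i => ⟨d - l + i, by omega⟩
  have he : Function.Injective e := fun i j h => by
    have := congrArg Fin.val h
    simp only [e] at this
    exact Fin.ext (by omega)
  have h : lastSpan d l = Submodule.span ℝ (Set.range fun i : Fin l =>
      (EuclideanSpace.single (e i) (1 : ℝ) : E d)) := by
    rw [lastSpan]
    congr 1
    ext v
    constructor
    · rintro ⟨i, hi, rfl⟩
      have h : e ⟨i - (d - l), by omega⟩ = i := Fin.ext (by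
        change d - l + (i - (d - l)) = (i : ℕ)
        omega)
      exact ⟨⟨i - (d - l), by omega⟩, by simp only [h]⟩
    · rintro ⟨i, rfl⟩
      exact ⟨e i, by change d ≤ d - l + i + l; omega, rfl⟩
  rw [h, finrank_span_eq_card, Fintype.card_fin]
  have := (EuclideanSpace.basisFun (Fin d) ℝ).orthonormal.linearIndependent
  simpa [Function.comp_def] using this.comp e he

theorem exists_eventually_norm_lin_le {A : ℕ → Matrix (Fin d) (Fin d) ℝ}
    {A₀ : Matrix (Fin d) (Fin d) ℝ} (hA : Tendsto A atTop (𝓝 A₀)) :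
    ∃ C > 0, ∀ᶠ n in atTop, ∀ v : E d, ‖Matrix.toEuclideanLin (A n) v‖ ≤ C * ‖v‖ := by
  have h1 : Tendsto (fun n => ∑ r, ∑ s, |A n r s|) atTop (𝓝 (∑ r, ∑ s, |A₀ r s|)) :=
    tendsto_finsetSum _ fun r _ => tendsto_finsetSum _ fun s _ =>
      (tendsto_pi_nhds.mp (tendsto_pi_nhds.mp hA r) s).abs
  refine ⟨∑ r, ∑ s, |A₀ r s| + 1, by positivity, ?_⟩
  filter_upwards [h1.eventually_lt_const (lt_add_one _)] with n hn v
  exact (abs_lin_apply_le (A n) Finset.univ (by simp)).trans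
    (mul_le_mul_of_nonneg_right hn.le (norm_nonneg _))

theorem tendsto_matrix_inv {A : ℕ → Matrix (Fin d) (Fin d) ℝ}
    (hA : Tendsto A atTop (𝓝 1)) : Tendsto (fun n => (A n)⁻¹) atTop (𝓝 1) := by
  have h1 : Tendsto (fun n => (A n).det) atTop (𝓝 1) := by
    simpa [Function.comp_def] using ((continuous_id.matrix_det).tendsto
      (1 : Matrix (Fin d) (Fin d) ℝ)).comp hA
  have h2 : Tendsto (fun n => (A n).adjugate) atTop (𝓝 1) := by
    simpa [Function.comp_def] using ((continuous_id.matrix_adjugate).tendsto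
      (1 : Matrix (Fin d) (Fin d) ℝ)).comp hA
  simp only [Matrix.inv_def, Ring.inverse_eq_inv']
  simpa using (h1.inv₀ one_ne_zero).smul h2

theorem eventually_isUnit_det {A : ℕ → Matrix (Fin d) (Fin d) ℝ}
    (hA : Tendsto A atTop (𝓝 1)) : ∀ᶠ n in atTop, IsUnit (A n).det := by
  have h1 : Tendsto (fun n => (A n).det) atTop (𝓝 1) := by
    simpa [Function.comp_def] using ((continuous_id.matrix_det).tendsto
      (1 : Matrix (Fin d) (Fin d) ℝ)).comp hA
  filter_upwards [h1.eventually_ne one_ne_zero] with n hn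
  exact hn.isUnit

theorem tendsto_matrix_transpose {A : ℕ → Matrix (Fin d) (Fin d) ℝ}
    {A₀ : Matrix (Fin d) (Fin d) ℝ} (hA : Tendsto A atTop (𝓝 A₀)) :
    Tendsto (fun n => (A n).transpose) atTop (𝓝 A₀.transpose) :=
  ((continuous_id.matrix_transpose).tendsto A₀).comp hA

/-- Vectors that become nearly parallel to a basis vector. -/
theorem tendsto_coord_div {y : ℕ → E d} {δ : ℕ → ℝ} (hδ : Tendsto δ atTop (𝓝 0)) {x : Fin d}
    (h : ∀ n i, i ≠ x → |y n i| ≤ δ n * ‖y n‖) (i : Fin d) (hi : i ≠ x) :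
    Tendsto (fun n => y n i / y n x) atTop (𝓝 0) := by
  have h1 : Tendsto (fun n => d * |δ n|) atTop (𝓝 0) := by simpa using (hδ.abs).const_mul (d : ℝ)
  refine squeeze_zero_norm' (a := fun n => 2 * |δ n|) ?_ (by simpa using hδ.abs.const_mul 2)
  filter_upwards [h1.eventually_lt_const (show (0 : ℝ) < 1 / 2 by norm_num)] with n hn
  have h2 : ∀ j, j ≠ x → |y n j| ≤ |δ n| * ‖y n‖ := fun j hj =>
    (h n j hj).trans (mul_le_mul_of_nonneg_right (le_abs_self _) (norm_nonneg _))
  have h3 : ‖y n‖ ≤ |y n x| + d * |δ n| * ‖y n‖ := by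
    refine (norm_le_sum_abs _).trans ?_
    rw [← Finset.add_sum_erase _ _ (Finset.mem_univ x)]
    refine add_le_add le_rfl ?_
    calc ∑ j ∈ Finset.univ.erase x, |y n j| ≤ ∑ j ∈ Finset.univ.erase x, |δ n| * ‖y n‖ :=
          Finset.sum_le_sum fun j hj => h2 j (Finset.ne_of_mem_erase hj)
      _ ≤ ∑ _j : Fin d, |δ n| * ‖y n‖ :=
          Finset.sum_le_sum_of_subset_of_nonneg (Finset.erase_subset _ _)
            fun _ _ _ => by positivity
      _ = d * |δ n| * ‖y n‖ := by simp [mul_assoc]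
  have h4 : ‖y n‖ ≤ 2 * |y n x| := by nlinarith [norm_nonneg (y n)]
  rw [Real.norm_eq_abs, abs_div]
  refine div_le_of_le_mul₀ (abs_nonneg _) (by positivity) ?_
  calc _ ≤ |δ n| * ‖y n‖ := h2 i hi
    _ ≤ |δ n| * (2 * |y n x|) := mul_le_mul_of_nonneg_left h4 (abs_nonneg _)
    _ = _ := by ring

end MatrixBounds

/-! ### From block domination to Cartan attractors -/

section Dynamics

variable {p q : ℕ}

theorem mul_formQ_transpose {M : Matrix (Fin (p + q)) (Fin (p + q)) ℝ}
    (hM : M.transpose * formQ p q * M = formQ p q) :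
    M * formQ p q * M.transpose = formQ p q := by
  have h1 : (formQ p q * M.transpose * formQ p q) * M = 1 := by
    rw [mul_assoc, mul_assoc, ← mul_assoc M.transpose, hM, formQ_mul_self]
  have h2 := mul_eq_one_comm.mp h1
  calc M * formQ p q * M.transpose
      = M * (formQ p q * M.transpose * formQ p q) * formQ p q := by
        simp only [mul_assoc, formQ_mul_self, mul_one]
    _ = formQ p q := by rw [h2, one_mul]

/-- A sequence in `SO(p,q)` which is almost block diagonal and contracts towards the standard flag
has the standard flag as limit of its Cartan attractors. -/
theorem tendsto_attractor_of_blocks (hpq : p < q) (hp : 2 ≤ p)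
    {g M F : ℕ → Matrix (Fin (p + q)) (Fin (p + q)) ℝ}
    {H H' G G' : Matrix (Fin (p + q)) (Fin (p + q)) ℝ}
    (hH : H * H' = 1) (hG : G * G' = 1) (hg : ∀ n, g n = H' * M n * G)
    (hM : ∀ n, (M n).transpose * formQ p q * M n = formQ p q)
    (hF : Tendsto F atTop (𝓝 1))
    (hD : ∀ n r s, ¬ SameBlock r s → (M n * F n) r s = 0)
    {P : Matrix (Fin (p + q)) (Fin (p + q)) ℝ} (hP : IsPosFrom (q + 1) P)
    {u : Fin (q + 2 - p) → ℝ} (hPu : HasMidVector hp P u) (hu : InCone u)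
    {y : Fin (p + q) → ℕ → E (p + q)}
    (hy : ∀ x : Fin (p + q), q + 1 ≤ (x : ℕ) →
      Tendsto (y x) atTop (𝓝 (Matrix.toEuclideanLin P (EuclideanSpace.single x 1))))
    (hdom : ∀ x : Fin (p + q), q + 1 ≤ (x : ℕ) → ∀ i, i ≠ x →
      Tendsto (fun n => Matrix.toEuclideanLin (M n) (y x n) i /
        Matrix.toEuclideanLin (M n) (y x n) x) atTop (𝓝 0))
    {j : ℕ} (hj : (1 ≤ j ∧ j ≤ p - 1) ∨ (q + 1 ≤ j ∧ j ≤ q + p - 1))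
    {U : ℕ → Submodule ℝ (E (p + q))} (hU : ∀ n, IsCartanAttractor j (g n) (U n)) :
    Tendsto (fun n => (U n).starProjection) atTop
      (𝓝 (mapSub H' (lastSpan (p + q) j)).starProjection) := by
  have hH' := mul_eq_one_comm.mp hH
  have hG' := mul_eq_one_comm.mp hG
  have hentry : ∀ {A : ℕ → Matrix (Fin (p + q)) (Fin (p + q)) ℝ}
      {A₀ : Matrix (Fin (p + q)) (Fin (p + q)) ℝ}, Tendsto A atTop (𝓝 A₀) →
      ∀ i j, Tendsto (fun n => A n i j) atTop (𝓝 (A₀ i j)) := fun h i j =>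
    tendsto_pi_nhds.mp (tendsto_pi_nhds.mp h i) j
  have hFi := tendsto_matrix_inv hF
  have hFu := eventually_isUnit_det hF
  set Q := formQ p q with hQ
  -- The correction `F n → 1` makes `D` exactly block diagonal, at the price of preserving `Q` only
  -- asymptotically: `Dᵀ Q D = Q'` and, eventually, `D R Dᵀ = Q`, with `Q'` and `R` tending to `Q`.
  let D := fun n => M n * F n
  let Q' := fun n => (F n).transpose * Q * F n
  let R := fun n => (F n)⁻¹ * Q * ((F n)⁻¹).transpose
  have hQ' : ∀ n, (D n).transpose * Q * D n = Q' n := fun n => by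
    simp only [D, Q', Matrix.transpose_mul]
    calc _ = (F n).transpose * ((M n).transpose * Q * M n) * F n := by simp only [mul_assoc]
      _ = _ := by rw [hM]
  have hQlim : ∀ i j, Tendsto (fun n => Q' n i j) atTop (𝓝 (Q i j)) := by
    refine hentry ?_
    simpa using ((tendsto_matrix_transpose hF).mul (tendsto_const_nhds (x := Q))).mul hF
  have hRlim : ∀ i j, Tendsto (fun n => R n i j) atTop (𝓝 (Q i j)) := by
    refine hentry ?_
    simpa using (hFi.mul (tendsto_const_nhds (x := Q))).mul (tendsto_matrix_transpose hFi)
  have hR : ∀ᶠ n in atTop, D n * R n * (D n).transpose = Q := by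
    filter_upwards [hFu] with n hn
    have h1 : F n * (F n)⁻¹ = 1 := Matrix.mul_nonsing_inv _ hn
    have h2 : ((F n)⁻¹).transpose * (F n).transpose = 1 := by
      rw [← Matrix.transpose_mul, h1, Matrix.transpose_one]
    simp only [D, R, Matrix.transpose_mul]
    calc _ = M n * (F n * (F n)⁻¹) * Q * (((F n)⁻¹).transpose * (F n).transpose) *
          (M n).transpose := by simp only [mul_assoc]
      _ = _ := by rw [h1, h2, mul_one, mul_one, mul_formQ_transpose (hM n)]
  have hdiv := tendsto_div_diag hpq hp hD hQ' hQlim hR hRlim hP hPu hu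
    (c := fun x n => Matrix.toEuclideanLin (F n)⁻¹ (y x n))
    (fun x hx i => by
      have := Tendsto.euclidean_apply (tendsto_lin (hentry hFi) (hy x hx)) i
      rwa [lin_one, lin_single] at this)
    (fun x hx i hi => by
      refine (hdom x hx i hi).congr' ?_
      filter_upwards [hFu] with n hn
      rw [← lin_mul, mul_assoc, Matrix.mul_nonsing_inv _ hn, mul_one])
  let N := fun n => R n * (D n).transpose * Q
  have hDN : ∀ᶠ n in atTop, D n * N n = 1 := by
    filter_upwards [hR] with n hn
    simp only [N]
    rw [← mul_assoc, ← mul_assoc, hn, hQ, formQ_mul_self]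
  let lo : Finset (Fin (p + q)) := Finset.univ.filter fun s => (s : ℕ) < p + q - j
  let hi : Finset (Fin (p + q)) := Finset.univ.filter fun s => p + q - j ≤ (s : ℕ)
  -- `α` bounds `D` on the first `d - j` coordinates and `β` bounds the inverse `N` on the last `j`.
  -- The condition on `j` says that the cut at `d - j` does not split the middle block.
  let α := fun n => ∑ r, ∑ s ∈ lo, |D n r s|
  let β := fun n => ∑ r, ∑ s ∈ hi, |N n r s|
  have hαβ : Tendsto (fun n => α n * β n) atTop (𝓝 0) := by
    have h1 : ∀ n, α n * β n = ∑ r, ∑ s ∈ lo, ∑ r', ∑ s' ∈ hi, |D n r s * N n r' s'| := fun n => by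
      simp only [α, β, Finset.sum_mul, abs_mul]
      simp only [Finset.mul_sum]
    simp only [h1]
    rw [show (0 : ℝ) = ∑ r : Fin (p + q), ∑ s ∈ lo, ∑ r' : Fin (p + q), ∑ s' ∈ hi, |(0 : ℝ)| by simp]
    refine tendsto_finsetSum _ fun r _ => tendsto_finsetSum _ fun s hs =>
      tendsto_finsetSum _ fun r' _ => tendsto_finsetSum _ fun s' hs' => Tendsto.abs ?_
    have h2 : (s : ℕ) < p + q - j := (Finset.mem_filter.mp hs).2
    have h3 : p + q - j ≤ (s' : ℕ) := (Finset.mem_filter.mp hs').2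
    exact tendsto_mul_inv_entry hD hQ' hQlim hRlim hdiv (by rw [Fin.lt_def]; omega)
      (by omega) r r'
  obtain ⟨C₁, hC₁, h₁⟩ := exists_norm_lin_le H'
  obtain ⟨C₂, hC₂, h₂⟩ := exists_norm_lin_le H
  obtain ⟨C₃, hC₃, h₃⟩ := exists_norm_lin_le G
  obtain ⟨C₄, hC₄, h₄⟩ := exists_norm_lin_le G'
  obtain ⟨C₅, hC₅, h₅⟩ := exists_eventually_norm_lin_le hF
  obtain ⟨C₆, hC₆, h₆⟩ := exists_eventually_norm_lin_le hFi
  have hα0 : ∀ n, 0 ≤ α n := fun n => by positivity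
  have hβ0 : ∀ n, 0 ≤ β n := fun n => by positivity
  have hgF : ∀ n, g n * (G' * F n) = H' * D n := fun n => by
    rw [hg]
    calc _ = H' * M n * (G * G') * F n := by simp only [mul_assoc]
      _ = _ := by rw [hG, mul_one, mul_assoc]
  -- The weakly expanded complement is the standard coordinate subspace in the adapted frame,
  -- carried back by `G' * F n`; the changes of frame cost only bounded factors.
  refine tendsto_cartanAttractor (by omega) hU
    (C := fun n => mapSub (G' * F n) (firstSpan (p + q) (p + q - j)))
    (a := fun n => C₁ * (α n * (C₆ * C₃))) (b := fun n => C₄ * (C₅ * (β n * C₂))) ?_ ?_ ?_ ?_ ?_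
  · rw [finrank_mapSub hH, finrank_lastSpan (by omega)]
  · filter_upwards [hFu] with n hn
    rw [finrank_mapSub (A := (F n)⁻¹ * G), finrank_firstSpan (by omega)]
    rw [mul_assoc, ← mul_assoc G, hG, one_mul, Matrix.nonsing_inv_mul _ hn]
  · filter_upwards [hFu, h₆] with n hn h₆ v hv
    obtain ⟨t, ht, rfl⟩ := hv
    have h7 : t = Matrix.toEuclideanLin (F n)⁻¹ (Matrix.toEuclideanLin G
        (Matrix.toEuclideanLin (G' * F n) t)) := by
      rw [← lin_mul, ← lin_mul, mul_assoc, ← mul_assoc G, hG, one_mul, Matrix.nonsing_inv_mul _ hn,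
        lin_one]
    have h8 := abs_lin_apply_le (D n) lo (v := t) fun i hi =>
      mem_firstSpan.mp ht i (by simpa [lo] using hi)
    rw [← lin_mul, hgF, lin_mul]
    have h9 : ‖t‖ ≤ C₆ * (C₃ * ‖Matrix.toEuclideanLin (G' * F n) t‖) := by
      conv_lhs => rw [h7]
      exact (h₆ _).trans (mul_le_mul_of_nonneg_left (h₃ _) hC₆.le)
    calc _ ≤ C₁ * ‖Matrix.toEuclideanLin (D n) t‖ := h₁ _
      _ ≤ C₁ * (α n * ‖t‖) := mul_le_mul_of_nonneg_left h8 hC₁.le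
      _ ≤ C₁ * (α n * (C₆ * (C₃ * ‖Matrix.toEuclideanLin (G' * F n) t‖))) :=
        mul_le_mul_of_nonneg_left (mul_le_mul_of_nonneg_left h9 (hα0 n)) hC₁.le
      _ = _ := by ring
  · filter_upwards [hDN, h₅] with n hn h₅ w hw
    obtain ⟨t, ht, rfl⟩ := hw
    refine ⟨Matrix.toEuclideanLin (G' * F n) (Matrix.toEuclideanLin (N n) t), ?_, ?_⟩
    · rw [← lin_mul, ← lin_mul, hgF, mul_assoc, hn, mul_one]
    · have h7 : t = Matrix.toEuclideanLin H (Matrix.toEuclideanLin H' t) := by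
        rw [← lin_mul, hH, lin_one]
      have h8 := abs_lin_apply_le (N n) hi (v := t) fun i hi' =>
        mem_lastSpan.mp ht i (by
          have : ¬ p + q - j ≤ (i : ℕ) := by simpa [hi] using hi'
          omega)
      have h9 : ‖t‖ ≤ C₂ * ‖Matrix.toEuclideanLin H' t‖ := by
        conv_lhs => rw [h7]
        exact h₂ _
      rw [lin_mul]
      calc _ ≤ C₄ * ‖Matrix.toEuclideanLin (F n) (Matrix.toEuclideanLin (N n) t)‖ := h₄ _
        _ ≤ C₄ * (C₅ * ‖Matrix.toEuclideanLin (N n) t‖) :=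
          mul_le_mul_of_nonneg_left (h₅ _) hC₄.le
        _ ≤ C₄ * (C₅ * (β n * ‖t‖)) := by gcongr
        _ ≤ C₄ * (C₅ * (β n * (C₂ * ‖Matrix.toEuclideanLin H' t‖))) := by
          have := hβ0 n
          gcongr
        _ = _ := by ring
  · have := hαβ.const_mul (C₁ * (C₆ * C₃) * (C₄ * C₅ * C₂))
    rw [mul_zero] at this
    exact this.congr fun n => by ring

end Dynamics

/-! ### Cyclic order on the circle -/

section Circle

theorem sbtw_of_btw_of_ne {α : Type*} [CircularOrder α] {a b c : α} (h : btw a b c) (hab : a ≠ b)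
    (hbc : b ≠ c) (hca : c ≠ a) : sbtw a b c :=
  sbtw_iff_btw_not_btw.mpr ⟨h, fun h' => by
    rcases h.antisymm h' with h | h | h
    exacts [hab h, hbc h, hca h]⟩

theorem sbtw_or_sbtw {α : Type*} [CircularOrder α] {a b c : α} (hab : a ≠ b)
    (hbc : b ≠ c) (hca : c ≠ a) : sbtw a b c ∨ sbtw c b a :=
  (btw_total a b c).imp (fun h => sbtw_of_btw_of_ne h hab hbc hca)
    fun h => sbtw_of_btw_of_ne h hbc.symm hab.symm hca.symm

theorem exists_sbtw {a c : UnitAddCircle} (hac : a ≠ c) : ∃ b, sbtw a b c := by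
  induction a using QuotientAddGroup.induction_on with | H a => ?_
  have hc : c ∈ ((↑) '' Set.Ico a (a + 1) : Set (AddCircle (1 : ℝ))) := by
    rw [AddCircle.coe_image_Ico_eq]; trivial
  obtain ⟨c, hc, rfl⟩ := hc
  have hne : a ≠ c := fun h => hac (by rw [h])
  have hlt : a < c := lt_of_le_of_ne hc.1 hne
  have hc2 := hc.2
  -- With lifts `a < c < a + 1`, the midpoint represents a point strictly between.
  have hb : (a + c) / 2 ∈ Set.Ico a (a + 1) := ⟨by linarith, by linarith⟩
  have h1 : toIcoMod (one_pos : (0 : ℝ) < 1) a ((a + c) / 2) = (a + c) / 2 :=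
    (toIcoMod_eq_iff _).mpr ⟨hb, 0, by simp⟩
  have h2 : toIocMod (one_pos : (0 : ℝ) < 1) a c = c :=
    (toIocMod_eq_iff _).mpr ⟨⟨hlt, hc2.le⟩, 0, by simp⟩
  refine ⟨(((a + c) / 2 : ℝ) : AddCircle (1 : ℝ)), sbtw_of_btw_of_ne ?_ ?_ ?_ hac.symm⟩
  · refine QuotientAddGroup.btw_coe_iff.mpr ?_
    rw [h1, h2]; linarith
  · intro h
    have := (AddCircle.coe_eq_coe_iff_of_mem_Ico ⟨le_rfl, by linarith⟩ hb).mp h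
    linarith
  · intro h
    have := (AddCircle.coe_eq_coe_iff_of_mem_Ico hb hc).mp h
    linarith

end Circle

/-! ### Flags, their images and their transversality -/

section Flags

variable {p q : ℕ}

theorem formQ_of_isInSO₀ {g : Matrix (Fin (p + q)) (Fin (p + q)) ℝ} (hg : IsInSO₀ g) :
    g.transpose * formQ p q * g = formQ p q :=
  (connectedComponentIn_subset _ _ hg).1

theorem mul_formQ_inv {g : Matrix (Fin (p + q)) (Fin (p + q)) ℝ}
    (hg : g.transpose * formQ p q * g = formQ p q) :
    g * (formQ p q * g.transpose * formQ p q) = 1 := by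
  rw [← mul_assoc, ← mul_assoc, mul_formQ_transpose hg, formQ_mul_self]

/-- The member of dimension `l` of the flag, or the whole space when there is none. -/
def IsotropicFlag.ext (A : IsotropicFlag p q) (l : ℕ) : Submodule ℝ (E (p + q)) :=
  if h : (1 ≤ l ∧ l ≤ p - 1) ∨ (q + 1 ≤ l ∧ l ≤ q + p - 1) then A.sub ⟨l, h⟩ else ⊤

theorem mapSub_top {d : ℕ} {g g' : Matrix (Fin d) (Fin d) ℝ} (h : g * g' = 1) :
    mapSub g ⊤ = ⊤ :=
  eq_top_iff.mpr fun v _ => ⟨Matrix.toEuclideanLin g' v, trivial, by rw [← lin_mul, h, lin_one]⟩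

theorem lastSpan_top {d : ℕ} : lastSpan d d = ⊤ :=
  eq_top_iff.mpr fun v _ => mem_lastSpan.mpr fun i hi => by omega

theorem firstSpan_top {d : ℕ} : firstSpan d d = ⊤ :=
  eq_top_iff.mpr fun v _ => mem_firstSpan.mpr fun i hi => by omega

theorem IsotropicFlag.ext_coe (A : IsotropicFlag p q) (l : FlagIndex p q) : A.ext l.1 = A.sub l :=
  dif_pos l.2

theorem IsotropicFlag.ext_top (A : IsotropicFlag p q) (hp : 1 ≤ p) : A.ext (p + q) = ⊤ :=
  dif_neg (by omega)

theorem mem_of_mapSub_eq {d : ℕ} {g g' : Matrix (Fin d) (Fin d) ℝ} (h : g * g' = 1)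
    {V W : Submodule ℝ (E d)} (hV : mapSub g V = W) {w : E d} (hw : w ∈ W) :
    Matrix.toEuclideanLin g' w ∈ V := by
  rw [← hV] at hw
  obtain ⟨v, hv, rfl⟩ := hw
  rwa [← lin_mul, mul_eq_one_comm.mp h, lin_one]

theorem lin_mem_of_mapSub_eq {d : ℕ} {g : Matrix (Fin d) (Fin d) ℝ}
    {V W : Submodule ℝ (E d)} (hV : mapSub g V = W) {v : E d} (hv : v ∈ V) :
    Matrix.toEuclideanLin g v ∈ W := hV ▸ ⟨v, hv, rfl⟩

theorem mapSub_eq_comm {d : ℕ} {g g' : Matrix (Fin d) (Fin d) ℝ} (h : g * g' = 1)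
    {V W : Submodule ℝ (E d)} (hV : mapSub g V = W) : mapSub g' W = V := by
  refine le_antisymm ?_ fun v hv => ⟨_, lin_mem_of_mapSub_eq hV hv, ?_⟩
  · rintro _ ⟨w, hw, rfl⟩
    exact mem_of_mapSub_eq h hV hw
  · rw [← lin_mul, mul_eq_one_comm.mp h, lin_one]

theorem sup_eq_top_of_mapSub {d : ℕ} {g g' : Matrix (Fin d) (Fin d) ℝ} (h : g * g' = 1)
    {V W V' W' : Submodule ℝ (E d)} (hV : mapSub g V = V') (hW : mapSub g W = W')
    (htop : V' ⊔ W' = ⊤) : V ⊔ W = ⊤ := by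
  rw [← mapSub_eq_comm h hV, ← mapSub_eq_comm h hW, mapSub, mapSub, ← Submodule.map_sup, htop]
  exact mapSub_top (mul_eq_one_comm.mp h)

theorem lastSpan_sup_firstSpan {d l m : ℕ} (h : d ≤ l + m) : lastSpan d l ⊔ firstSpan d m = ⊤ := by
  refine eq_top_iff.mpr fun v _ => ?_
  let a : E d := WithLp.toLp 2 fun i => if (i : ℕ) < m then v i else 0
  have hv : v = (v - a) + a := by abel
  rw [hv]
  refine Submodule.add_mem_sup (mem_lastSpan.mpr fun i hi => ?_) (mem_firstSpan.mpr fun i hi => ?_)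
  · have : (i : ℕ) < m := by omega
    simp [a, this]
  · simp [a, not_lt.mpr hi]

theorem IsUnip.exists_mul_eq_one {d : ℕ} {P : Matrix (Fin d) (Fin d) ℝ} (hP : IsUnip P) :
    ∃ P', P * P' = 1 := by
  have hdet : IsUnit P.det := by
    rw [Matrix.det_of_isUpperTriangular (fun i j h => hP.1 i j h)]
    simp [hP.2]
  exact ⟨P⁻¹, Matrix.mul_nonsing_inv _ hdet⟩

theorem IsUnip.lin_mem_firstSpan {d : ℕ} {P : Matrix (Fin d) (Fin d) ℝ} (hP : IsUnip P) {l : ℕ}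
    {t : E d} (ht : t ∈ firstSpan d l) : Matrix.toEuclideanLin P t ∈ firstSpan d l := by
  rw [mem_firstSpan] at ht ⊢
  intro i hi
  rw [lin_apply]
  refine Finset.sum_eq_zero fun k _ => ?_
  by_cases hk : k < i
  · rw [hP.1 i k hk, zero_mul]
  · rw [ht k (hi.trans (not_lt.mp hk)), mul_zero]

theorem IsUnip.mapSub_lastSpan_sup_firstSpan {d : ℕ} {P : Matrix (Fin d) (Fin d) ℝ}
    (hP : IsUnip P) {l m : ℕ} (h : d ≤ l + m) :
    mapSub P (lastSpan d l) ⊔ firstSpan d m = ⊤ := by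
  obtain ⟨P', hP'⟩ := hP.exists_mul_eq_one
  rw [eq_top_iff, ← mapSub_top hP', ← lastSpan_sup_firstSpan h, mapSub, Submodule.map_sup]
  refine sup_le_sup le_rfl ?_
  rintro _ ⟨t, ht, rfl⟩
  exact hP.lin_mem_firstSpan ht

theorem single_mem_lastSpan {d l : ℕ} {i : Fin d} (h : d ≤ (i : ℕ) + l) :
    (EuclideanSpace.single i 1 : E d) ∈ lastSpan d l := Submodule.subset_span ⟨i, h, rfl⟩

theorem single_mem_firstSpan {d l : ℕ} {i : Fin d} (h : (i : ℕ) < l) :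
    (EuclideanSpace.single i 1 : E d) ∈ firstSpan d l := Submodule.subset_span ⟨i, h, rfl⟩

end Flags

/-! ### Cartan attractors from moving triples of flags -/

section Limits

variable {p q : ℕ}

/-- A sequence in `SO(p,q)` moving a triple of flags towards one member of a positive triple has
that member as limit of its Cartan attractors. -/
theorem tendsto_attractor_of_flags (hpq : p < q) (hp : 3 ≤ p)
    {g : ℕ → Matrix (Fin (p + q)) (Fin (p + q)) ℝ}
    (hg : ∀ n, (g n).transpose * formQ p q * g n = formQ p q)
    {A B Y W W' : IsotropicFlag p q} {X Z Y' : ℕ → IsotropicFlag p q}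
    (hX : ∀ n l, mapSub (g n) ((X n).sub l) = A.sub l)
    (hZ : ∀ n l, mapSub (g n) ((Z n).sub l) = B.sub l)
    (hY : ∀ n l, mapSub (g n) (Y.sub l) = (Y' n).sub l)
    (hXlim : ∀ l, Tendsto (fun n => ((X n).sub l).starProjection) atTop
      (𝓝 (W.sub l).starProjection))
    (hZlim : ∀ l, Tendsto (fun n => ((Z n).sub l).starProjection) atTop
      (𝓝 (W'.sub l).starProjection))
    (hYlim : ∀ l, Tendsto (fun n => ((Y' n).sub l).starProjection) atTop
      (𝓝 (A.sub l).starProjection))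
    (hpos : IsPositiveTriple W Y W') {H : Matrix (Fin (p + q)) (Fin (p + q)) ℝ}
    (hHQ : H.transpose * formQ p q * H = formQ p q)
    (hHA : ∀ l, mapSub H (A.sub l) = lastSpan (p + q) l.1)
    (hHB : ∀ l, mapSub H (B.sub l) = firstSpan (p + q) l.1)
    (j : FlagIndex p q) {U : ℕ → Submodule ℝ (E (p + q))}
    (hU : ∀ n, IsCartanAttractor j.1 (g n) (U n)) :
    Tendsto (fun n => (U n).starProjection) atTop (𝓝 (A.sub j).starProjection) := by
  obtain ⟨G, hGSO, v, hGv⟩ := hpos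
  have hGQ := formQ_of_isInSO₀ hGSO
  have hGG' := mul_formQ_inv hGQ
  set G' := formQ p q * G.transpose * formQ p q with hG'
  have hHH' := mul_formQ_inv hHQ
  set H' := formQ p q * H.transpose * formQ p q with hH'
  have hG'G := mul_eq_one_comm.mp hGG'
  have hH'H := mul_eq_one_comm.mp hHH'
  set P : Matrix (Fin (p + q)) (Fin (p + q)) ℝ := posElem v
  have hP : IsPosFrom (q + 1) P := posElem_isPosFrom hpq hp v
  obtain ⟨u, hPu, hu⟩ := posElem_midVector hpq (by omega : 2 ≤ p) v
  have hgg' : ∀ n, ∃ g', g n * g' = 1 := fun n => ⟨_, mul_formQ_inv (hg n)⟩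
  have hmap : ∀ (K : Matrix (Fin (p + q)) (Fin (p + q)) ℝ), (∃ K', K * K' = 1) →
      ∀ (V : IsotropicFlag p q) (f : ℕ → Submodule ℝ (E (p + q))),
      (∀ l : FlagIndex p q, mapSub K (V.sub l) = f l.1) → f (p + q) = ⊤ →
      ∀ l : ℕ, ((1 ≤ l ∧ l ≤ p - 1) ∨ (q + 1 ≤ l ∧ l ≤ p + q)) → mapSub K (V.ext l) = f l := by
    rintro K ⟨K', hK⟩ V f hf htop l hl
    by_cases h : l = p + q
    · rw [h, V.ext_top (by omega), htop, mapSub_top hK]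
    · have h' : (1 ≤ l ∧ l ≤ p - 1) ∨ (q + 1 ≤ l ∧ l ≤ q + p - 1) := by omega
      exact (congrArg (mapSub K) (V.ext_coe ⟨l, h'⟩)).trans (hf ⟨l, h'⟩)
  have hlim : ∀ (V : ℕ → IsotropicFlag p q) (V₀ : IsotropicFlag p q),
      (∀ l, Tendsto (fun n => ((V n).sub l).starProjection) atTop
        (𝓝 (V₀.sub l).starProjection)) → ∀ l : ℕ,
      Tendsto (fun n => ((V n).ext l).starProjection) atTop (𝓝 (V₀.ext l).starProjection) := by
    intro V V₀ h l
    by_cases hl : (1 ≤ l ∧ l ≤ p - 1) ∨ (q + 1 ≤ l ∧ l ≤ q + p - 1)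
    · have := h ⟨l, hl⟩
      simp only [IsotropicFlag.ext, dif_pos hl]
      exact this
    · simp only [IsotropicFlag.ext, dif_neg hl]
      exact tendsto_const_nhds
  have hGW := hmap G ⟨G', hGG'⟩ W (lastSpan (p + q)) (fun l => (hGv l).1) lastSpan_top
  have hGW' := hmap G ⟨G', hGG'⟩ W' (firstSpan (p + q)) (fun l => (hGv l).2.2) firstSpan_top
  have hHgX : ∀ n l, ((1 ≤ l ∧ l ≤ p - 1) ∨ (q + 1 ≤ l ∧ l ≤ p + q)) → ∀ v ∈ (X n).ext l,
      Matrix.toEuclideanLin H (Matrix.toEuclideanLin (g n) v) ∈ lastSpan (p + q) l :=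
    fun n l hl v hv => lin_mem_of_mapSub_eq
      (hmap H ⟨H', hHH'⟩ A (lastSpan (p + q)) hHA lastSpan_top l hl)
      (lin_mem_of_mapSub_eq (hmap (g n) (hgg' n) (X n) A.ext
        (fun l => by rw [hX, A.ext_coe]) (A.ext_top (by omega)) l hl) hv)
  have hHgZ : ∀ n l, ((1 ≤ l ∧ l ≤ p - 1) ∨ (q + 1 ≤ l ∧ l ≤ p + q)) → ∀ v ∈ (Z n).ext l,
      Matrix.toEuclideanLin H (Matrix.toEuclideanLin (g n) v) ∈ firstSpan (p + q) l :=
    fun n l hl v hv => lin_mem_of_mapSub_eq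
      (hmap H ⟨H', hHH'⟩ B (firstSpan (p + q)) hHB firstSpan_top l hl)
      (lin_mem_of_mapSub_eq (hmap (g n) (hgg' n) (Z n) B.ext
        (fun l => by rw [hZ, B.ext_coe]) (B.ext_top (by omega)) l hl) hv)
  -- In the standard position, members of dimensions `hi i` and `lo i` of the two transverse flags
  -- meet in the axis `e_i` for `i` outside the middle block, and in the whole middle block
  -- otherwise. Dimension `d` occurs at the extreme indices, which is why `ext` is used.
  let hi : Fin (p + q) → ℕ := fun i => if p ≤ (i : ℕ) + 1 ∧ (i : ℕ) ≤ q then q + 1 else p + q - i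
  let lo : Fin (p + q) → ℕ := fun i => if p ≤ (i : ℕ) + 1 ∧ (i : ℕ) ≤ q then q + 1 else i + 1
  have hhi : ∀ i, ((1 ≤ hi i ∧ hi i ≤ p - 1) ∨ (q + 1 ≤ hi i ∧ hi i ≤ p + q)) := fun i => by
    have := i.2
    simp only [hi]; split_ifs <;> omega
  have hlo : ∀ i, ((1 ≤ lo i ∧ lo i ≤ p - 1) ∨ (q + 1 ≤ lo i ∧ lo i ≤ p + q)) := fun i => by
    have := i.2
    simp only [lo]; split_ifs <;> omega
  have hframe : ∀ i, ∃ f : ℕ → E (p + q), (∀ n, f n ∈ (X n).ext (hi i)) ∧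
      (∀ n, f n ∈ (Z n).ext (lo i)) ∧
      Tendsto f atTop (𝓝 (Matrix.toEuclideanLin G' (EuclideanSpace.single i 1))) := by
    intro i
    have hi2 := i.2
    refine exists_tendsto_mem_inter (hlim X W hXlim _) (hlim Z W' hZlim _)
      (sup_eq_top_of_mapSub hGG' (hGW _ (hhi i)) (hGW' _ (hlo i)) (lastSpan_sup_firstSpan ?_))
      (mem_of_mapSub_eq hGG' (hGW _ (hhi i)) (single_mem_lastSpan ?_))
      (mem_of_mapSub_eq hGG' (hGW' _ (hlo i)) (single_mem_firstSpan ?_))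
    all_goals
      simp only [hi, lo]; split_ifs <;> omega
  choose f hfX hfZ hflim using hframe
  -- In the frame `G`, these vectors approximate the columns of `P`. They are chosen in `Y ^ (d -
  -- x)`, whose images approach `A`, and in `Z n ^ (x + 1)`, whose images lie in `B`.
  have hcol : ∀ x : Fin (p + q), ∃ w : ℕ → E (p + q), q + 1 ≤ (x : ℕ) →
      (∀ n, w n ∈ Y.ext (p + q - x)) ∧ (∀ n, w n ∈ (Z n).ext (x + 1)) ∧
      Tendsto w atTop (𝓝 (Matrix.toEuclideanLin G'
        (Matrix.toEuclideanLin P (EuclideanSpace.single x 1)))) := by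
    intro x
    by_cases hx : q + 1 ≤ (x : ℕ)
    swap
    · exact ⟨0, fun h => absurd h hx⟩
    have hx2 := x.2
    have hGY := hmap G ⟨G', hGG'⟩ Y (fun l => mapSub P (lastSpan (p + q) l))
      (fun l => (hGv l).2.1) (by
        obtain ⟨P', hP'⟩ := hP.1.1.exists_mul_eq_one
        simp only [lastSpan_top, mapSub_top hP']) (p + q - x) (by omega)
    obtain ⟨w, hw⟩ := exists_tendsto_mem_inter (A := fun _ => Y.ext (p + q - x))
      (C := fun n => (Z n).ext (x + 1)) tendsto_const_nhds (hlim Z W' hZlim _)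
      (sup_eq_top_of_mapSub hGG' hGY (hGW' (x + 1) (by omega))
        (hP.1.1.mapSub_lastSpan_sup_firstSpan (by omega)))
      (mem_of_mapSub_eq hGG' hGY ⟨_, single_mem_lastSpan (i := x) (by omega), rfl⟩)
      (mem_of_mapSub_eq hGG' (hGW' _ (by omega))
        (hP.1.1.lin_mem_firstSpan (single_mem_firstSpan (by omega))))
    exact ⟨w, fun _ => hw⟩
  choose w hw using hcol
  let M := fun n => H * g n * G'
  -- The columns are the frame vectors `f i n` in the coordinates `G`. They tend to the standard
  -- basis, and `M n * F n` is block diagonal because `g n` carries `X n, Z n` to `A, B`.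
  let F : ℕ → Matrix (Fin (p + q)) (Fin (p + q)) ℝ := fun n =>
    Matrix.of fun r i => Matrix.toEuclideanLin G (f i n) r
  have hG'Q : G'.transpose * formQ p q * G' = formQ p q := by
    simp only [hG', Matrix.transpose_mul, Matrix.transpose_transpose, formQ_transpose]
    calc _ = formQ p q * (G * (formQ p q * formQ p q) * formQ p q * G.transpose) * formQ p q := by
          simp only [mul_assoc]
      _ = _ := by
          rw [formQ_mul_self, mul_one, mul_formQ_transpose hGQ, formQ_mul_self, one_mul]
  have hMG : ∀ n v, Matrix.toEuclideanLin (M n) (Matrix.toEuclideanLin G v) =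
      Matrix.toEuclideanLin H (Matrix.toEuclideanLin (g n) v) := fun n v => by
    rw [← lin_mul, ← lin_mul, mul_assoc, hG'G, mul_one]
  have hGlim : ∀ {a : ℕ → E (p + q)} {b : E (p + q)},
      Tendsto a atTop (𝓝 (Matrix.toEuclideanLin G' b)) →
      Tendsto (fun n => Matrix.toEuclideanLin G (a n)) atTop (𝓝 b) := fun {a b} h => by
    have := tendsto_lin (A := fun _ => G) (fun i j => tendsto_const_nhds) h
    rwa [← lin_mul, hGG', lin_one] at this
  rw [← mapSub_eq_comm hHH' (hHA j)]
  refine tendsto_attractor_of_blocks hpq (by omega) (M := M) (F := F) (G := G) hHH' hGG' ?_ ?_ ?_ ?_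
    hP hPu hu (y := fun x n => Matrix.toEuclideanLin G (w x n)) (fun x hx => hGlim (hw x hx).2.2)
    ?_ j.2 hU
  · intro n
    calc g n = (H' * H) * g n * (G' * G) := by rw [hH'H, hG'G, one_mul, mul_one]
      _ = _ := by simp only [M, mul_assoc]
  · intro n
    simp only [M, Matrix.transpose_mul]
    calc _ = G'.transpose * ((g n).transpose * (H.transpose * formQ p q * H) * g n) * G' := by
          simp only [mul_assoc]
      _ = _ := by rw [hHQ, hg, hG'Q]
  · refine tendsto_pi_nhds.mpr fun r => tendsto_pi_nhds.mpr fun i => ?_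
    have := Tendsto.euclidean_apply (hGlim (hflim i)) r
    simpa [F, Matrix.one_apply, Pi.single_apply] using this
  · intro n r i hri
    have h1 : (M n * F n) r i = Matrix.toEuclideanLin H (Matrix.toEuclideanLin (g n) (f i n)) r := by
      rw [← hMG, lin_apply, Matrix.mul_apply]; rfl
    have h2 := mem_lastSpan.mp (hHgX n _ (hhi i) _ (hfX i n)) r
    have h3 := mem_firstSpan.mp (hHgZ n _ (hlo i) _ (hfZ i n)) r
    rw [h1]
    by_cases hm : p ≤ (i : ℕ) + 1 ∧ (i : ℕ) ≤ q
    · simp only [hi, lo, if_pos hm] at h2 h3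
      by_cases hr : (r : ℕ) + (q + 1) < p + q
      · exact h2 hr
      · refine h3 ?_
        by_contra hr'
        exact hri (Or.inr ⟨by omega, by omega, hm⟩)
    · simp only [hi, lo, if_neg hm] at h2 h3
      have hne : (r : ℕ) ≠ i := fun h => hri (Or.inl (Fin.ext h))
      by_cases hr : (r : ℕ) < i
      · exact h2 (by omega)
      · exact h3 (by omega)
  · intro x hx
    simp only [hMG]
    have hx2 := x.2
    obtain ⟨hwY, hwZ, -⟩ := hw x hx
    have hl : (1 ≤ p + q - (x : ℕ) ∧ p + q - (x : ℕ) ≤ p - 1) ∨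
        (q + 1 ≤ p + q - (x : ℕ) ∧ p + q - (x : ℕ) ≤ q + p - 1) := by omega
    let l : FlagIndex p q := ⟨p + q - x, hl⟩
    obtain ⟨C₁, hC₁, h₁⟩ := exists_norm_lin_le H
    obtain ⟨C₂, hC₂, h₂⟩ := exists_norm_lin_le H'
    -- In the frame `H`, coordinates after `x` vanish on `B ^ (x + 1)`, and coordinates before `x`
    -- vanish on `A ^ (d - x)`. The image vector lies in the former and in `Y' n ^ (d - x)`, so the
    -- distance of the projections to `A` and `Y' n` bounds the remaining coordinates.
    refine tendsto_coord_div (δ := fun n => C₁ * (‖((Y' n).sub l).starProjection -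
      (A.sub l).starProjection‖ * C₂)) ?_ ?_
    · have := ((tendsto_iff_norm_sub_tendsto_zero.mp (hYlim l)).mul_const C₂).const_mul C₁
      simpa using this
    intro n i hix
    set a := Matrix.toEuclideanLin (g n) (w x n) with ha
    have haY : a ∈ (Y' n).sub l := by
      refine lin_mem_of_mapSub_eq (hY n l) ?_
      have := hwY n
      rwa [show p + q - (x : ℕ) = l.1 from rfl, Y.ext_coe] at this
    by_cases hlt : i < x
    swap
    · have h3 := mem_firstSpan.mp (hHgZ n (x + 1) (by omega) _ (hwZ n)) i (by
        have : (i : ℕ) ≠ x := fun h => hix (Fin.ext h)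
        rw [Fin.lt_def] at hlt
        omega)
      rw [← ha] at h3
      rw [h3, abs_zero]
      positivity
    · have hlt' : (i : ℕ) < x := hlt
      have h3 : Matrix.toEuclideanLin H ((A.sub l).starProjection a) i = 0 :=
        mem_lastSpan.mp (lin_mem_of_mapSub_eq (hHA l)
          (Submodule.starProjection_apply_mem (A.sub l) a)) i (by
            simp only [l]; omega)
      have h4 : Matrix.toEuclideanLin H a i = Matrix.toEuclideanLin H
          ((((Y' n).sub l).starProjection - (A.sub l).starProjection) a) i := by
        rw [sub_apply, map_sub, PiLp.sub_apply, h3, sub_zero,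
          Submodule.starProjection_eq_self_iff.mpr haY]
      have h5 : ‖a‖ ≤ C₂ * ‖Matrix.toEuclideanLin H a‖ := by
        conv_lhs => rw [← lin_one a, ← hH'H, lin_mul]
        exact h₂ _
      rw [h4]
      calc _ ≤ _ := abs_apply_le_norm _ _
        _ ≤ _ := h₁ _
        _ ≤ C₁ * (‖((Y' n).sub l).starProjection - (A.sub l).starProjection‖ * ‖a‖) :=
          mul_le_mul_of_nonneg_left (ContinuousLinearMap.le_opNorm _ _) hC₁.le
        _ ≤ C₁ * (‖((Y' n).sub l).starProjection - (A.sub l).starProjection‖ *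
            (C₂ * ‖Matrix.toEuclideanLin H a‖)) := by gcongr
        _ = _ := by ring

end Limits

/-! ### The positive flag map gives the boundary maps -/

section BoundaryMaps

variable {Γ : Type*} [Group Γ] {S : Finset Γ} {p q : ℕ}

theorem act_act_inv (g : Γ) (x : Boundary S) : Boundary.act g (Boundary.act g⁻¹ x) = x := by
  induction x using Quot.ind with | mk r => ?_
  refine congrArg (Quot.mk _) ?_
  simp [GeodesicRay.translate]

/-- The flag map of a `Θ`-positive representation consists of boundary maps. -/
theorem isBoundaryMap_flag (hS : Subgroup.closure (S : Set Γ) = ⊤) (hyp : IsHyperbolic S)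
    (φ : Boundary S ≃ₜ UnitAddCircle) (hpq : p < q) (hp : 3 ≤ p) {ρ : Γ →* SO p q}
    {ξ : Boundary S → IsotropicFlag p q}
    (hξ : ∀ l, Continuous fun x => ((ξ x).sub l).starProjection)
    (hact : ∀ γ x l, (ξ (Boundary.act γ x)).sub l =
      mapSub (ρ γ : Matrix.SpecialLinearGroup (Fin (p + q)) ℝ).1 ((ξ x).sub l))
    (hpos : ∀ z y x : Boundary S, sbtw (φ z) (φ y) (φ x) → IsPositiveTriple (ξ z) (ξ y) (ξ x))
    (j : FlagIndex p q) :
    IsBoundaryMap S ((SO p q).subtype.comp ρ) j.1 (fun x => (ξ x).sub j) := by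
  intro r U hU
  refine tendsto_of_subseq_tendsto fun ns hns => ?_
  obtain ⟨ms, w, w', -, hww', hw, hw', hy⟩ := exists_attracting_repelling hS hyp r ns hns
  refine ⟨ms, ?_⟩
  -- A point between `w` and `w'` makes the limiting triple positive; it also differs from the
  -- repelling point `w'`, so it is attracted to the end of the ray.
  obtain ⟨b, hb⟩ := exists_sbtw (φ.injective.ne hww')
  obtain ⟨y, rfl⟩ := φ.surjective b
  have hyw' : y ≠ w' := fun h => sbtw_irrefl_right (h ▸ hb)
  obtain ⟨z, hz⟩ : ∃ z, z ≠ r.endpoint := by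
    by_contra! h
    exact hww' ((h w).trans (h w').symm)
  -- This third point serves only to place `r.endpoint` and `z` in a positive triple, whose
  -- normalization `H` brings their two flags to standard position.
  obtain ⟨b', hb'⟩ := exists_sbtw (φ.injective.ne hz.symm)
  obtain ⟨y', rfl⟩ := φ.surjective b'
  obtain ⟨H, hHSO, v, hH⟩ := hpos _ _ _ hb'
  refine tendsto_attractor_of_flags hpq hp
    (g := fun n => (ρ (r.vertex (ns (ms n))) : Matrix.SpecialLinearGroup (Fin (p + q)) ℝ).1)
    (fun n => (ρ (r.vertex (ns (ms n)))).2)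
    (X := fun n => ξ (Boundary.act (r.vertex (ns (ms n)))⁻¹ r.endpoint))
    (Z := fun n => ξ (Boundary.act (r.vertex (ns (ms n)))⁻¹ z))
    (Y' := fun n => ξ (Boundary.act (r.vertex (ns (ms n))) y)) ?_ ?_ (fun n l => (hact _ _ _).symm)
    (fun l => ((hξ l).tendsto _).comp hw) (fun l => ((hξ l).tendsto _).comp (hw' z hz))
    (fun l => ((hξ l).tendsto _).comp (hy y hyw')) (hpos _ _ _ hb) (formQ_of_isInSO₀ hHSO)
    (fun l => (hH l).1) (fun l => (hH l).2.2) j (fun n => hU (ns (ms n)))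
  · intro n l
    rw [← hact, act_act_inv]
  · intro n l
    rw [← hact, act_act_inv]

theorem isBoundaryMap_top {d : ℕ} {ρ : Γ →* Matrix.SpecialLinearGroup (Fin d) ℝ} :
    IsBoundaryMap S ρ d (fun _ => ⊤) := by
  intro r U hU
  have h : U = fun _ => ⊤ := funext fun n => by
    obtain ⟨K, hK, -, -, -, h⟩ := hU n
    rw [h, firstSpan_top, mapSub_top (mul_transpose_of_mem hK)]
  rw [h]
  exact tendsto_const_nhds

end BoundaryMaps

/-! ### Directness for positive triples -/

section Directness

theorem iSupIndep_of_sum_eq_zero {d : ℕ} {V₁ V₂ V₃ : Submodule ℝ (E d)}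
    (h : ∀ v₁ ∈ V₁, ∀ v₂ ∈ V₂, ∀ v₃ ∈ V₃, v₁ + v₂ + v₃ = 0 → v₁ = 0 ∧ v₂ = 0 ∧ v₃ = 0) :
    iSupIndep ![V₁, V₂, V₃] := by
  rw [iSupIndep_iff_finsetSum_eq_zero_imp_eq_zero]
  intro s v hv hsum
  let v' : Fin 3 → E d := fun i => if i ∈ s then v i else 0
  have hv' : ∀ i, v' i ∈ ![V₁, V₂, V₃] i := fun i => by
    by_cases hi : i ∈ s
    · simpa only [v', if_pos hi] using hv i hi
    · simp only [v', if_neg hi]; exact zero_mem _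
  have hsum' : v' 0 + v' 1 + v' 2 = 0 := by
    rw [← Fin.sum_univ_three, ← hsum]
    simp [v', Finset.sum_ite_mem]
  obtain ⟨h0, h1, h2⟩ := h _ (hv' 0) _ (hv' 1) _ (hv' 2) hsum'
  intro i hi
  have : v' i = 0 := by
    fin_cases i
    exacts [h0, h1, h2]
  simpa only [v', if_pos hi] using this

variable {p q : ℕ}

/-- Transversality of the partial flags in a positive triple. -/
theorem iSupIndep_of_isPositiveTriple (hpq : p < q) {k : ℕ} (hk : 1 ≤ k) (hkp : k + 3 ≤ p)
    {A B C X Y : IsotropicFlag p q} (hpos : IsPositiveTriple A B C)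
    (hXY : (X = A ∧ Y = B) ∨ (X = B ∧ Y = A)) :
    iSupIndep ![C.ext (p + q - k - 2), X.ext k ⊓ C.ext (p + q - k + 1), Y.ext (k + 1)] := by
  obtain ⟨g, hg, v, hv⟩ := hpos
  have hinj := lin_injective (mul_eq_one_comm.mp (mul_formQ_inv (formQ_of_isInSO₀ hg)))
  have hmem : ∀ (V : IsotropicFlag p q) (f : ℕ → Submodule ℝ (E (p + q))),
      (∀ l : FlagIndex p q, mapSub g (V.sub l) = f l.1) → ∀ l : ℕ,
      ((1 ≤ l ∧ l ≤ p - 1) ∨ (q + 1 ≤ l ∧ l ≤ q + p - 1)) → ∀ s ∈ V.ext l,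
      Matrix.toEuclideanLin g s ∈ f l := fun V f hf l hl s hs => by
    rw [IsotropicFlag.ext, dif_pos hl] at hs
    exact lin_mem_of_mapSub_eq (hf ⟨l, hl⟩) hs
  have hA := hmem A (lastSpan (p + q)) fun l => (hv l).1
  have hB := hmem B (fun l => mapSub (posElem v) (lastSpan (p + q) l)) fun l => (hv l).2.1
  have hC := hmem C (firstSpan (p + q)) fun l => (hv l).2.2
  refine iSupIndep_of_sum_eq_zero fun s₁ h₁ s₂ h₂ s₃ h₃ hsum => ?_
  have hs₁ := hC (p + q - k - 2) (by omega) s₁ h₁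
  have hs₂ : Matrix.toEuclideanLin g s₂ ∈ firstSpan (p + q) (p + q - k + 1) := by
    by_cases hk1 : p + q - k + 1 = p + q
    · rw [hk1, firstSpan_top]
      exact Submodule.mem_top
    · exact hC (p + q - k + 1) (by omega) s₂ h₂.2
  have hsum' : Matrix.toEuclideanLin g s₁ + Matrix.toEuclideanLin g s₂ +
      Matrix.toEuclideanLin g s₃ = 0 := by
    rw [← map_add, ← map_add, hsum, map_zero]
  have h := sum_eq_zero_imp_of_pos hpq (posElem_isPosFrom hpq (by omega) v) hk hkp hs₁ hs₂ hsum' (by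
    rcases hXY with ⟨hX, hY⟩ | ⟨hX, hY⟩
    · rw [hX] at h₂
      rw [hY] at h₃
      exact Or.inl ⟨hA k (by omega) s₂ h₂.1, hB (k + 1) (by omega) s₃ h₃⟩
    · rw [hX] at h₂
      rw [hY] at h₃
      exact Or.inr ⟨hB k (by omega) s₂ h₂.1, hA (k + 1) (by omega) s₃ h₃⟩)
  simpa only [map_eq_zero_iff _ hinj] using h

end Directness

end ThetaPos
end

/-! ### The proposition -/

theorem proposition1p6 {Γ : Type*} [Group Γ] (S : Finset Γ)
    (hS : Subgroup.closure (S : Set Γ) = ⊤) (hyp : ThetaPos.IsHyperbolic S)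
    (φ : ThetaPos.Boundary S ≃ₜ UnitAddCircle) {p q : ℕ} (hpq : p < q)
    (ρ : Γ →* ThetaPos.SO p q)
    (hAnosov : ∀ j : ℕ, 1 ≤ j → j ≤ p - 1 →
      ThetaPos.IsAnosov S ((ThetaPos.SO p q).subtype.comp ρ) j)
    (hpos : ThetaPos.IsThetaPositive S φ ρ) (k : ℕ) (hk : 1 ≤ k) (hkp : k + 3 ≤ p) :
    ThetaPos.PropertyC S ((ThetaPos.SO p q).subtype.comp ρ) k := by
  obtain ⟨ξ, hξ, hact, htriple⟩ := hpos
  refine ⟨?_, fun j x => (ξ x).ext j, ?_, ?_⟩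
  · intro j hj hj0 hjd
    have hsymm : ∀ i, 1 ≤ i → i ≤ p - 1 →
        ThetaPos.IsAnosov S ((ThetaPos.SO p q).subtype.comp ρ) (p + q - i) := fun i hi hip =>
      ThetaPos.isAnosov_symm hi (by omega) (hAnosov i hi hip)
    simp only [Set.mem_insert_iff, Set.mem_singleton_iff] at hj
    rcases hj with rfl | rfl | rfl | rfl
    · exact hAnosov _ hk (by omega)
    · exact hAnosov _ (by omega) (by omega)
    · rw [Nat.sub_sub]
      exact hsymm (k + 2) (by omega) (by omega)
    -- The condition `j < d` excludes `k = 1` here, so `k - 1 ≥ 1` and the symmetry applies.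
    · rw [show p + q - k + 1 = p + q - (k - 1) by omega]
      exact hsymm (k - 1) (by omega) (by omega)
  · intro j hj
    simp only [Set.mem_insert_iff, Set.mem_singleton_iff] at hj
    -- This occurs for `k = 1`, where `d - k + 1 = d` and the boundary map is constant.
    by_cases hjd : j = p + q
    · subst hjd
      simp only [ThetaPos.IsotropicFlag.ext_top _ (by omega : 1 ≤ p)]
      exact ThetaPos.isBoundaryMap_top
    · have hjf : (1 ≤ j ∧ j ≤ p - 1) ∨ (q + 1 ≤ j ∧ j ≤ q + p - 1) := by omega
      simp only [ThetaPos.IsotropicFlag.ext, dif_pos hjf]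
      exact ThetaPos.isBoundaryMap_flag hS hyp φ hpq (by omega) hξ hact htriple ⟨j, hjf⟩
  · intro x y z hxy hyz hxz
    -- The two cyclic orders exchange which of `ξ y`, `ξ z` becomes `X` and which `P X`; `ξ x`
    -- becomes `Z` in both.
    rcases ThetaPos.sbtw_or_sbtw (φ.injective.ne hyz) (φ.injective.ne hxz.symm) (φ.injective.ne hxy)
      with h | h
    · exact ThetaPos.iSupIndep_of_isPositiveTriple hpq hk hkp (htriple y z x h) (Or.inl ⟨rfl, rfl⟩)
    · exact ThetaPos.iSupIndep_of_isPositiveTriple hpq hk hkp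
        (htriple z y x h.cyclic_left) (Or.inr ⟨rfl, rfl⟩)
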